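/- **Setting.** For a family $S$ of $n$ segments in the plane and an axis-parallel square $\square$ of side length $2r$ (radius $r>0$), the congestion of $\square$ is $c(\square)=\frac1r\sum_{s\in S}\|s\cap\square\|$, where $\|\cdot\|$ denotes length. The congestion of $S$ is $\mathrm{cong}(S)=\sup_{\square} c(\square)$, over all axis-parallel squares of positive side length. A canonical square is a half-open cell $[i2^{-\ell},(i+1)2^{-\ell})\times[j2^{-\ell},(j+1)2^{-\ell})$ contained in $[0,1)^2$, with integers $\ell\ge 0$ and $i,j$. A (possibly compressed) quadtree $T$ is a finite rooted tree with a canonical square, called a cell, at every node, such that the cell of every child lies in one of the four congruent quadrants of its parent's cell, and different children of a node lie in different quadrants. Its congestion $\mathrm{cong}(T)$ is the maximum of $c(\square)$ over the cells $\square$ of $T$. Algorithms are programs for the unit-cost real RAM (with $+,-,\times,\div,\sqrt{\cdot}$, floor, rounding down to a power of two, comparisons, and only integer constants) that may flip fair coins. **Lemma.** For every $\varepsilon>0$ and every integer $d\ge 0$ there is a randomized algorithm such that for every $K$ there is a constant $C$ (depending on $\varepsilon$, $d$ and $K$ only) with the following property. Given any $n$ segments $S$ in the plane and any quadtree $T$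 with at most $Kn$ cells, the expected running time of the algorithm is at most $C\,n\log^2(n+1)$, and with probability at least $1-n^{-d}$ it outputs a number $\hat c$ with $$\frac{\mathrm{cong}(T)}{4\sqrt2+\varepsilon}\;\le\;\hat c\;\le\;\mathrm{cong}(S).$$ -/

import Mathlib

open MeasureTheory
open scoped ENNReal

noncomputable section

/-! ## Segments, squares and congestion -/

namespace Congestion

/-- Points of the Euclidean plane. -/
abbrev Point : Type := EuclideanSpace ℝ (Fin 2)

/-- A (closed, possibly degenerate) segment in the plane, given by its two endpoints. -/
structure Segment where
  p : Point
  q : Point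

/-- The length of the part of the segment `s` that lies in the region `A`: the speed
`dist s.p s.q` of the affine parametrization of `s` over `[0, 1]`, times the Lebesgue measure of
the set of parameters at which the parametrization is in `A`. -/
def clipLength (s : Segment) (A : Set Point) : ℝ :=
  dist s.p s.q * volume.real {t : ℝ | t ∈ Set.Icc (0 : ℝ) 1 ∧ AffineMap.lineMap s.p s.q t ∈ A}

/-- The axis-parallel square centred at `c` with side length `2 * r`, i.e. the closed ball of
radius `r` around `c` in the maximum norm. -/
def square (c : Point) (r : ℝ) : Set Point := {x | ∀ k : Fin 2, |x k - c k| ≤ r}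

/-- The congestion of a square `A` of radius `r` with respect to the segments `S`: the total length
of the segments inside the square, divided by the radius. -/
def squareCongestion {n : ℕ} (S : Fin n → Segment) (A : Set Point) (r : ℝ) : ℝ :=
  (∑ i, clipLength (S i) A) / r

/-- The congestion of the segments `S`: the supremum of the congestion over all axis-parallel
squares of positive radius. (It is at most `2 * √2 * n`, hence a supremum of a bounded set.) -/
def congestion {n : ℕ} (S : Fin n → Segment) : ℝ :=
  sSup {c : ℝ | ∃ (p : Point) (r : ℝ), 0 < r ∧ c = squareCongestion S (square p r) r}

/-! ## Quadtrees -/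

/-- A canonical square: the cell at position `(col, row)` in the grid of width `2 ^ (-level)`,
contained in the unit square `[0, 1)²`. -/
structure CanonicalSquare where
  level : ℕ
  col : ℕ
  row : ℕ
  col_lt : col < 2 ^ level
  row_lt : row < 2 ^ level

namespace CanonicalSquare

/-- The side length `2 ^ (-level)`. -/
def side (Q : CanonicalSquare) : ℝ := (1 / 2 : ℝ) ^ Q.level

/-- The radius, i.e. half of the side length. -/
def radius (Q : CanonicalSquare) : ℝ := Q.side / 2

/-- The `x`-coordinate of the lower left corner. -/
def left (Q : CanonicalSquare) : ℝ := Q.col * Q.side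

/-- The `y`-coordinate of the lower left corner. -/
def bottom (Q : CanonicalSquare) : ℝ := Q.row * Q.side

/-- The half-open square itself, as a cell of the grid. -/
def toSet (Q : CanonicalSquare) : Set Point :=
  {x | Q.left ≤ x 0 ∧ x 0 < Q.left + Q.side ∧ Q.bottom ≤ x 1 ∧ x 1 < Q.bottom + Q.side}

/-- `R` is one of the four congruent squares into which `Q` is partitioned. -/
def IsQuadrant (R Q : CanonicalSquare) : Prop :=
  R.level = Q.level + 1 ∧ R.col / 2 = Q.col ∧ R.row / 2 = Q.row

end CanonicalSquare

/-- A finite (possibly compressed) quadtree over the unit square with `m` nodes: a rooted tree,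
given by its parent pointers (the root points to itself), with a canonical square attached to every
node, such that the square of every node other than the root lies inside one of the four quadrants
of the square of its parent, and different children of a node lie in different quadrants. In an
ordinary quadtree the square of a child equals a quadrant of the parent; in a compressed quadtree it
can be smaller, as paths of nodes with a single relevant child are contracted. -/
structure Quadtree (m : ℕ) where
  root : Fin m
  parent : Fin m → Fin m
  cell : Fin m → CanonicalSquare
  parent_root : parent root = root
  cell_subset : ∀ v, v ≠ root →
    ∃ R : CanonicalSquare, R.IsQuadrant (cell (parent v)) ∧ (cell v).toSet ⊆ R.toSet
  siblings : ∀ v w, v ≠ root → w ≠ root → v ≠ w → parent v = parent w →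
    ∀ R : CanonicalSquare, R.IsQuadrant (cell (parent v)) →
      ¬ ((cell v).toSet ⊆ R.toSet ∧ (cell w).toSet ⊆ R.toSet)

/-- The congestion of a quadtree: the maximum of the congestion of its cells. -/
def treeCongestion {n m : ℕ} (S : Fin n → Segment) (T : Quadtree m) : ℝ :=
  ⨆ v : Fin m, squareCongestion S (T.cell v).toSet (T.cell v).radius

end Congestion

/-! ## Randomized real RAM programs

The unit-cost real RAM: memory cells hold natural numbers or real numbers and are organised in
arrays of unbounded length, addressed by array name (fixed in the program) and computed index.
Programs contain only integer constants. The operations on reals are the four arithmetic operations,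
the square root, the floor function and rounding down to a power of two. Randomness comes from
fair coins. -/

namespace RealRAM

mutual

/-- Expressions with values in the natural numbers. `load a i` reads array `a` at index `i`. -/
inductive NExp : Type
  | lit : ℕ → NExp
  | load : ℕ → NExp → NExp
  | add : NExp → NExp → NExp
  | sub : NExp → NExp → NExp
  | mul : NExp → NExp → NExp
  | div : NExp → NExp → NExp
  | floor : RExp → NExp

/-- Expressions with values in the real numbers. -/
inductive RExp : Type
  | lit : ℤ → RExp
  | load : ℕ → NExp → RExp
  | ofNat : NExp → RExp
  | add : RExp → RExp → RExp
  | sub : RExp → RExp → RExp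
  | mul : RExp → RExp → RExp
  | div : RExp → RExp → RExp
  | sqrt : RExp → RExp
  | floor : RExp → RExp
  | powTwo : RExp → RExp

end

/-- Tests. -/
inductive BExp : Type
  | ltN : NExp → NExp → BExp
  | ltR : RExp → RExp → BExp
  | not : BExp → BExp
  | and : BExp → BExp → BExp

/-- Programs. `storeN a i e` and `storeR a i e` write the value of `e` to array `a` at index `i`;
`flip a i` writes the outcome (`0` or `1`) of a fresh fair coin there. -/
inductive Prog : Type
  | skip : Prog
  | storeN : ℕ → NExp → NExp → Prog
  | storeR : ℕ → NExp → RExp → Prog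
  | flip : ℕ → NExp → Prog
  | seq : Prog → Prog → Prog
  | ite : BExp → Prog → Prog → Prog
  | while : BExp → Prog → Prog

/-- A memory state: the arrays of natural numbers, the arrays of real numbers, and the number of
coins flipped so far. -/
structure State where
  nat : ℕ → ℕ → ℕ
  real : ℕ → ℕ → ℝ
  coins : ℕ

mutual

/-- The value of an expression (subtraction is truncated at zero, division rounds down, `floor`
is zero on negative reals). -/
def NExp.eval (σ : State) : NExp → ℕ
  | .lit k => k
  | .load a i => σ.nat a (i.eval σ)
  | .add x y => x.eval σ + y.eval σ
  | .sub x y => x.eval σ - y.eval σ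
  | .mul x y => x.eval σ * y.eval σ
  | .div x y => x.eval σ / y.eval σ
  | .floor x => ⌊x.eval σ⌋₊

/-- The value of an expression. For a positive real `x`, `powTwo` yields the largest power of two
(with integer exponent) that is at most `x`, that is, `2 ^ ⌊log₂ x⌋`. -/
def RExp.eval (σ : State) : RExp → ℝ
  | .lit k => (k : ℝ)
  | .load a i => σ.real a (i.eval σ)
  | .ofNat x => (x.eval σ : ℝ)
  | .add x y => x.eval σ + y.eval σ
  | .sub x y => x.eval σ - y.eval σ
  | .mul x y => x.eval σ * y.eval σ
  | .div x y => x.eval σ / y.eval σ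
  | .sqrt x => Real.sqrt (x.eval σ)
  | .floor x => (⌊x.eval σ⌋ : ℝ)
  | .powTwo x => (2 : ℝ) ^ Int.log 2 (x.eval σ)

end

mutual

/-- The cost of evaluating an expression: one unit for each constant, memory access and
operation. -/
def NExp.cost : NExp → ℕ
  | .lit _ => 1
  | .load _ i => i.cost + 1
  | .add x y => x.cost + y.cost + 1
  | .sub x y => x.cost + y.cost + 1
  | .mul x y => x.cost + y.cost + 1
  | .div x y => x.cost + y.cost + 1
  | .floor x => x.cost + 1

/-- The cost of evaluating an expression: one unit for each constant, memory access and
operation. -/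
def RExp.cost : RExp → ℕ
  | .lit _ => 1
  | .load _ i => i.cost + 1
  | .ofNat x => x.cost + 1
  | .add x y => x.cost + y.cost + 1
  | .sub x y => x.cost + y.cost + 1
  | .mul x y => x.cost + y.cost + 1
  | .div x y => x.cost + y.cost + 1
  | .sqrt x => x.cost + 1
  | .floor x => x.cost + 1
  | .powTwo x => x.cost + 1

end

/-- The truth of a test. -/
def BExp.Holds (σ : State) : BExp → Prop
  | .ltN x y => x.eval σ < y.eval σ
  | .ltR x y => x.eval σ < y.eval σ
  | .not b => ¬ b.Holds σ
  | .and b c => b.Holds σ ∧ c.Holds σ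

/-- The cost of a test. -/
def BExp.cost : BExp → ℕ
  | .ltN x y => x.cost + y.cost + 1
  | .ltR x y => x.cost + y.cost + 1
  | .not b => b.cost + 1
  | .and b c => b.cost + c.cost + 1

/-- Writing a natural number into memory. -/
def State.setNat (σ : State) (a i k : ℕ) : State :=
  { σ with nat := Function.update σ.nat a (Function.update (σ.nat a) i k) }

/-- Writing a real number into memory. -/
def State.setReal (σ : State) (a i : ℕ) (x : ℝ) : State :=
  { σ with real := Function.update σ.real a (Function.update (σ.real a) i x) }

/-- Flipping the next coin of the sequence `ω` and writing the outcome into memory. -/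
def State.flip (ω : ℕ → Bool) (σ : State) (a i : ℕ) : State :=
  { σ.setNat a i (if ω σ.coins then 1 else 0) with coins := σ.coins + 1 }

/-- `Exec ω P σ t τ`: with the coin outcomes `ω`, the program `P` started in the state `σ` halts
after exactly `t` time steps in the state `τ`. -/
inductive Exec (ω : ℕ → Bool) : Prog → State → ℕ → State → Prop
  | skip (σ : State) : Exec ω .skip σ 1 σ
  | storeN (a : ℕ) (i x : NExp) (σ : State) :
      Exec ω (.storeN a i x) σ (i.cost + x.cost + 1) (σ.setNat a (i.eval σ) (x.eval σ))
  | storeR (a : ℕ) (i : NExp) (x : RExp) (σ : State) :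
      Exec ω (.storeR a i x) σ (i.cost + x.cost + 1) (σ.setReal a (i.eval σ) (x.eval σ))
  | flip (a : ℕ) (i : NExp) (σ : State) :
      Exec ω (.flip a i) σ (i.cost + 1) (σ.flip ω a (i.eval σ))
  | seq {P Q : Prog} {σ τ ρ : State} {t u : ℕ} (hP : Exec ω P σ t τ) (hQ : Exec ω Q τ u ρ) :
      Exec ω (.seq P Q) σ (t + u) ρ
  | ite_true {b : BExp} {P Q : Prog} {σ τ : State} {t : ℕ} (hb : b.Holds σ)
      (hP : Exec ω P σ t τ) : Exec ω (.ite b P Q) σ (b.cost + t) τ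
  | ite_false {b : BExp} {P Q : Prog} {σ τ : State} {t : ℕ} (hb : ¬ b.Holds σ)
      (hQ : Exec ω Q σ t τ) : Exec ω (.ite b P Q) σ (b.cost + t) τ
  | while_true {b : BExp} {P : Prog} {σ τ ρ : State} {t u : ℕ} (hb : b.Holds σ)
      (hP : Exec ω P σ t τ) (hW : Exec ω (.while b P) τ u ρ) :
      Exec ω (.while b P) σ (b.cost + t + u) ρ
  | while_false {b : BExp} {P : Prog} {σ : State} (hb : ¬ b.Holds σ) :
      Exec ω (.while b P) σ b.cost σ

/-- The running time of `P` from the state `σ` with coin outcomes `ω`; it is `∞` if `P` does not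
halt. -/
def runTime (P : Prog) (σ : State) (ω : ℕ → Bool) : ℝ≥0∞ :=
  ⨅ (t : ℕ) (_ : ∃ τ, Exec ω P σ t τ), (t : ℝ≥0∞)

/-- The law of an infinite sequence of independent fair coin flips. -/
def coinMeasure : Measure (ℕ → Bool) :=
  Measure.infinitePi fun _ : ℕ => (PMF.uniformOfFintype Bool).toMeasure

/-- The expected running time of `P` from the state `σ`. -/
def expectedTime (P : Prog) (σ : State) : ℝ≥0∞ := ∫⁻ ω, runTime P σ ω ∂(coinMeasure)

end RealRAM

/-! ## Input and output conventions -/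

namespace Congestion

/-- The initial memory on input `S`, `T`. Natural number array `0` holds `n`, `m` and the index of
the root, and array `1` holds the parent pointers of the nodes. Real arrays `0` to `3` hold the
coordinates of the endpoints of the segments, and real arrays `4` to `6` hold the coordinates of the
lower left corners and the side lengths of the cells. All other memory cells are `0`. -/
def inputState {n m : ℕ} (S : Fin n → Segment) (T : Quadtree m) : RealRAM.State where
  nat := fun a i => match a with
    | 0 => if i = 0 then n else if i = 1 then m else if i = 2 then (T.root : ℕ) else 0
    | 1 => if h : i < m then (T.parent ⟨i, h⟩ : ℕ) else 0
    | _ => 0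
  real := fun a i => match a with
    | 0 => if h : i < n then (S ⟨i, h⟩).p 0 else 0
    | 1 => if h : i < n then (S ⟨i, h⟩).p 1 else 0
    | 2 => if h : i < n then (S ⟨i, h⟩).q 0 else 0
    | 3 => if h : i < n then (S ⟨i, h⟩).q 1 else 0
    | 4 => if h : i < m then (T.cell ⟨i, h⟩).left else 0
    | 5 => if h : i < m then (T.cell ⟨i, h⟩).bottom else 0
    | 6 => if h : i < m then (T.cell ⟨i, h⟩).side else 0
    | _ => 0
  coins := 0

/-- `Outputs P S T ω c`: on input `S`, `T` and with coin outcomes `ω`, the program `P` halts with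
the number `c` in real array `7` at index `0`. -/
def Outputs {n m : ℕ} (P : RealRAM.Prog) (S : Fin n → Segment) (T : Quadtree m) (ω : ℕ → Bool)
    (c : ℝ) : Prop :=
  ∃ (t : ℕ) (τ : RealRAM.State), RealRAM.Exec ω P (inputState S T) t τ ∧ τ.real 7 0 = c

end Congestion

end

-- For a cell of side D, hence radius D/2, call a segment meeting the closed cell short if its
-- length is below D/2 and long otherwise. Let A be the total length of the short ones, N the number
-- of the long ones, and W = A/(D/2) + N. The concentric square of radius D contains every short
-- segment completely and at least length D/2 of every long one, so W/2 ≤ cong(S)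
-- (`weight_le_congestion`). Inside the cell a long segment has length at most √2·D, so the
-- congestion of the cell is at most A/(D/2) + 2√2·N ≤ 2√2·W (`squareCongestion_le_weight`). The
-- maximum of W/2 over all cells therefore has the required quality with factor 4√2; the ε pays for
-- computing it only approximately. Since cong(S) ≥ 1 as soon as one segment is nondegenerate
-- (`one_le_congestion`), small additive errors are harmless.
--
-- Let L be the number of bits of n + m. Every segment gets four grid squares, of side the smallest
-- power of two above its length, among which are all squares of that grid that it meets. Grid
-- squares and cells are dyadic, hence laminar: if the root strictly contains a grid square, then a
-- unique lowest node does, and jumps along heavy paths find it in O(L²) steps (`searchProg_wp`).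
-- For the sums A it suffices to visit L + O(1) ancestors of this node: sides at least double from
-- child to parent, so at larger cells the segment is so short that all n such segments together
-- contribute at most a small constant (`EntriesSpec.le_weight`).
--
-- For the counts N, a segment that is long at a node but not at the parent enters there, and the
-- entry is the only child of the located node that lies in the grid square (`exists_regEnt`,
-- `children_inside_eq`). Every other long segment of a node is inherited from the parent
-- (`longSet_child`). Complete lists may be too long, so the segments are thinned by fair coins in
-- rounds until no list exceeds a capacity of order L, and the lengths of the lists are scaled back.
-- A round costs O((n + m)·L). By a Chernoff bound (`not_accurate_le`) and a union bound
-- (`le_allAccurate`), the first round without overflow gives all N up to 1/k times the largest N.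
-- An error relative to the largest count suffices, because W is at least that count at the node
-- attaining it; `EntriesSpec.output_le` and `EntriesSpec.le_output` turn this into the two bounds
-- on the output.

namespace RealRAM

/-! ## A total-correctness logic with running times -/

/-- Whether a program writes to the natural number array `a`. -/
def Prog.wN : Prog → ℕ → Bool
  | .skip, _ => false
  | .storeN a _ _, b => a == b
  | .storeR _ _ _, _ => false
  | .flip a _, b => a == b
  | .seq P Q, b => P.wN b || Q.wN b
  | .ite _ P Q, b => P.wN b || Q.wN b
  | .while _ P, b => P.wN b

/-- Whether a program writes to the real number array `a`. -/
def Prog.wR : Prog → ℕ → Bool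
  | .skip, _ => false
  | .storeN _ _ _, _ => false
  | .storeR a _ _, b => a == b
  | .flip _ _, _ => false
  | .seq P Q, b => P.wR b || Q.wR b
  | .ite _ P Q, b => P.wR b || Q.wR b
  | .while _ P, b => P.wR b

/-- Whether a program contains a coin flip. -/
def Prog.flips : Prog → Bool
  | .skip => false
  | .storeN _ _ _ => false
  | .storeR _ _ _ => false
  | .flip _ _ => true
  | .seq P Q => P.flips || Q.flips
  | .ite _ P Q => P.flips || Q.flips
  | .while _ P => P.flips

/-- The states `σ` and `τ` agree on everything that `P` does not write. -/
structure Agrees (P : Prog) (σ τ : State) : Prop where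
  nat : ∀ a, P.wN a = false → τ.nat a = σ.nat a
  real : ∀ a, P.wR a = false → τ.real a = σ.real a
  coins : P.flips = false → τ.coins = σ.coins

theorem Agrees.refl (P : Prog) (σ : State) : Agrees P σ σ :=
  ⟨fun _ _ => rfl, fun _ _ => rfl, fun _ => rfl⟩

theorem Agrees.trans {P : Prog} {σ τ ρ : State} (h : Agrees P σ τ) (h' : Agrees P τ ρ) :
    Agrees P σ ρ :=
  ⟨fun a ha => (h'.nat a ha).trans (h.nat a ha), fun a ha => (h'.real a ha).trans (h.real a ha),
    fun hf => (h'.coins hf).trans (h.coins hf)⟩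

theorem Agrees.seq_left {P Q : Prog} {σ τ : State} (h : Agrees P σ τ) : Agrees (.seq P Q) σ τ :=
  ⟨fun a ha => h.nat a (by simp [Prog.wN] at ha; exact ha.1),
   fun a ha => h.real a (by simp [Prog.wR] at ha; exact ha.1),
   fun ha => h.coins (by simp [Prog.flips] at ha; exact ha.1)⟩

theorem Agrees.seq_right {P Q : Prog} {σ τ : State} (h : Agrees Q σ τ) : Agrees (.seq P Q) σ τ :=
  ⟨fun a ha => h.nat a (by simp [Prog.wN] at ha; exact ha.2),
   fun a ha => h.real a (by simp [Prog.wR] at ha; exact ha.2),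
   fun ha => h.coins (by simp [Prog.flips] at ha; exact ha.2)⟩

theorem Agrees.ite_left {b : BExp} {P Q : Prog} {σ τ : State} (h : Agrees P σ τ) :
    Agrees (.ite b P Q) σ τ := ⟨h.seq_left.nat, h.seq_left.real, h.seq_left.coins⟩

theorem Agrees.ite_right {b : BExp} {P Q : Prog} {σ τ : State} (h : Agrees Q σ τ) :
    Agrees (.ite b P Q) σ τ :=
  ⟨(h.seq_right (P := P)).nat, (h.seq_right (P := P)).real, (h.seq_right (P := P)).coins⟩

theorem Agrees.while {b : BExp} {P : Prog} {σ τ : State} (h : Agrees P σ τ) :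
    Agrees (.while b P) σ τ := ⟨h.nat, h.real, h.coins⟩

@[simp] theorem State.setNat_nat (σ : State) (a i k b : ℕ) :
    (σ.setNat a i k).nat b = if b = a then Function.update (σ.nat a) i k else σ.nat b := by
  simp only [State.setNat, Function.update_apply]
@[simp] theorem State.setNat_real (σ : State) (a i k : ℕ) : (σ.setNat a i k).real = σ.real := rfl
@[simp] theorem State.setNat_coins (σ : State) (a i k : ℕ) : (σ.setNat a i k).coins = σ.coins := rfl
@[simp] theorem State.setReal_real (σ : State) (a i : ℕ) (x : ℝ) (b : ℕ) :
    (σ.setReal a i x).real b = if b = a then Function.update (σ.real a) i x else σ.real b := by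
  simp only [State.setReal, Function.update_apply]
@[simp] theorem State.setReal_nat (σ : State) (a i : ℕ) (x : ℝ) : (σ.setReal a i x).nat = σ.nat := rfl
@[simp] theorem State.setReal_coins (σ : State) (a i : ℕ) (x : ℝ) :
    (σ.setReal a i x).coins = σ.coins := rfl

theorem State.agrees_setNat (σ : State) (a i k : ℕ) (P : Prog) (h : P.wN a = true) :
    Agrees P σ (σ.setNat a i k) :=
  ⟨fun b hb => by rw [State.setNat_nat, if_neg (by rintro rfl; simp [h] at hb)],
    fun _ _ => rfl, fun _ => rfl⟩

/-- Frame rule. The written arrays are computed from the syntax by Boolean functions, so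
preservation of data across a program reduces to side conditions that `rfl` proves. -/
theorem Exec.agrees {ω : ℕ → Bool} {P : Prog} {σ τ : State} {t : ℕ} (h : Exec ω P σ t τ) :
    Agrees P σ τ := by
  induction h with
  | skip σ => exact .refl _ _
  | storeN a i x σ => exact State.agrees_setNat _ _ _ _ _ (by simp [Prog.wN])
  | storeR a i x σ =>
    refine ⟨fun _ _ => rfl, fun b hb => ?_, fun _ => rfl⟩
    rw [State.setReal_real, if_neg]; rintro rfl; simp [Prog.wR] at hb
  | flip a i σ =>
    refine ⟨fun b hb => ?_, fun _ _ => rfl, fun h => by simp [Prog.flips] at h⟩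
    simp only [State.flip, State.setNat_nat]
    rw [if_neg]; rintro rfl; simp [Prog.wN] at hb
  | seq _ _ h₁ h₂ => exact h₁.seq_left.trans h₂.seq_right
  | ite_true _ _ h => exact h.ite_left
  | ite_false _ _ h => exact h.ite_right
  | while_true _ _ _ h₁ h₂ => exact h₁.while.trans h₂
  | while_false => exact .refl _ _

/-- The program `P`, started in `σ`, halts within `T` steps in a state satisfying `R`. -/
def WP (ω : ℕ → Bool) (P : Prog) (T : ℕ) (σ : State) (R : State → Prop) : Prop :=
  ∃ t ≤ T, ∃ τ, Exec ω P σ t τ ∧ R τ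

variable {ω : ℕ → Bool}

theorem WP.mono {P : Prog} {T T' : ℕ} {σ : State} {R R' : State → Prop} (h : WP ω P T σ R)
    (hT : T ≤ T') (hR : ∀ τ, Agrees P σ τ → R τ → R' τ) : WP ω P T' σ R' := by
  obtain ⟨t, ht, τ, he, hr⟩ := h
  exact ⟨t, ht.trans hT, τ, he, hR τ he.agrees hr⟩

theorem WP.seq {P Q : Prog} {T U : ℕ} {σ : State} {R : State → Prop}
    (h : WP ω P T σ fun τ => WP ω Q U τ R) : WP ω (.seq P Q) (T + U) σ R := by
  obtain ⟨t, ht, τ, he, u, hu, ρ, he', hr⟩ := h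
  exact ⟨t + u, by omega, ρ, .seq he he', hr⟩

/-- Sequential composition, with the frame of the first part at hand. -/
theorem WP.comp {P Q : Prog} {T U : ℕ} {σ : State} {R S : State → Prop} (h : WP ω P T σ R)
    (h' : ∀ τ, Agrees P σ τ → R τ → WP ω Q U τ S) : WP ω (.seq P Q) (T + U) σ S :=
  WP.seq (h.mono le_rfl h')

theorem WP.ite {b : BExp} {P Q : Prog} {T U : ℕ} {σ : State} {R : State → Prop}
    (h : b.Holds σ → WP ω P T σ R) (h' : ¬ b.Holds σ → WP ω Q U σ R) :
    WP ω (.ite b P Q) (b.cost + (T + U)) σ R := by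
  by_cases hb : b.Holds σ
  · obtain ⟨t, ht, τ, he, hr⟩ := h hb
    exact ⟨b.cost + t, by omega, τ, .ite_true hb he, hr⟩
  · obtain ⟨t, ht, τ, he, hr⟩ := h' hb
    exact ⟨b.cost + t, by omega, τ, .ite_false hb he, hr⟩

/-- Programs without loops. -/
def Prog.loopFree : Prog → Bool
  | .skip => true
  | .storeN _ _ _ => true
  | .storeR _ _ _ => true
  | .flip _ _ => true
  | .seq P Q => P.loopFree && Q.loopFree
  | .ite _ P Q => P.loopFree && Q.loopFree
  | .while _ _ => false

/-- A bound on the running time of programs without loops. -/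
def Prog.wc : Prog → ℕ
  | .skip => 1
  | .storeN _ i x => i.cost + x.cost + 1
  | .storeR _ i x => i.cost + x.cost + 1
  | .flip _ i => i.cost + 1
  | .seq P Q => P.wc + Q.wc
  | .ite b P Q => b.cost + (P.wc + Q.wc)
  -- A junk value: `WP.run` uses this bound for programs without loops only.
  | .while _ _ => 0

open Classical in
/-- The effect of a program without loops. -/
noncomputable def Prog.run (ω : ℕ → Bool) : Prog → State → State
  | .skip, σ => σ
  | .storeN a i x, σ => σ.setNat a (i.eval σ) (x.eval σ)
  | .storeR a i x, σ => σ.setReal a (i.eval σ) (x.eval σ)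
  | .flip a i, σ => σ.flip ω a (i.eval σ)
  | .seq P Q, σ => Q.run ω (P.run ω σ)
  | .ite b P Q, σ => if b.Holds σ then P.run ω σ else Q.run ω σ
  | .while _ _, σ => σ

theorem WP.run {P : Prog} (hP : P.loopFree = true) {σ : State} {R : State → Prop}
    (h : R (P.run ω σ)) : WP ω P P.wc σ R := by
  suffices H : ∀ σ, WP ω P P.wc σ fun τ => τ = P.run ω σ from
    (H σ).mono le_rfl fun τ _ hτ => hτ ▸ h
  clear h R σ
  induction P with
  | skip => exact fun σ => ⟨1, le_rfl, σ, .skip σ, rfl⟩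
  | storeN a i x => exact fun σ => ⟨_, le_rfl, _, .storeN a i x σ, rfl⟩
  | storeR a i x => exact fun σ => ⟨_, le_rfl, _, .storeR a i x σ, rfl⟩
  | flip a i => exact fun σ => ⟨_, le_rfl, _, .flip a i σ, rfl⟩
  | seq P Q ihP ihQ =>
    intro σ
    simp only [Prog.loopFree, Bool.and_eq_true] at hP
    exact (ihP hP.1 σ).comp fun τ _ hτ => (ihQ hP.2 τ).mono le_rfl fun ρ _ hρ => by
      rw [hρ, hτ]; rfl
  | ite b P Q ihP ihQ =>
    intro σ
    simp only [Prog.loopFree, Bool.and_eq_true] at hP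
    refine WP.ite (fun hb => ?_) (fun hb => ?_)
    · exact (ihP hP.1 σ).mono le_rfl fun ρ _ hρ => by rw [hρ, Prog.run, if_pos hb]
    · exact (ihQ hP.2 σ).mono le_rfl fun ρ _ hρ => by rw [hρ, Prog.run, if_neg hb]
  | _ => simp [Prog.loopFree] at hP

/-- The loop `for v = 0, …, hi - 1`, where `v` is stored in the natural number array `v` at `0`. -/
def forTo (v : ℕ) (hi : NExp) (body : Prog) : Prog :=
  .seq (.storeN v (.lit 0) (.lit 0)) (.while (.ltN (.load v (.lit 0)) hi)
    (.seq body (.storeN v (.lit 0) (.add (.load v (.lit 0)) (.lit 1)))))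

/-- Induction on the number `j` of remaining iterations. The step hypothesis also receives the frame
relative to the initial state, so that invariants need to mention only the arrays that change. The
summand 20 covers the loop test and the increment of the counter. -/
theorem WP.forTo {v : ℕ} {hi : NExp} {body : Prog} {σ₀ : State} {N c : ℕ} (I : ℕ → State → Prop)
    (hv : body.wN v = false)
    (hhi : ∀ σ, Agrees (forTo v hi body) σ₀ σ → hi.eval σ = N)
    (h0 : I 0 (σ₀.setNat v 0 0))
    (hstep : ∀ k σ, k < N → Agrees (RealRAM.forTo v hi body) σ₀ σ → σ.nat v 0 = k → I k σ →
      WP ω body c σ fun τ => I (k + 1) (τ.setNat v 0 (k + 1))) :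
    WP ω (RealRAM.forTo v hi body) ((N + 1) * (c + hi.cost + 20)) σ₀ (I N) := by
  have hw : (RealRAM.forTo v hi body).wN v = true := by simp [RealRAM.forTo, Prog.wN]
  have key : ∀ j k σ, k + j = N → Agrees (RealRAM.forTo v hi body) σ₀ σ → σ.nat v 0 = k → I k σ →
      WP ω (.while (.ltN (.load v (.lit 0)) hi)
        (.seq body (.storeN v (.lit 0) (.add (.load v (.lit 0)) (.lit 1)))))
        (hi.cost + 3 + j * (c + hi.cost + 20)) σ (I N) := by
    intro j
    induction j with
    | zero =>
      intro k σ hk hag hkv hI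
      have hb : ¬ (BExp.ltN (.load v (.lit 0)) hi).Holds σ := by
        simp only [BExp.Holds, NExp.eval, hkv, hhi σ hag]; omega
      refine ⟨_, ?_, σ, .while_false hb, by simpa [← hk] using hI⟩
      simp only [BExp.cost, NExp.cost]; omega
    | succ j ih =>
      intro k σ hk hag hkv hI
      have hb : (BExp.ltN (.load v (.lit 0)) hi).Holds σ := by
        simp only [BExp.Holds, NExp.eval, hkv, hhi σ hag]; omega
      obtain ⟨t, ht, τ, he, hr⟩ := hstep k σ (by omega) hag hkv hI
      have hτ : τ.nat v 0 = k := by rw [he.agrees.nat v hv, hkv]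
      have e₂ : Exec ω (.storeN v (.lit 0) (.add (.load v (.lit 0)) (.lit 1))) τ 6
          (τ.setNat v 0 (k + 1)) := by
        have := Exec.storeN (ω := ω) v (.lit 0) (.add (.load v (.lit 0)) (.lit 1)) τ
        simpa [NExp.eval, NExp.cost, hτ] using this
      have e₃ := Exec.seq he e₂
      have hag' : Agrees (RealRAM.forTo v hi body) σ₀ (τ.setNat v 0 (k + 1)) :=
        hag.trans (Agrees.seq_right (Agrees.while e₃.agrees))
      obtain ⟨u, hu, ρ, he', hr'⟩ := ih (k + 1) _ (by omega) hag' (by simp) hr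
      refine ⟨_, ?_, ρ, .while_true hb e₃ he', hr'⟩
      simp only [BExp.cost, NExp.cost, Nat.add_mul]; omega
  have e₁ : Exec ω (.storeN v (.lit 0) (.lit 0)) σ₀ 3 (σ₀.setNat v 0 0) := by
    simpa [NExp.eval, NExp.cost] using Exec.storeN (ω := ω) v (.lit 0) (.lit 0) σ₀
  obtain ⟨t, ht, τ, he, hr⟩ := key N 0 (σ₀.setNat v 0 0) (by omega)
    (State.agrees_setNat _ _ _ _ _ hw) (by simp) h0
  refine ⟨_, ?_, τ, .seq e₁ he, hr⟩
  rw [Nat.add_mul]; omega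

/-- As `runTime` is an infimum over halting times, exhibiting one execution is enough and
determinism of `Exec` plays no role. -/
theorem runTime_le {P : Prog} {T : ℕ} {σ : State} {R : State → Prop} (h : WP ω P T σ R) :
    runTime P σ ω ≤ T := by
  obtain ⟨t, ht, τ, he, -⟩ := h
  exact (iInf₂_le t ⟨τ, he⟩).trans (by exact_mod_cast ht)

end RealRAM

-- Geometry: laminar dyadic cells, clipped segments, and weights of cells.

namespace Congestion

/-! ## Quadtrees given by coordinates -/

/-- The data of a quadtree as it is stored in the input arrays, together with the properties of
these data that matter for the algorithm. -/
structure NodeTree where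
  m : ℕ
  root : ℕ
  par : ℕ → ℕ
  X : ℕ → ℝ
  Y : ℕ → ℝ
  D : ℕ → ℝ
  lev : ℕ → ℕ
  root_lt : root < m
  par_lt : ∀ v, v < m → par v < m
  par_root : par root = root
  side : ∀ v, v < m → D v = (1 / 2) ^ lev v
  -- The index `m` acts as a dummy child; with side zero it fails every test for strict containment
  -- of a square of positive side.
  D_end : D m = 0
  grid : ∀ v, v < m → ∃ c r : ℤ, X v = c * D v ∧ Y v = r * D v
  lev_lt : ∀ v, v < m → v ≠ root → lev (par v) < lev v
  quadX : ∀ v, v < m → v ≠ root →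
    (X (par v) ≤ X v ∧ X v + D v ≤ X (par v) + D (par v) / 2) ∨
    (X (par v) + D (par v) / 2 ≤ X v ∧ X v + D v ≤ X (par v) + D (par v))
  quadY : ∀ v, v < m → v ≠ root →
    (Y (par v) ≤ Y v ∧ Y v + D v ≤ Y (par v) + D (par v) / 2) ∨
    (Y (par v) + D (par v) / 2 ≤ Y v ∧ Y v + D v ≤ Y (par v) + D (par v))
  sib : ∀ v w, v < m → w < m → v ≠ root → w ≠ root → par v = par w →
    (X (par v) + D (par v) / 2 ≤ X v ↔ X (par v) + D (par v) / 2 ≤ X w) →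
    (Y (par v) + D (par v) / 2 ≤ Y v ↔ Y (par v) + D (par v) / 2 ≤ Y w) → v = w

namespace NodeTree

variable (T : NodeTree)

/-- `c` is a child of `u`. -/
def IsChild (c u : ℕ) : Prop := c < T.m ∧ c ≠ T.root ∧ T.par c = u

/-- The half-open cell of `v`. -/
def In (v : ℕ) (x y : ℝ) : Prop :=
  T.X v ≤ x ∧ x < T.X v + T.D v ∧ T.Y v ≤ y ∧ y < T.Y v + T.D v

/-- The cell of `v` strictly contains the square with lower left corner `(x, y)` and side `g`. -/
def CC (x y g : ℝ) (v : ℕ) : Prop :=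
  T.X v ≤ x ∧ x + g ≤ T.X v + T.D v ∧ T.Y v ≤ y ∧ y + g ≤ T.Y v + T.D v ∧ g < T.D v

/-- The cell of `v` is contained in the square with lower left corner `(x, y)` and side `g`. -/
def Inside (x y g : ℝ) (v : ℕ) : Prop :=
  x ≤ T.X v ∧ T.X v + T.D v ≤ x + g ∧ y ≤ T.Y v ∧ T.Y v + T.D v ≤ y + g

/-- No child of `u` strictly contains the given square. -/
def Stuck (x y g : ℝ) (u : ℕ) : Prop := ∀ c, T.IsChild c u → ¬ T.CC x y g c

/-- `(x, y)` is a vertex of the grid of width `g`, a power of two. -/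
def _root_.Congestion.IsGrid (x y g : ℝ) : Prop :=
  ∃ z c r : ℤ, g = (2 : ℝ) ^ z ∧ x = c * g ∧ y = r * g

variable {T}

theorem D_pos {v : ℕ} (h : v < T.m) : 0 < T.D v := by rw [T.side v h]; positivity

theorem D_le_half {v : ℕ} (h : v < T.m) (hr : v ≠ T.root) : T.D v ≤ T.D (T.par v) / 2 := by
  rcases T.quadX v h hr with h' | h' <;> linarith

theorem D_le_par {v : ℕ} (h : v < T.m) : T.D v ≤ T.D (T.par v) := by
  by_cases hr : v = T.root
  · rw [hr, T.par_root]
  · linarith [D_le_half h hr, D_pos h]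

theorem sub_par {v : ℕ} (h : v < T.m) : T.X (T.par v) ≤ T.X v ∧
    T.X v + T.D v ≤ T.X (T.par v) + T.D (T.par v) ∧ T.Y (T.par v) ≤ T.Y v ∧
    T.Y v + T.D v ≤ T.Y (T.par v) + T.D (T.par v) := by
  by_cases hr : v = T.root
  · rw [hr, T.par_root]; simp
  · have := D_pos h
    have := D_pos (T.par_lt v h)
    rcases T.quadX v h hr with h' | h' <;> rcases T.quadY v h hr with h'' | h'' <;>
      refine ⟨?_, ?_, ?_, ?_⟩ <;> linarith

theorem In.par {v : ℕ} {x y : ℝ} (hv : v < T.m) (h : T.In v x y) : T.In (T.par v) x y := by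
  obtain ⟨a, b, c, d⟩ := h
  obtain ⟨a', b', c', d'⟩ := T.sub_par hv
  exact ⟨by linarith, by linarith, by linarith, by linarith⟩

theorem CC.par {v : ℕ} {x y g : ℝ} (hv : v < T.m) (h : T.CC x y g v) : T.CC x y g (T.par v) := by
  obtain ⟨a, b, c, d, e⟩ := h
  obtain ⟨a', b', c', d'⟩ := T.sub_par hv
  exact ⟨by linarith, by linarith, by linarith, by linarith, by linarith [D_le_par hv]⟩

theorem In_corner {v : ℕ} (hv : v < T.m) : T.In v (T.X v) (T.Y v) := by
  have := D_pos hv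
  exact ⟨le_rfl, by linarith, le_rfl, by linarith⟩

theorem CC.In {v : ℕ} {x y g : ℝ} (hg : 0 < g) (h : T.CC x y g v) : T.In v x y := by
  obtain ⟨a, b, c, d, e⟩ := h
  exact ⟨a, by linarith, c, by linarith⟩

theorem iter_lt {v : ℕ} (hv : v < T.m) (k : ℕ) : T.par^[k] v < T.m := by
  induction k with
  | zero => simpa
  | succ k ih => rw [Function.iterate_succ_apply']; exact T.par_lt _ ih

theorem In.iter {v : ℕ} {x y : ℝ} (hv : v < T.m) (h : T.In v x y) (k : ℕ) :
    T.In (T.par^[k] v) x y := by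
  induction k with
  | zero => simpa
  | succ k ih => rw [Function.iterate_succ_apply']; exact ih.par (iter_lt hv k)

theorem CC.iter {v : ℕ} {x y g : ℝ} (hv : v < T.m) (h : T.CC x y g v) (k : ℕ) :
    T.CC x y g (T.par^[k] v) := by
  induction k with
  | zero => simpa
  | succ k ih => rw [Function.iterate_succ_apply']; exact ih.par (iter_lt hv k)

theorem reach_root {v : ℕ} (hv : v < T.m) : ∃ k, T.par^[k] v = T.root := by
  induction hl : T.lev v using Nat.strong_induction_on generalizing v with
  | _ l ih =>
    by_cases hr : v = T.root
    · exact ⟨0, hr⟩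
    · obtain ⟨k, hk⟩ := ih _ (hl ▸ T.lev_lt v hv hr) (T.par_lt v hv) rfl
      exact ⟨k + 1, by rw [Function.iterate_succ_apply, hk]⟩

/-- A proper ancestor `b` of `a` has a child that is an ancestor of `a`. -/
theorem eq_or_child {a b k : ℕ} (ha : a < T.m) (h : T.par^[k] a = b) :
    a = b ∨ ∃ j, T.IsChild (T.par^[j] a) b := by
  induction k generalizing b with
  | zero => exact .inl h
  | succ k ih =>
    rw [Function.iterate_succ_apply'] at h
    by_cases hr : T.par^[k] a = T.root
    · rw [hr, T.par_root] at h
      exact ih (hr.trans h)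
    · exact .inr ⟨k, iter_lt ha k, hr, h⟩

/-- A common point decides, in each coordinate, in which half of the parent both cells lie. Hence
they lie in the same quadrant, where `sib` allows only one child. -/
theorem siblings_disjoint {v w u : ℕ} {x y : ℝ} (hv : T.IsChild v u) (hw : T.IsChild w u)
    (h : T.In v x y) (h' : T.In w x y) : v = w := by
  obtain ⟨hv, hvr, rfl⟩ := hv
  obtain ⟨hw, hwr, hp⟩ := hw
  have x1 := T.quadX v hv hvr
  have x2 := T.quadX w hw hwr
  have y1 := T.quadY v hv hvr
  have y2 := T.quadY w hw hwr
  rw [hp] at x2 y2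
  obtain ⟨a, b, c, d⟩ := h
  obtain ⟨a', b', c', d'⟩ := h'
  refine T.sib v w hv hw hvr hwr hp.symm ?_ ?_
  · constructor <;> intro hh
    · rcases x2 with x2 | x2 <;> linarith
    · rcases x1 with x1 | x1 <;> linarith
  · constructor <;> intro hh
    · rcases y2 with y2 | y2 <;> linarith
    · rcases y1 with y1 | y1 <;> linarith

/-- Nodes whose cells intersect are comparable in the tree. -/
theorem comparable {a b : ℕ} {x y : ℝ} (ha : a < T.m) (hb : b < T.m) (h : T.In a x y)
    (h' : T.In b x y) : (∃ k, T.par^[k] a = b) ∨ ∃ k, T.par^[k] b = a := by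
  classical
  by_contra! hcon
  obtain ⟨hab, hba⟩ := hcon
  -- Consider the first ancestor of `a` that is also an ancestor of `b`. Its children on the two
  -- paths both contain the point, so they are equal, contradicting minimality.
  have hex : ∃ i, ∃ j, T.par^[j] b = T.par^[i] a := by
    obtain ⟨i, hi⟩ := reach_root ha
    obtain ⟨j, hj⟩ := reach_root hb
    exact ⟨i, j, hj.trans hi.symm⟩
  obtain ⟨j, hj⟩ := Nat.find_spec hex
  have hmin := fun i (hi : i < Nat.find hex) => Nat.find_min hex hi
  set i := Nat.find hex
  rcases hi0 : i with _ | i'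
  · rw [hi0] at hj; exact hba j hj
  rcases eq_or_child hb hj with hb' | ⟨j', hj'⟩
  · exact hab i hb'.symm
  have hm := hmin i' (by omega)
  have hr : T.par^[i'] a ≠ T.root := fun hr => by
    obtain ⟨k, hk⟩ := reach_root hb
    exact hm ⟨k, hk.trans hr.symm⟩
  have hc : T.IsChild (T.par^[i'] a) (T.par^[i] a) :=
    ⟨iter_lt ha i', hr, by rw [hi0, Function.iterate_succ_apply']⟩
  exact hm ⟨j', siblings_disjoint hj' hc (h'.iter hb j') (h.iter ha i')⟩

/-- Both cells contain the corner of the square, so the nodes are comparable. Were `w` a proper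
descendant of `u`, the child of `u` on the path to `w` would strictly contain the square as well. -/
theorem Stuck.ancestor {u w : ℕ} {x y g : ℝ} (hg : 0 < g) (hu : u < T.m) (hw : w < T.m)
    (hcu : T.CC x y g u) (hs : T.Stuck x y g u) (hcw : T.CC x y g w) : ∃ k, T.par^[k] u = w := by
  rcases comparable hu hw (hcu.In hg) (hcw.In hg) with h | ⟨k, hk⟩
  · exact h
  · rcases eq_or_child hw hk with rfl | ⟨j, hj⟩
    · exact ⟨0, rfl⟩
    · exact absurd (hcw.iter hw j) (hs _ hj)

theorem Stuck.unique {u w : ℕ} {x y g : ℝ} (hg : 0 < g) (hu : u < T.m) (hw : w < T.m)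
    (hcu : T.CC x y g u) (hs : T.Stuck x y g u) (hcw : T.CC x y g w) (hs' : T.Stuck x y g w) :
    u = w := by
  obtain ⟨k, hk⟩ := hs.ancestor hg hu hw hcu hcw
  rcases eq_or_child hu hk with h | ⟨j, hj⟩
  · exact h
  · exact absurd (hcu.iter hu j) (hs' _ hj)

/-- Every genuine step to a parent at least doubles the side. Steps at the root are idle, because it
is its own parent, so `k` has to be chosen anew without them. This bounds the number of ancestors up
to a given size. -/
theorem iter_growth {u w : ℕ} (hu : u < T.m) (h : ∃ k, T.par^[k] u = w) :
    ∃ k, T.par^[k] u = w ∧ 2 ^ k * T.D u ≤ T.D w := by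
  obtain ⟨k, hk⟩ := h
  induction k generalizing w with
  | zero => exact ⟨0, hk, by simp at hk; simp [hk]⟩
  | succ k ih =>
    rw [Function.iterate_succ_apply'] at hk
    obtain ⟨j, hj, hj'⟩ := ih rfl
    by_cases hr : T.par^[k] u = T.root
    · rw [hr, T.par_root] at hk
      exact ⟨j, by rw [hj, hr, hk], by rw [← hk, ← hr]; exact hj'⟩
    · refine ⟨j + 1, by rw [Function.iterate_succ_apply', hj, hk], ?_⟩
      have := D_le_half (iter_lt hu k) hr
      rw [hk] at this
      rw [pow_succ]
      linarith

/-- The side of a cell that is larger than `g` is a multiple of `g`. -/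
theorem exists_mult {v : ℕ} {z : ℤ} (hv : v < T.m) (h : (2 : ℝ) ^ z < T.D v) :
    ∃ b : ℤ, 2 ≤ b ∧ T.D v = b * (2 : ℝ) ^ z := by
  rw [T.side v hv, one_div, ← zpow_natCast, inv_zpow', ] at h ⊢
  have hlt : z < -(T.lev v : ℤ) := (zpow_lt_zpow_iff_right₀ (by norm_num)).1 h
  obtain ⟨j, hj⟩ := Int.eq_ofNat_of_zero_le (show 0 ≤ -(T.lev v : ℤ) - z - 1 by omega)
  refine ⟨2 ^ (j + 1), ?_, ?_⟩
  · rw [pow_succ]; have : (1 : ℤ) ≤ 2 ^ j := one_le_pow₀ (by norm_num)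
    linarith
  · push_cast
    rw [← zpow_natCast, ← zpow_add₀ (by norm_num)]
    congr 1; push_cast; omega

theorem D_le_or {v : ℕ} {z : ℤ} (hv : v < T.m) :
    T.D v ≤ (2 : ℝ) ^ z ∨ 2 * (2 : ℝ) ^ z ≤ T.D v := by
  rcases le_or_gt (T.D v) ((2 : ℝ) ^ z) with h | h
  · exact .inl h
  · obtain ⟨b, hb, e⟩ := exists_mult hv h
    right; rw [e]
    have : (2 : ℝ) ≤ b := by exact_mod_cast hb
    have : (0 : ℝ) < 2 ^ z := by positivity
    nlinarith

/-- One coordinate of laminarity. All endpoints are integer multiples of `g`, so the strict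
inequalities forced by the common point `p` sharpen by integrality to containment of the intervals.
-/
theorem laminar_aux {g p : ℝ} {a b c : ℤ} (hg : 0 < g) (h1 : a * (b * g) ≤ p)
    (h2 : p < a * (b * g) + b * g) (h3 : c * g ≤ p) (h4 : p < c * g + g) :
    a * (b * g) ≤ c * g ∧ c * g + g ≤ a * (b * g) + b * g := by
  have e1 : ((a * b : ℤ) : ℝ) * g < ((c + 1 : ℤ) : ℝ) * g := by push_cast; linarith
  have e2 : (c : ℝ) * g < ((a * b + b : ℤ) : ℝ) * g := by push_cast; linarith
  rw [mul_lt_mul_iff_left₀ hg] at e1 e2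
  have f1 : a * b < c + 1 := by exact_mod_cast e1
  have f2 : c < a * b + b := by exact_mod_cast e2
  have k1 : ((a * b : ℤ) : ℝ) ≤ c := by exact_mod_cast Int.lt_add_one_iff.1 f1
  have k2 : ((c + 1 : ℤ) : ℝ) ≤ (a * b + b : ℤ) := by exact_mod_cast f2
  have := mul_le_mul_of_nonneg_right k1 hg.le
  have := mul_le_mul_of_nonneg_right k2 hg.le
  push_cast at *
  constructor <;> linarith

theorem laminar {v : ℕ} {x y g px py : ℝ} (hq : IsGrid x y g) (hv : v < T.m) (hgv : g < T.D v)
    (h : T.In v px py) (hx : x ≤ px) (hx' : px < x + g) (hy : y ≤ py) (hy' : py < y + g) :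
    T.CC x y g v := by
  obtain ⟨z, c, r, rfl, rfl, rfl⟩ := hq
  obtain ⟨b, hb, e⟩ := exists_mult hv hgv
  obtain ⟨c', r', h1, h2⟩ := T.grid v hv
  obtain ⟨a1, a2, a3, a4⟩ := h
  have hg : (0 : ℝ) < 2 ^ z := by positivity
  refine ⟨?_, ?_, ?_, ?_, hgv⟩ <;> simp only [h1, h2, e] at *
  · exact (laminar_aux hg a1 a2 hx hx').1
  · exact (laminar_aux hg a1 a2 hx hx').2
  · exact (laminar_aux hg a3 a4 hy hy').1
  · exact (laminar_aux hg a3 a4 hy hy').2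

/-- If `v` lies in a grid square and the parent `p` of `v` is larger than that square, then `p` is
the lowest node strictly containing the square. -/
theorem stuck_of_child_inside {v : ℕ} {x y g : ℝ} (hq : IsGrid x y g) (hv : v < T.m)
    (hr : v ≠ T.root) (hin : T.Inside x y g v) (hgp : g < T.D (T.par v)) :
    T.CC x y g (T.par v) ∧ T.Stuck x y g (T.par v) := by
  have hp := T.par_lt v hv
  have hD := D_pos hv
  obtain ⟨i1, i2, i3, i4⟩ := hin
  refine ⟨laminar hq hp hgp ((In_corner hv).par hv) i1 (by linarith) i3 (by linarith), ?_⟩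
  intro c hc hcc
  obtain ⟨c1, c2, c3, c4, c5⟩ := hcc
  have : T.In c (T.X v) (T.Y v) := ⟨by linarith, by linarith, by linarith, by linarith⟩
  have := siblings_disjoint hc ⟨hv, hr, rfl⟩ this (In_corner hv)
  subst this
  linarith

/-- A cell is contained in a grid square of side at least its own. -/
theorem grid_aux {D x : ℝ} {a : ℤ} {b : ℕ} (hD : 0 < D) (hx : x = a * D) :
    ∃ c : ℤ, c * (2 ^ b * D) ≤ x ∧ x + D ≤ c * (2 ^ b * D) + 2 ^ b * D := by
  refine ⟨a / 2 ^ b, ?_, ?_⟩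
  · have h : (a / 2 ^ b) * 2 ^ b ≤ a := Int.ediv_mul_le a (by positivity)
    have h' : (((a / 2 ^ b : ℤ)) : ℝ) * 2 ^ b ≤ a := by exact_mod_cast h
    rw [hx]; nlinarith
  · have h := Int.lt_ediv_add_one_mul_self a (show (0 : ℤ) < 2 ^ b by positivity)
    have h' : (a : ℝ) + 1 ≤ (((a / 2 ^ b : ℤ)) + 1 : ℝ) * 2 ^ b := by exact_mod_cast h
    rw [hx]; nlinarith

theorem exists_grid_containing {v : ℕ} {z : ℤ} (hv : v < T.m) (h : T.D v ≤ (2 : ℝ) ^ z) :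
    ∃ c r : ℤ, T.Inside (c * (2 : ℝ) ^ z) (r * (2 : ℝ) ^ z) ((2 : ℝ) ^ z) v := by
  obtain ⟨c', r', h1, h2⟩ := T.grid v hv
  have hD := D_pos hv
  have hz : ∃ b : ℕ, (2 : ℝ) ^ z = 2 ^ b * T.D v := by
    have e : T.D v = (2 : ℝ) ^ (-(T.lev v : ℤ)) := by
      rw [T.side v hv, one_div, ← zpow_natCast, inv_zpow']
    rw [e] at h ⊢
    have hle : -(T.lev v : ℤ) ≤ z := (zpow_le_zpow_iff_right₀ (by norm_num)).1 h
    obtain ⟨j, hj⟩ := Int.eq_ofNat_of_zero_le (show 0 ≤ z + (T.lev v : ℤ) by omega)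
    refine ⟨j, ?_⟩
    rw [← zpow_natCast, ← zpow_add₀ (by norm_num)]
    congr 1; omega
  obtain ⟨b, hb⟩ := hz
  obtain ⟨c, hc1, hc2⟩ := grid_aux (b := b) hD h1
  obtain ⟨r, hr1, hr2⟩ := grid_aux (b := b) hD h2
  exact ⟨c, r, by rw [hb]; exact hc1, by rw [hb]; exact hc2, by rw [hb]; exact hr1,
    by rw [hb]; exact hr2⟩

/-- A point of a closed cell lies in a closed grid square contained in that cell. -/
theorem grid_point_aux {g p : ℝ} {a b : ℤ} (hg : 0 < g) (hb : 1 ≤ b) (h1 : a * (b * g) ≤ p)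
    (h2 : p ≤ a * (b * g) + b * g) :
    ∃ c : ℤ, c * g ≤ p ∧ p ≤ c * g + g ∧ a * (b * g) ≤ c * g ∧ c * g + g ≤ a * (b * g) + b * g := by
  -- The minimum matters only if `p` is the right end of the closed cell, where the floor would give
  -- the grid interval just outside.
  refine ⟨min ⌊p / g⌋ (a * b + b - 1), ?_⟩
  have f1 : (⌊p / g⌋ : ℝ) * g ≤ p := by
    have := Int.floor_le (p / g); rwa [le_div_iff₀ hg] at this
  have f2 : p < (⌊p / g⌋ + 1 : ℝ) * g := by
    have := Int.lt_floor_add_one (p / g); rwa [div_lt_iff₀ hg] at this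
  have f3 : a * b ≤ ⌊p / g⌋ := by
    rw [Int.le_floor, le_div_iff₀ hg]; push_cast; linarith
  have f3' : ((a : ℝ) * b) ≤ ⌊p / g⌋ := by exact_mod_cast f3
  have hb' : (1 : ℝ) ≤ b := by exact_mod_cast hb
  rcases le_total ⌊p / g⌋ (a * b + b - 1) with h | h
  · rw [min_eq_left h]
    have h' : (⌊p / g⌋ : ℝ) ≤ a * b + b - 1 := by exact_mod_cast h
    refine ⟨f1, by linarith, by nlinarith, by nlinarith⟩
  · rw [min_eq_right h]
    have h' : (a * b + b - 1 : ℝ) ≤ ⌊p / g⌋ := by exact_mod_cast h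
    push_cast
    refine ⟨by nlinarith, by linarith, by nlinarith, by linarith⟩

theorem exists_grid_in {v : ℕ} {z : ℤ} {px py : ℝ} (hv : v < T.m) (h : (2 : ℝ) ^ z < T.D v)
    (hx : T.X v ≤ px) (hx' : px ≤ T.X v + T.D v) (hy : T.Y v ≤ py) (hy' : py ≤ T.Y v + T.D v) :
    ∃ c r : ℤ, T.CC (c * (2 : ℝ) ^ z) (r * (2 : ℝ) ^ z) ((2 : ℝ) ^ z) v ∧
      c * (2 : ℝ) ^ z ≤ px ∧ px ≤ c * (2 : ℝ) ^ z + (2 : ℝ) ^ z ∧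
      r * (2 : ℝ) ^ z ≤ py ∧ py ≤ r * (2 : ℝ) ^ z + (2 : ℝ) ^ z := by
  obtain ⟨b, hb, e⟩ := exists_mult hv h
  obtain ⟨c', r', h1, h2⟩ := T.grid v hv
  have hg : (0 : ℝ) < 2 ^ z := by positivity
  rw [h1, e] at hx hx'
  rw [h2, e] at hy hy'
  obtain ⟨c, c1, c2, c3, c4⟩ := grid_point_aux hg (by omega) hx hx'
  obtain ⟨r, r1, r2, r3, r4⟩ := grid_point_aux hg (by omega) hy hy'
  refine ⟨c, r, ⟨?_, ?_, ?_, ?_, h⟩, c1, c2, r1, r2⟩ <;> simp only [h1, h2, e] <;> assumption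

end NodeTree
end Congestion

namespace Congestion

/-! ## Segments and squares -/

/-- The length of a segment. -/
noncomputable def Segment.len (s : Segment) : ℝ := dist s.p s.q

theorem Segment.len_eq (s : Segment) : s.len =
    √((s.p 0 - s.q 0) * (s.p 0 - s.q 0) + (s.p 1 - s.q 1) * (s.p 1 - s.q 1)) := by
  rw [Segment.len, EuclideanSpace.dist_eq, Fin.sum_univ_two, Real.dist_eq, Real.dist_eq, sq_abs,
    sq_abs, sq, sq]

theorem Segment.len_nonneg (s : Segment) : 0 ≤ s.len := dist_nonneg

theorem Segment.abs_coord_le_len (s : Segment) (k : Fin 2) : |s.q k - s.p k| ≤ s.len := by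
  rw [Segment.len_eq]
  apply Real.abs_le_sqrt
  fin_cases k <;> simp <;> nlinarith [sq_nonneg (s.q 0 - s.p 0), sq_nonneg (s.q 1 - s.p 1)]

/-- The segment meets the closed square with lower left corner `(l, b)` and side `D`. -/
def Segment.Meets (s : Segment) (l b D : ℝ) : Prop :=
  ∃ t : ℝ, 0 ≤ t ∧ t ≤ 1 ∧ l ≤ s.p 0 + t * (s.q 0 - s.p 0) ∧ s.p 0 + t * (s.q 0 - s.p 0) ≤ l + D ∧
    b ≤ s.p 1 + t * (s.q 1 - s.p 1) ∧ s.p 1 + t * (s.q 1 - s.p 1) ≤ b + D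

/-- The minimum of the two quotients is the parameter at which the line enters the slab, for either
sign of `d`. If `d = 0`, both quotients are 0 by convention, which is harmless for `t ≥ 0`. -/
theorem entry_param_le {l D p d t : ℝ} (h1 : l ≤ p + t * d) (h2 : p + t * d ≤ l + D) (h0 : 0 ≤ t) :
    min ((l - p) / d) ((l + D - p) / d) ≤ t := by
  rcases lt_trichotomy d 0 with hd | rfl | hd
  · exact (min_le_right _ _).trans ((div_le_iff_of_neg hd).2 (by linarith))
  · simpa using h0
  · exact (min_le_left _ _).trans ((div_le_iff₀ hd).2 (by linarith))

/-- Convexity of the slab: between the entry and a later parameter in the slab, the point stays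
inside. -/
theorem entry_param_spec {l D p d t u : ℝ} (h1 : l ≤ p + t * d) (h2 : p + t * d ≤ l + D)
    (hu : min ((l - p) / d) ((l + D - p) / d) ≤ u) (hut : u ≤ t) :
    l ≤ p + u * d ∧ p + u * d ≤ l + D := by
  have hD : 0 ≤ D := by linarith
  rcases lt_trichotomy d 0 with hd | rfl | hd
  · have e : (l + D - p) / d ≤ (l - p) / d := div_le_div_of_nonpos_of_le hd.le (by linarith)
    rw [min_eq_right e, div_le_iff_of_neg hd] at hu
    constructor <;> nlinarith
  · simp at *; exact ⟨h1, h2⟩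
  · have e : (l - p) / d ≤ (l + D - p) / d := by gcongr; linarith
    rw [min_eq_left e, div_le_iff₀ hd] at hu
    constructor <;> nlinarith

/-- The parameter at which the segment enters a square, if it meets it. -/
noncomputable def Segment.enter (s : Segment) (l b D : ℝ) : ℝ :=
  max 0 (max (min ((l - s.p 0) / (s.q 0 - s.p 0)) ((l + D - s.p 0) / (s.q 0 - s.p 0)))
    (min ((b - s.p 1) / (s.q 1 - s.p 1)) ((b + D - s.p 1) / (s.q 1 - s.p 1))))

/-- A test by a single candidate. If the segment is in the square at `t`, then the latest of 0 and
the two slab entries is at most `t`, and by convexity the point at that parameter is in both slabs.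
This is what the program evaluates. -/
theorem Segment.meets_iff (s : Segment) (l b D : ℝ) : s.Meets l b D ↔ s.enter l b D ≤ 1 ∧
    l ≤ s.p 0 + s.enter l b D * (s.q 0 - s.p 0) ∧
    s.p 0 + s.enter l b D * (s.q 0 - s.p 0) ≤ l + D ∧
    b ≤ s.p 1 + s.enter l b D * (s.q 1 - s.p 1) ∧
    s.p 1 + s.enter l b D * (s.q 1 - s.p 1) ≤ b + D := by
  constructor
  · rintro ⟨t, h0, h1, hx, hx', hy, hy'⟩
    have hle : s.enter l b D ≤ t :=
      max_le h0 (max_le (entry_param_le hx hx' h0) (entry_param_le hy hy' h0))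
    have ex := entry_param_spec hx hx' (u := s.enter l b D)
      ((le_max_left _ _).trans (le_max_right _ _)) hle
    have ey := entry_param_spec hy hy' (u := s.enter l b D)
      ((le_max_right _ _).trans (le_max_right _ _)) hle
    exact ⟨hle.trans h1, ex.1, ex.2, ey.1, ey.2⟩
  · rintro ⟨h1, h⟩
    exact ⟨_, le_max_left _ _, h1, h⟩

theorem Segment.Meets.mono {s : Segment} {l b D l' b' D' : ℝ} (h : s.Meets l b D) (h1 : l' ≤ l)
    (h2 : l + D ≤ l' + D') (h3 : b' ≤ b) (h4 : b + D ≤ b' + D') : s.Meets l' b' D' := by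
  obtain ⟨t, a, b, c, d, e, f⟩ := h
  exact ⟨t, a, b, by linarith, by linarith, by linarith, by linarith⟩

theorem lineMap_coord (s : Segment) (t : ℝ) (k : Fin 2) :
    (AffineMap.lineMap s.p s.q t : Point) k = s.p k + t * (s.q k - s.p k) := by
  simp [AffineMap.lineMap_apply]; ring

/-- The parameters at which a segment is in a region. -/
def Segment.params (s : Segment) (A : Set Point) : Set ℝ :=
  {t : ℝ | t ∈ Set.Icc (0 : ℝ) 1 ∧ AffineMap.lineMap s.p s.q t ∈ A}

theorem clipLength_eq (s : Segment) (A : Set Point) :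
    clipLength s A = s.len * volume.real (s.params A) := rfl

theorem clipLength_nonneg (s : Segment) (A : Set Point) : 0 ≤ clipLength s A :=
  mul_nonneg dist_nonneg measureReal_nonneg

theorem params_finite (s : Segment) (A : Set Point) : volume (s.params A) ≠ ∞ :=
  ((measure_mono fun _ h => h.1).trans_lt (measure_Icc_lt_top (a := (0 : ℝ)) (b := 1))).ne

theorem volume_params_le_one (s : Segment) (A : Set Point) : volume.real (s.params A) ≤ 1 := by
  have := measureReal_mono (μ := volume) (s₁ := s.params A) (s₂ := Set.Icc (0 : ℝ) 1)
    (fun t h => h.1) (by simp)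
  simpa using this

theorem clipLength_le_len (s : Segment) (A : Set Point) : clipLength s A ≤ s.len := by
  rw [clipLength_eq]
  have := volume_params_le_one s A
  nlinarith [s.len_nonneg]

/-- The closed square with lower left corner `(l, b)` and side `D`. -/
def box (l b D : ℝ) : Set Point := {x | l ≤ x 0 ∧ x 0 ≤ l + D ∧ b ≤ x 1 ∧ x 1 ≤ b + D}

theorem clipLength_eq_zero {s : Segment} {A : Set Point} {l b D : ℝ} (hA : A ⊆ box l b D)
    (h : ¬ s.Meets l b D) : clipLength s A = 0 := by
  have : s.params A = ∅ := by
    rw [Set.eq_empty_iff_forall_notMem]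
    rintro t ⟨⟨h0, h1⟩, hm⟩
    have := hA hm
    simp only [box, Set.mem_ofPred_eq, lineMap_coord] at this
    exact h ⟨t, h0, h1, this⟩
  rw [clipLength_eq, this]; simp

theorem volume_params_le {s : Segment} {A : Set Point} {l D : ℝ} {k : Fin 2} (hD : 0 ≤ D)
    (hA : ∀ x ∈ A, l ≤ x k ∧ x k ≤ l + D) :
    |s.q k - s.p k| * volume.real (s.params A) ≤ D := by
  set d := s.q k - s.p k with hd
  rcases eq_or_ne d 0 with h0 | h0
  · simp [h0, hD]
  have hsub : s.params A ⊆ Metric.closedBall ((l + D / 2 - s.p k) / d) (D / (2 * |d|)) := by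
    rintro t ⟨-, hm⟩
    have := hA _ hm
    rw [lineMap_coord, ← hd] at this
    rw [Metric.mem_closedBall, Real.dist_eq]
    have e : t - (l + D / 2 - s.p k) / d = (s.p k + t * d - (l + D / 2)) / d := by
      field_simp; ring
    rw [e, abs_div, div_le_div_iff₀ (abs_pos.2 h0) (by positivity)]
    have : |s.p k + t * d - (l + D / 2)| ≤ D / 2 := abs_le.2 ⟨by linarith, by linarith⟩
    nlinarith [abs_nonneg d]
  have hle := measureReal_mono (μ := volume) hsub (measure_closedBall_lt_top).ne
  rw [Real.volume_real_closedBall (by positivity)] at hle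
  have hd' : 0 < |d| := abs_pos.2 h0
  calc |d| * volume.real (s.params A) ≤ |d| * (2 * (D / (2 * |d|))) := by gcongr
    _ = D := by field_simp

/-- With V the measure of the parameters inside, each coordinate gives |difference|·V ≤ D; adding
the squares bounds the clipped length by the diagonal. -/
theorem clipLength_le_of_subset {s : Segment} {A : Set Point} {l b D : ℝ} (hD : 0 ≤ D)
    (hA : A ⊆ box l b D) : clipLength s A ≤ √2 * D := by
  have hx := volume_params_le (s := s) (k := 0) hD (fun x hx => ⟨(hA hx).1, (hA hx).2.1⟩)
  have hy := volume_params_le (s := s) (k := 1) hD (fun x hx => ⟨(hA hx).2.2.1, (hA hx).2.2.2⟩)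
  set V := volume.real (s.params A) with hV
  have hV0 : 0 ≤ V := measureReal_nonneg
  rw [clipLength_eq, Segment.len_eq, ← hV]
  have e1 : ∀ E : ℝ, √E * V = √(E * V ^ 2) := fun E => by
    rw [Real.sqrt_mul' _ (sq_nonneg V), Real.sqrt_sq hV0]
  have e2 : √2 * D = √(2 * D ^ 2) := by rw [Real.sqrt_mul' _ (sq_nonneg D), Real.sqrt_sq hD]
  rw [e1, e2]
  apply Real.sqrt_le_sqrt
  have hx2 := pow_le_pow_left₀ (by positivity) hx 2
  have hy2 := pow_le_pow_left₀ (by positivity) hy 2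
  rw [mul_pow, sq_abs] at hx2 hy2
  nlinarith

/-- From a point in the square of side `D`, a piece of length at most `D / 2` stays within max-norm
distance `D / 2` of it, hence in the concentric square of radius `D`. -/
theorem len_le_of_meets {s : Segment} {l b D : ℝ} (hD : 0 < D) (h : s.Meets l b D) :
    min s.len (D / 2) ≤ clipLength s (square !₂[l + D / 2, b + D / 2] D) := by
  obtain ⟨t, h0, h1, x1, x2, y1, y2⟩ := h
  rcases eq_or_lt_of_le s.len_nonneg with hl | hl
  · rw [← hl]; exact (min_le_left _ _).trans (clipLength_nonneg _ _)
  have hk : ∀ k : Fin 2, |s.q k - s.p k| ≤ s.len := by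
    exact s.abs_coord_le_len
  have key : ∀ u, u ∈ Set.Icc (0 : ℝ) 1 → |u - t| * s.len ≤ D / 2 →
      u ∈ s.params (square !₂[l + D / 2, b + D / 2] D) := by
    intro u hu hut
    have aux : ∀ k : Fin 2, |(u - t) * (s.q k - s.p k)| ≤ D / 2 := fun k => by
      rw [abs_mul]; exact (mul_le_mul_of_nonneg_left (hk k) (abs_nonneg _)).trans hut
    have a0 := abs_le.1 (aux 0)
    have a1 := abs_le.1 (aux 1)
    refine ⟨hu, fun k => ?_⟩
    rw [lineMap_coord]
    fin_cases k <;> simp <;> rw [abs_le] <;> constructor <;> linarith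
  set w := min 1 (D / 2 / s.len) with hw
  have hw0 : 0 ≤ w := le_min zero_le_one (by positivity)
  have hw1 : w ≤ 1 := min_le_left _ _
  have hwl : w * s.len ≤ D / 2 := by
    have := min_le_right 1 (D / 2 / s.len)
    rw [← hw, le_div_iff₀ hl] at this; exact this
  -- A parameter interval of length `w` containing `t`, pushed back into [0, 1] if `t` is too close
  -- to 1.
  obtain ⟨a, ha0, ha1, hat, hta⟩ : ∃ a, 0 ≤ a ∧ a + w ≤ 1 ∧ a ≤ t ∧ t ≤ a + w := by
    rcases le_total t (1 - w) with h | h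
    · exact ⟨t, h0, by linarith, le_rfl, by linarith⟩
    · exact ⟨1 - w, by linarith, by linarith, h, by linarith⟩
  have hsub : Set.Icc a (a + w) ⊆ s.params (square !₂[l + D / 2, b + D / 2] D) := by
    rintro u ⟨hu1, hu2⟩
    refine key u ⟨by linarith, by linarith⟩ (le_trans ?_ hwl)
    gcongr
    rw [abs_le]; constructor <;> linarith
  have hvol := measureReal_mono (μ := volume) hsub (params_finite _ _)
  rw [Real.volume_real_Icc_of_le (by linarith), add_sub_cancel_left] at hvol
  rw [clipLength_eq]
  calc min s.len (D / 2) = s.len * w := by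
        rw [hw, mul_min_of_nonneg _ _ hl.le, mul_one, mul_div_cancel₀ _ hl.ne']
    _ ≤ _ := by gcongr

theorem square_subset_box (c : Point) (r : ℝ) :
    square c r ⊆ box (c 0 - r) (c 1 - r) (2 * r) := by
  intro x hx
  have h0 := abs_le.1 (hx 0)
  have h1 := abs_le.1 (hx 1)
  exact ⟨by linarith, by linarith, by linarith, by linarith⟩

variable {n : ℕ} (S : Fin n → Segment)

theorem squareCongestion_le_congestion (c : Point) {r : ℝ} (hr : 0 < r) :
    squareCongestion S (square c r) r ≤ congestion S := by
  refine le_csSup ⟨n * (√2 * 2), ?_⟩ ⟨c, r, hr, rfl⟩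
  rintro _ ⟨c, r, hr, rfl⟩
  rw [squareCongestion, div_le_iff₀ hr]
  calc ∑ i, clipLength (S i) (square c r) ≤ ∑ _i : Fin n, √2 * (2 * r) :=
        Finset.sum_le_sum fun i _ => clipLength_le_of_subset (by positivity) (square_subset_box c r)
    _ = _ := by simp; ring

/-- The square of radius `len` around an endpoint contains the whole segment. This lower bound later
turns an additive error into a relative one. -/
theorem one_le_congestion (i : Fin n) (hi : 0 < (S i).len) : 1 ≤ congestion S := by
  refine le_trans ?_ (squareCongestion_le_congestion S (S i).p hi)
  rw [squareCongestion, le_div_iff₀ hi, one_mul]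
  have hpar : (S i).params (square (S i).p (S i).len) = Set.Icc 0 1 := by
    ext t
    refine ⟨fun h => h.1, fun h => ⟨h, fun k => ?_⟩⟩
    rw [lineMap_coord, add_sub_cancel_left, abs_mul, abs_of_nonneg h.1]
    have := (S i).abs_coord_le_len k
    nlinarith [h.2, h.1, abs_nonneg ((S i).q k - (S i).p k)]
  calc (S i).len = clipLength (S i) (square (S i).p (S i).len) := by
        rw [clipLength_eq, hpar]; simp
    _ ≤ _ := Finset.single_le_sum (f := fun j => clipLength (S j) (square (S i).p (S i).len))
        (fun j _ => clipLength_nonneg _ _) (Finset.mem_univ i)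

theorem congestion_nonneg : 0 ≤ congestion S := by
  refine le_trans ?_ (squareCongestion_le_congestion S 0 one_pos)
  exact div_nonneg (Finset.sum_nonneg fun _ _ => clipLength_nonneg _ _) zero_le_one

/-- Long segments meeting a square (counted) and short segments meeting it (weighted by their
length) give a lower bound for the congestion. -/
theorem weight_le_congestion {l b D : ℝ} (hD : 0 < D) {F N : Finset (Fin n)}
    (hF : ∀ i ∈ F, (S i).len < D / 2 ∧ (S i).Meets l b D)
    (hN : ∀ i ∈ N, D / 2 ≤ (S i).len ∧ (S i).Meets l b D) :
    ((∑ i ∈ F, (S i).len) / (D / 2) + N.card) / 2 ≤ congestion S := by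
  refine le_trans ?_ (squareCongestion_le_congestion S !₂[l + D / 2, b + D / 2] hD)
  rw [squareCongestion, le_div_iff₀ hD]
  have hdis : Disjoint F N := Finset.disjoint_left.2 fun i hi hi' =>
    absurd (hF i hi).1 (not_lt.2 (hN i hi').1)
  calc ((∑ i ∈ F, (S i).len) / (D / 2) + N.card) / 2 * D
      = ∑ i ∈ F, (S i).len + ∑ _i ∈ N, D / 2 := by
        rw [Finset.sum_const, nsmul_eq_mul]; field_simp
    _ ≤ ∑ i ∈ F, clipLength (S i) (square !₂[l + D / 2, b + D / 2] D) +
        ∑ i ∈ N, clipLength (S i) (square !₂[l + D / 2, b + D / 2] D) := by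
        gcongr with i hi i hi
        · have := len_le_of_meets hD (hF i hi).2
          rwa [min_eq_left (hF i hi).1.le] at this
        · have := len_le_of_meets hD (hN i hi).2
          rwa [min_eq_right (hN i hi).1] at this
    _ = ∑ i ∈ F ∪ N, clipLength (S i) (square !₂[l + D / 2, b + D / 2] D) :=
        (Finset.sum_union hdis).symm
    _ ≤ _ := Finset.sum_le_sum_of_subset_of_nonneg (Finset.subset_univ _)
        fun _ _ _ => clipLength_nonneg _ _

/-- Each long segment contributes at most the diagonal √2·D, which is 2√2 in units of the radius `D
/ 2`. Short segments missing from `F` are of length at most δ·(D/2)/n, and there are at most `n` of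
them, so together they contribute at most `δ`. -/
theorem squareCongestion_le_weight {l b D δ : ℝ} (hD : 0 < D) (hδ : 0 ≤ δ) {A : Set Point}
    (hA : A ⊆ box l b D) {F N : Finset (Fin n)}
    (hF : ∀ i, 0 < (S i).len → (S i).len < D / 2 → (S i).Meets l b D → i ∉ F →
      (S i).len * n ≤ δ * (D / 2))
    (hN : ∀ i, 0 < (S i).len → D / 2 ≤ (S i).len → (S i).Meets l b D → i ∈ N) :
    squareCongestion S A (D / 2) ≤ (∑ i ∈ F, (S i).len) / (D / 2) + δ + 2 * √2 * N.card := by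
  rw [squareCongestion, div_le_iff₀ (by positivity)]
  rcases Nat.eq_zero_or_pos n with rfl | hn
  · have : 0 ≤ ∑ i ∈ F, (S i).len := Finset.sum_nonneg fun i _ => (S i).len_nonneg
    simp; positivity
  have hn' : (0 : ℝ) < n := by exact_mod_cast hn
  calc ∑ i, clipLength (S i) A
      ≤ ∑ i, ((if i ∈ F then (S i).len else 0) + δ * (D / 2) / n +
          (if i ∈ N then √2 * D else 0)) := by
        refine Finset.sum_le_sum fun i _ => ?_
        have t1 : 0 ≤ (if i ∈ F then (S i).len else 0) := by
          split_ifs; exacts [(S i).len_nonneg, le_rfl]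
        have t2 : 0 ≤ δ * (D / 2) / n := by positivity
        have t3 : 0 ≤ (if i ∈ N then √2 * D else 0) := by
          split_ifs; exacts [by positivity, le_rfl]
        by_cases hm : (S i).Meets l b D
        swap
        · rw [clipLength_eq_zero hA hm]; positivity
        rcases eq_or_lt_of_le (S i).len_nonneg with h0 | h0
        · have := clipLength_le_len (S i) A; linarith
        rcases le_or_gt (D / 2) (S i).len with hl | hl
        · rw [if_pos (hN i h0 hl hm)]
          have := clipLength_le_of_subset (s := S i) hD.le hA
          linarith
        · by_cases hiF : i ∈ F
          · rw [if_pos hiF]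
            have := clipLength_le_len (S i) A; linarith
          · have h1 := hF i h0 hl hm hiF
            rw [← le_div_iff₀ hn'] at h1
            have := clipLength_le_len (S i) A; linarith
    _ = _ := by
        rw [Finset.sum_add_distrib, Finset.sum_add_distrib]
        simp only [Finset.sum_ite_mem, Finset.univ_inter, Finset.sum_const, Finset.card_univ,
          Fintype.card_fin, nsmul_eq_mul]
        field_simp

end Congestion

-- Tree preprocessing and point location by heavy paths.

namespace RealRAM

/-! ## Abbreviations for programs -/

/-- The natural number variable stored in array `a`. -/
def nv (a : ℕ) : NExp := .load a (.lit 0)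
/-- The real variable stored in array `a`. -/
def rv (a : ℕ) : RExp := .load a (.lit 0)
/-- Assignment to a natural number variable. -/
def nset (a : ℕ) (x : NExp) : Prog := .storeN a (.lit 0) x
/-- Assignment to a real variable. -/
def rset (a : ℕ) (x : RExp) : Prog := .storeR a (.lit 0) x
/-- Conditional execution. -/
def when (b : BExp) (P : Prog) : Prog := .ite b P .skip
/-- The test `x ≠ y`. -/
def neN (x y : NExp) : BExp := .not (.and (.not (.ltN x y)) (.not (.ltN y x)))
/-- The test `x ≤ y`. -/
def leR (x y : RExp) : BExp := .not (.ltR y x)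

infixr:60 " ;; " => Prog.seq

@[simp] theorem nv_eval (σ : State) (a : ℕ) : (nv a).eval σ = σ.nat a 0 := by simp [nv, NExp.eval]
@[simp] theorem rv_eval (σ : State) (a : ℕ) : (rv a).eval σ = σ.real a 0 := by
  simp [rv, RExp.eval, NExp.eval]
@[simp] theorem neN_holds (σ : State) (x y : NExp) :
    (neN x y).Holds σ ↔ x.eval σ ≠ y.eval σ := by simp [neN, BExp.Holds]; omega
@[simp] theorem leR_holds (σ : State) (x y : RExp) :
    (leR x y).Holds σ ↔ x.eval σ ≤ y.eval σ := by simp [leR, BExp.Holds]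

section run
variable (ω : ℕ → Bool) (σ : State)
@[simp] theorem run_nset (a : ℕ) (x : NExp) :
    Prog.run ω (nset a x) σ = σ.setNat a 0 (x.eval σ) := by simp [nset, Prog.run, NExp.eval]
@[simp] theorem run_rset (a : ℕ) (x : RExp) :
    Prog.run ω (rset a x) σ = σ.setReal a 0 (x.eval σ) := by simp [rset, Prog.run, NExp.eval]
@[simp] theorem run_storeN (a : ℕ) (i x : NExp) :
    Prog.run ω (.storeN a i x) σ = σ.setNat a (i.eval σ) (x.eval σ) := rfl
@[simp] theorem run_storeR (a : ℕ) (i : NExp) (x : RExp) :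
    Prog.run ω (.storeR a i x) σ = σ.setReal a (i.eval σ) (x.eval σ) := rfl
@[simp] theorem run_seq (P Q : Prog) : Prog.run ω (P ;; Q) σ = Q.run ω (P.run ω σ) := rfl
open Classical in
theorem run_ite (b : BExp) (P Q : Prog) :
    Prog.run ω (.ite b P Q) σ = if b.Holds σ then P.run ω σ else Q.run ω σ := rfl
open Classical in
theorem run_when (b : BExp) (P : Prog) :
    Prog.run ω (when b P) σ = if b.Holds σ then P.run ω σ else σ := rfl
end run

end RealRAM

namespace Congestion

open RealRAM

/-- The number of the quadrant of its parent in which the node `v` lies. -/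
noncomputable def NodeTree.qd (T : NodeTree) (v : ℕ) : ℕ :=
  (if T.X (T.par v) + T.D (T.par v) / 2 ≤ T.X v then 1 else 0) +
  2 * (if T.Y (T.par v) + T.D (T.par v) / 2 ≤ T.Y v then 1 else 0)

theorem NodeTree.qd_lt (T : NodeTree) (v : ℕ) : T.qd v < 4 := by
  unfold NodeTree.qd; split_ifs <;> omega

theorem NodeTree.qd_inj {T : NodeTree} {v w u : ℕ} (hv : T.IsChild v u) (hw : T.IsChild w u)
    (h : T.qd v = T.qd w) : v = w := by
  obtain ⟨hv, hvr, hvp⟩ := hv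
  obtain ⟨hw, hwr, hwp⟩ := hw
  unfold NodeTree.qd at h
  rw [hvp, hwp] at h
  refine T.sib v w hv hw hvr hwr (hvp.trans hwp.symm) ?_ ?_ <;> rw [hvp] <;>
    by_cases a : T.X u + T.D u / 2 ≤ T.X v <;> by_cases b : T.X u + T.D u / 2 ≤ T.X w <;>
    by_cases c : T.Y u + T.D u / 2 ≤ T.Y v <;> by_cases d : T.Y u + T.D u / 2 ≤ T.Y w <;>
    simp [a, b, c, d] at h ⊢

/-- The memory contains the input. -/
structure Inp (T : NodeTree) (n : ℕ) (sg : ℕ → Segment) (σ : State) : Prop where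
  n : σ.nat 0 0 = n
  m : σ.nat 0 1 = T.m
  root : σ.nat 0 2 = T.root
  par : σ.nat 1 = T.par
  px : σ.real 0 = fun i => (sg i).p 0
  py : σ.real 1 = fun i => (sg i).p 1
  qx : σ.real 2 = fun i => (sg i).q 0
  qy : σ.real 3 = fun i => (sg i).q 1
  X : σ.real 4 = T.X
  Y : σ.real 5 = T.Y
  D : σ.real 6 = T.D

/-- A program that does not write to the input arrays. -/
def inputSafe (P : Prog) : Bool :=
  !(P.wN 0 || P.wN 1 || P.wR 0 || P.wR 1 || P.wR 2 || P.wR 3 || P.wR 4 || P.wR 5 || P.wR 6)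

variable {T : NodeTree} {n : ℕ} {sg : ℕ → Segment} {σ τ : State} {ω : ℕ → Bool}

theorem Inp.agrees {P : Prog} (h : Inp T n sg σ) (hP : inputSafe P = true) (ha : Agrees P σ τ) :
    Inp T n sg τ := by
  simp only [inputSafe, Bool.not_eq_true', Bool.or_eq_false_iff] at hP
  obtain ⟨⟨⟨⟨⟨⟨⟨⟨h0, h1⟩, r0⟩, r1⟩, r2⟩, r3⟩, r4⟩, r5⟩, r6⟩ := hP
  have e0 := ha.nat 0 h0
  exact ⟨by rw [e0, h.n], by rw [e0, h.m], by rw [e0, h.root], (ha.nat 1 h1).trans h.par,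
    (ha.real 0 r0).trans h.px, (ha.real 1 r1).trans h.py, (ha.real 2 r2).trans h.qx,
    (ha.real 3 r3).trans h.qy, (ha.real 4 r4).trans h.X, (ha.real 5 r5).trans h.Y,
    (ha.real 6 r6).trans h.D⟩

/-! ## The table of children -/

/-- The specification of the table of children. -/
structure ChildTab (T : NodeTree) (ct : ℕ → ℕ) : Prop where
  sound : ∀ i, ct i = 0 ∨ ∃ c, ct i = c + 1 ∧ T.IsChild c (i / 4) ∧ T.qd c = i % 4
  complete : ∀ c, c < T.m → c ≠ T.root → ct (4 * T.par c + T.qd c) = c + 1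

/-- The number of nodes. -/
def eM : NExp := .load 0 (.lit 1)
/-- The index of the root. -/
def eRoot : NExp := .load 0 (.lit 2)

/-- Entering the node `v` (array 20) into the table of children at quadrant `q`. -/
def childStore (q : ℕ) : Prog :=
  .storeN 10 (.add (.mul (.lit 4) (.load 1 (nv 20))) (.lit q)) (.add (nv 20) (.lit 1))

/-- Entering the node `v` (array 20) into the table of children. -/
def childBody : Prog :=
  when (neN (nv 20) eRoot)
    (.ite (leR (.add (.load 4 (.load 1 (nv 20))) (.div (.load 6 (.load 1 (nv 20))) (.lit 2)))
        (.load 4 (nv 20)))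
      (.ite (leR (.add (.load 5 (.load 1 (nv 20))) (.div (.load 6 (.load 1 (nv 20))) (.lit 2)))
          (.load 5 (nv 20))) (childStore 3) (childStore 1))
      (.ite (leR (.add (.load 5 (.load 1 (nv 20))) (.div (.load 6 (.load 1 (nv 20))) (.lit 2)))
          (.load 5 (nv 20))) (childStore 2) (childStore 0)))

/-- Computing the table of children. -/
def childProg : Prog := forTo 20 eM childBody

theorem childBody_run {k : ℕ} (h : Inp T n sg σ) (hk : σ.nat 20 0 = k) :
    Prog.run ω childBody σ = if k = T.root then σ else
      σ.setNat 10 (4 * T.par k + T.qd k) (k + 1) := by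
  simp only [childBody, run_when, run_ite, neN_holds, leR_holds, NExp.eval, RExp.eval, nv_eval,
    hk, eRoot, h.root, h.par, h.X, h.Y, h.D, childStore, run_storeN]
  unfold NodeTree.qd
  push_cast
  split_ifs <;> simp_all

theorem childProg_wp (h : Inp T n sg σ) (h0 : σ.nat 10 = fun _ => 0) :
    WP ω childProg ((T.m + 1) * (childBody.wc + eM.cost + 20)) σ fun τ =>
      ChildTab T (τ.nat 10) := by
  have hI : ∀ τ, Agrees childProg σ τ → Inp T n sg τ := fun τ ha => h.agrees rfl ha
  refine (WP.forTo (I := fun k τ =>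
    (∀ i, τ.nat 10 i = 0 ∨ ∃ c, τ.nat 10 i = c + 1 ∧ T.IsChild c (i / 4) ∧ T.qd c = i % 4 ∧ c < k) ∧
    ∀ c, c < k → c ≠ T.root → τ.nat 10 (4 * T.par c + T.qd c) = c + 1) (N := T.m) rfl ?_ ?_ ?_).mono
    le_rfl ?_
  · intro τ ha; simp [eM, NExp.eval, (hI τ ha).m]
  · simp [h0]
  · intro k τ hk ha hkv ⟨h1, h2⟩
    refine WP.run rfl ?_
    simp only [childBody_run (hI τ ha) hkv]
    split_ifs with hr
    · subst hr
      simp only [State.setNat_nat, Nat.reduceEqDiff, if_false]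
      refine ⟨fun i => (h1 i).imp_right ?_, fun c hc hcr => h2 c (by omega) hcr⟩
      rintro ⟨c, a1, a2, a3, a4⟩
      exact ⟨c, a1, a2, a3, by omega⟩
    · have hq := T.qd_lt k
      simp only [State.setNat_nat, Nat.reduceEqDiff, if_false, if_true]
      constructor
      · intro i
        by_cases hi : i = 4 * T.par k + T.qd k
        · right
          refine ⟨k, by rw [hi]; simp, ⟨hk, hr, by omega⟩, by omega, by omega⟩
        · rw [Function.update_of_ne hi]
          refine (h1 i).imp_right ?_
          rintro ⟨c, a1, a2, a3, a4⟩
          exact ⟨c, a1, a2, a3, by omega⟩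
      · intro c hc hcr
        by_cases hck : c = k
        · subst hck; simp
        · rw [Function.update_of_ne, h2 c (by omega) hcr]
          intro he
          have := T.qd_lt c
          exact hck (NodeTree.qd_inj (u := T.par k) ⟨by omega, hcr, by omega⟩ ⟨hk, hr, rfl⟩
            (by omega))
  · rintro τ - ⟨h1, h2⟩
    refine ⟨fun i => (h1 i).imp_right ?_, h2⟩
    rintro ⟨c, a1, a2, a3, a4⟩
    exact ⟨c, a1, a2, a3⟩

/-! ## Breadth-first order -/

/-- The specification of a list of all nodes, parents first. -/
structure Order (T : NodeTree) (ord : ℕ → ℕ) : Prop where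
  lt : ∀ t, t < T.m → ord t < T.m
  inj : ∀ t t', t < T.m → t' < T.m → ord t = ord t' → t = t'
  zero : ord 0 = T.root
  par : ∀ t, t < T.m → t ≠ 0 → ord t ≠ T.root ∧ ∃ t' < t, ord t' = T.par (ord t)

theorem Order.surj {ord : ℕ → ℕ} (h : Order T ord) {v : ℕ} (hv : v < T.m) :
    ∃ t < T.m, ord t = v := by
  have := Finset.surjOn_of_injOn_of_card_le (s := Finset.range T.m) (t := Finset.range T.m) ord
    (fun t ht => by simpa using h.lt t (by simpa using ht))
    (fun t ht t' ht' e => h.inj t t' (by simpa using ht) (by simpa using ht') e) le_rfl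
  obtain ⟨t, ht, rfl⟩ := this (by simpa using hv)
  exact ⟨t, by simpa using ht, rfl⟩

/-- The entry of the table of children for the node number `e / 4` in the order and the quadrant
`e % 4`, where `e` is in array 20. -/
def bfsChild : NExp := .load 10 (.add (.mul (.lit 4) (.load 11 (.div (nv 20) (.lit 4))))
  (.sub (nv 20) (.mul (.lit 4) (.div (nv 20) (.lit 4)))))

/-- One step of breadth-first search. -/
def bfsBody : Prog :=
  nset 22 bfsChild ;; when (.ltN (.lit 0) (nv 22))
    (.storeN 11 (nv 21) (.sub (nv 22) (.lit 1)) ;; nset 21 (.add (nv 21) (.lit 1)))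

/-- Breadth-first search. -/
def bfsProg : Prog :=
  (.storeN 11 (.lit 0) eRoot ;; nset 21 (.lit 1)) ;; forTo 20 (.mul (.lit 4) eM) bfsBody

/-- The invariant of breadth-first search after `e` steps. -/
structure BfsInv (T : NodeTree) (e : ℕ) (ord : ℕ → ℕ) (tail : ℕ) : Prop where
  pos : 0 < tail
  lt : ∀ t, t < tail → ord t < T.m
  inj : ∀ t t', t < tail → t' < tail → ord t = ord t' → t = t'
  zero : ord 0 = T.root
  par : ∀ t, t < tail → t ≠ 0 →
    ord t ≠ T.root ∧ ∃ t' < t, ord t' = T.par (ord t) ∧ 4 * t' + T.qd (ord t) < e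
  closed : ∀ t, t < tail → ∀ c, T.IsChild c (ord t) → 4 * t + T.qd c < e → ∃ t' < tail, ord t' = c

theorem BfsInv.tail_le {e tail : ℕ} {ord : ℕ → ℕ} (h : BfsInv T e ord tail) : tail ≤ T.m := by
  have := Finset.card_le_card_of_injOn (s := Finset.range tail) (t := Finset.range T.m) ord
    (fun t ht => by simpa using h.lt t (by simpa using ht))
    (fun t ht t' ht' e => h.inj t t' (by simpa using ht) (by simpa using ht') e)
  simpa using this

/-- Step `e` scans quadrant `e % 4` of the node at position `e / 4`. Once all quadrants of all
queued nodes have been scanned, the queue contains the root and is closed under children, so it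
contains every node. -/
theorem BfsInv.complete {e tail : ℕ} {ord : ℕ → ℕ} (h : BfsInv T e ord tail) (he : 4 * tail ≤ e) :
    tail = T.m := by
  refine le_antisymm h.tail_le ?_
  have hall : ∀ k v, v < T.m → T.par^[k] v = T.root → ∃ t < tail, ord t = v := by
    intro k
    induction k with
    | zero => intro v _ hr; exact ⟨0, h.pos, h.zero.trans hr.symm⟩
    | succ k ih =>
      intro v hv hk
      by_cases hr : v = T.root
      · exact ⟨0, h.pos, h.zero.trans hr.symm⟩
      obtain ⟨t, ht, e1⟩ := ih (T.par v) (T.par_lt v hv) hk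
      exact h.closed t ht v ⟨hv, hr, e1.symm⟩ (by have := T.qd_lt v; omega)
  have := Finset.card_le_card_of_surjOn (s := Finset.range tail) (t := Finset.range T.m) ord
    (fun v hv => by
      obtain ⟨k, hk⟩ := NodeTree.reach_root (T := T) (v := v) (by simpa using hv)
      obtain ⟨t, ht, rfl⟩ := hall k v (by simpa using hv) hk
      exact ⟨t, by simpa using ht, rfl⟩)
  simpa using this

theorem BfsInv.order {tail : ℕ} {ord : ℕ → ℕ} (h : BfsInv T (4 * T.m) ord tail) : Order T ord := by
  obtain rfl : tail = T.m := h.complete (by have := h.tail_le; omega)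
  exact ⟨h.lt, h.inj, h.zero, fun t ht h0 => (h.par t ht h0).imp_right fun ⟨t', a, b, _⟩ => ⟨t', a, b⟩⟩

/-- The queue cannot run empty before step `4 * T.m`, since it would then already be complete. Hence
a loop of fixed length needs no test for emptiness. -/
theorem BfsInv.lt_tail {e tail : ℕ} {ord : ℕ → ℕ} (h : BfsInv T e ord tail) (he : e < 4 * T.m) :
    e / 4 < tail := by
  by_contra hcon
  have := h.complete (by omega)
  omega

theorem BfsInv.step_none {e tail : ℕ} {ord ct : ℕ → ℕ} (hct : ChildTab T ct)
    (h : BfsInv T e ord tail) (h0 : ct (4 * ord (e / 4) + e % 4) = 0) :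
    BfsInv T (e + 1) ord tail := by
  refine ⟨h.pos, h.lt, h.inj, h.zero, fun t ht h0 => (h.par t ht h0).imp_right
    fun ⟨t', a, b, c⟩ => ⟨t', a, b, by omega⟩, fun t ht c hc hlt => ?_⟩
  by_cases he : 4 * t + T.qd c = e
  · have := hct.complete c hc.1 hc.2.1
    have hq := T.qd_lt c
    obtain rfl : t = e / 4 := by omega
    have : T.qd c = e % 4 := by omega
    rw [hc.2.2] at *
    simp_all
  · exact h.closed t ht c hc (by omega)

theorem BfsInv.step_some {e tail c : ℕ} {ord ct : ℕ → ℕ} (hct : ChildTab T ct)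
    (h : BfsInv T e ord tail) (he : e < 4 * T.m) (hc : ct (4 * ord (e / 4) + e % 4) = c + 1) :
    BfsInv T (e + 1) (Function.update ord tail c) (tail + 1) := by
  have htl := h.lt_tail he
  rcases hct.sound (4 * ord (e / 4) + e % 4) with h' | ⟨c', h1, h2, h3⟩
  · omega
  obtain rfl : c' = c := by omega
  rw [show (4 * ord (e / 4) + e % 4) / 4 = ord (e / 4) by omega] at h2
  rw [show (4 * ord (e / 4) + e % 4) % 4 = e % 4 by omega] at h3
  -- A queued copy of the child would have been found at an earlier step, but the parent and the
  -- quadrant determine the step, and it is `e`.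
  have hne : ∀ t, t < tail → ord t ≠ c' := by
    intro t ht he'
    by_cases ht0 : t = 0
    · subst ht0; exact h2.2.1 (he'.symm.trans h.zero)
    obtain ⟨-, t', a, b, d⟩ := h.par t ht ht0
    rw [he', h2.2.2] at b
    have := h.inj t' (e / 4) (by omega) htl b
    rw [he', h3] at d
    omega
  have hup : ∀ t, t < tail → Function.update ord tail c' t = ord t := fun t ht =>
    Function.update_of_ne (by omega) _ _
  refine ⟨by omega, ?_, ?_, ?_, ?_, ?_⟩
  · intro t ht
    rcases Nat.lt_succ_iff_lt_or_eq.1 ht with ht | rfl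
    · rw [hup t ht]; exact h.lt t ht
    · rw [Function.update_self]; exact h2.1
  · intro t t' ht ht' heq
    rcases Nat.lt_succ_iff_lt_or_eq.1 ht with ht | rfl <;>
      rcases Nat.lt_succ_iff_lt_or_eq.1 ht' with ht' | rfl
    · rw [hup t ht, hup t' ht'] at heq; exact h.inj t t' ht ht' heq
    · rw [hup t ht, Function.update_self] at heq; exact absurd heq (hne t ht)
    · rw [hup t' ht', Function.update_self] at heq; exact absurd heq.symm (hne t' ht')
    · rfl
  · rw [hup 0 h.pos, h.zero]
  · intro t ht h0
    rcases Nat.lt_succ_iff_lt_or_eq.1 ht with ht | rfl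
    · rw [hup t ht]
      obtain ⟨a, t', b, d, f⟩ := h.par t ht h0
      exact ⟨a, t', b, by rw [hup t' (by omega), d], by omega⟩
    · rw [Function.update_self]
      exact ⟨h2.2.1, e / 4, htl, by rw [hup _ htl, h2.2.2], by omega⟩
  · intro t ht d hd hlt
    by_cases hdc : d = c'
    · exact ⟨tail, by omega, by rw [Function.update_self, hdc]⟩
    rcases Nat.lt_succ_iff_lt_or_eq.1 ht with ht | rfl
    · rw [hup t ht] at hd
      by_cases he' : 4 * t + T.qd d = e
      · have hq := T.qd_lt d
        obtain rfl : t = e / 4 := by omega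
        exact absurd (NodeTree.qd_inj hd h2 (by omega)) hdc
      · obtain ⟨t', a, b⟩ := h.closed t ht d hd (by omega)
        exact ⟨t', by omega, by rw [hup t' a, b]⟩
    · omega

theorem bfsProg_wp (h : Inp T n sg σ) (hct : ChildTab T (σ.nat 10)) :
    WP ω bfsProg (8 + (4 * T.m + 1) * (bfsBody.wc + (NExp.mul (.lit 4) eM).cost + 20)) σ fun τ =>
      Order T (τ.nat 11) := by
  refine WP.comp (R := fun τ => τ.nat 11 0 = T.root ∧ τ.nat 21 0 = 1) ((WP.run rfl ?_).mono
    (by decide) fun _ _ h => h) ?_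
  · simp [eRoot, NExp.eval, h.root]
  intro σ₁ ha₁ ⟨hr, ht⟩
  have h₁ := h.agrees rfl ha₁
  have hc₁ : σ₁.nat 10 = σ.nat 10 := ha₁.nat 10 rfl
  have hI : ∀ τ, Agrees (forTo 20 (.mul (.lit 4) eM) bfsBody) σ₁ τ → Inp T n sg τ ∧
      τ.nat 10 = σ.nat 10 := fun τ ha => ⟨h₁.agrees rfl ha, (ha.nat 10 rfl).trans hc₁⟩
  refine (WP.forTo (I := fun e τ => BfsInv T e (τ.nat 11) (τ.nat 21 0)) (N := 4 * T.m) rfl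
    ?_ ?_ ?_).mono le_rfl fun τ _ h => h.order
  · intro τ ha; simp [eM, NExp.eval, (hI τ ha).1.m]
  · simp only [State.setNat_nat, Nat.reduceEqDiff, if_false, ht]
    refine ⟨one_pos, fun t ht => ?_, fun t t' _ _ _ => by omega, hr, fun t _ _ => by omega,
      fun _ _ _ _ _ => by omega⟩
    obtain rfl : t = 0 := by omega
    rw [hr]; exact T.root_lt
  · intro e τ he ha hev hinv
    refine WP.run rfl ?_
    obtain ⟨hi, hct'⟩ := hI τ ha
    have hE : bfsChild.eval τ = σ.nat 10 (4 * τ.nat 11 (e / 4) + e % 4) := by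
      simp only [bfsChild, NExp.eval, nv_eval, hev, hct']
      congr 2; omega
    simp only [bfsBody, run_seq, run_when, run_nset, hE, BExp.Holds, NExp.eval, nv_eval]
    split_ifs with hpos
    · simp at hpos
      obtain ⟨c, hc⟩ := Nat.exists_eq_succ_of_ne_zero hpos.ne'
      have := hinv.step_some hct he hc
      simpa [hc, NExp.eval] using this
    · simp at hpos
      simpa using hinv.step_none hct hpos

end Congestion

namespace Congestion

open RealRAM
variable {T : NodeTree} {n : ℕ} {sg : ℕ → Segment} {σ τ : State} {ω : ℕ → Bool}

/-! ## Sizes of subtrees -/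

/-- The properties of the sizes of the subtrees that the search needs. -/
structure Sizes (T : NodeTree) (sz : ℕ → ℕ) : Prop where
  pos : ∀ v, v < T.m → 1 ≤ sz v
  le : ∀ v, v < T.m → sz v ≤ T.m
  last : sz T.m = 0
  child : ∀ c u, T.IsChild c u → sz c < sz u
  pair : ∀ c c' u, T.IsChild c u → T.IsChild c' u → c ≠ c' → sz c + sz c' < sz u

open Classical in
/-- The children of `u` that have been processed after `e` steps. -/
noncomputable def doneChildren (T : NodeTree) (ord : ℕ → ℕ) (e u : ℕ) : Finset ℕ :=
  (Finset.range T.m).filter fun c => T.IsChild c u ∧ ∃ t, T.m - e ≤ t ∧ t < T.m ∧ ord t = c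

/-- The invariant of the computation of the sizes. -/
structure SizeInv (T : NodeTree) (ord : ℕ → ℕ) (e : ℕ) (sz : ℕ → ℕ) : Prop where
  eq : ∀ u, u < T.m → sz u = 1 + ∑ c ∈ doneChildren T ord e u, sz c
  total : ∑ t ∈ Finset.range (T.m - e), sz (ord t) = T.m
  last : sz T.m = 0

/-- After `T.m - 1` steps only the root is unprocessed, so `total` reads `sz T.root = T.m`, and
sizes strictly grow towards the root. The inequalities for children follow because a size is one
plus the sum over all children. -/
theorem SizeInv.sizes {ord sz : ℕ → ℕ} (ho : Order T ord) (h : SizeInv T ord (T.m - 1) sz) :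
    Sizes T sz := by
  classical
  have hroot := T.root_lt
  have hdone : ∀ c u, T.IsChild c u → c ∈ doneChildren T ord (T.m - 1) u := by
    intro c u hc
    obtain ⟨t, ht, hte⟩ := ho.surj hc.1
    refine Finset.mem_filter.2 ⟨by simpa using hc.1, hc, t, ?_, ht, hte⟩
    have : t ≠ 0 := by rintro rfl; exact hc.2.1 (hte.symm.trans ho.zero)
    omega
  have hul : ∀ c u, T.IsChild c u → u < T.m := fun c u hc => hc.2.2 ▸ T.par_lt c hc.1
  have hchild : ∀ c u, T.IsChild c u → sz c < sz u := by
    intro c u hc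
    rw [h.eq u (hul c u hc)]
    have := Finset.single_le_sum (f := sz) (fun _ _ => Nat.zero_le _) (hdone c u hc)
    omega
  have hr : sz T.root = T.m := by
    have := h.total
    rw [show T.m - (T.m - 1) = 1 by omega] at this
    simpa [ho.zero] using this
  refine ⟨fun v hv => by rw [h.eq v hv]; omega, ?_, h.last, hchild, ?_⟩
  · have hmono : ∀ k v, v < T.m → T.par^[k] v = T.root → sz v ≤ T.m := by
      intro k
      induction k with
      | zero => intro v _ hk; rw [show v = T.root from hk, hr]
      | succ k ih =>
        intro v hv hk
        by_cases hvr : v = T.root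
        · rw [hvr, hr]
        · exact (hchild v _ ⟨hv, hvr, rfl⟩).le.trans (ih _ (T.par_lt v hv) hk)
    intro v hv
    obtain ⟨k, hk⟩ := NodeTree.reach_root hv
    exact hmono k v hv hk
  · intro c c' u hc hc' hne
    rw [h.eq u (hul c u hc)]
    have : ∑ x ∈ {c, c'}, sz x ≤ ∑ x ∈ doneChildren T ord (T.m - 1) u, sz x := by
      refine Finset.sum_le_sum_of_subset fun x hx => ?_
      rcases Finset.mem_insert.1 hx with rfl | hx
      · exact hdone _ _ hc
      · rw [Finset.mem_singleton.1 hx]; exact hdone _ _ hc'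
    rw [Finset.sum_pair hne] at this
    omega

/-- Nodes are processed in the reverse of an order with parents first. The parent `p` that receives
the update is therefore not yet processed and occurs in none of the sums over processed children. In
`total`, position `s` leaves the sum while its size is added at the position of `p`. -/
theorem SizeInv.step {ord sz : ℕ → ℕ} {e : ℕ} (ho : Order T ord) (he : e < T.m - 1)
    (h : SizeInv T ord e sz) : SizeInv T ord (e + 1) (Function.update sz
      (T.par (ord (T.m - 1 - e))) (sz (T.par (ord (T.m - 1 - e))) + sz (ord (T.m - 1 - e)))) := by
  classical
  set s := T.m - 1 - e with hs
  obtain ⟨hvr, t', ht', hpt⟩ := ho.par s (by omega) (by omega)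
  have hv := ho.lt s (by omega)
  set v := ord s with hvdef
  set p := T.par v with hp
  have hpm : p < T.m := T.par_lt v hv
  have hsplit : ∀ u, doneChildren T ord (e + 1) u =
      if p = u then insert v (doneChildren T ord e u) else doneChildren T ord e u := by
    intro u
    ext c
    have hiff : (∃ t, T.m - (e + 1) ≤ t ∧ t < T.m ∧ ord t = c) ↔
        c = v ∨ ∃ t, T.m - e ≤ t ∧ t < T.m ∧ ord t = c := by
      constructor
      · rintro ⟨t, h1, h2, h3⟩
        rcases eq_or_lt_of_le h1 with h1 | h1
        · left; rw [← h3, ← h1, hvdef]; congr 1; omega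
        · exact .inr ⟨t, by omega, h2, h3⟩
      · rintro (rfl | ⟨t, h1, h2, h3⟩)
        · exact ⟨s, by omega, by omega, rfl⟩
        · exact ⟨t, by omega, h2, h3⟩
    simp only [doneChildren, Finset.mem_filter, hiff]
    split_ifs with hpu
    · simp only [Finset.mem_insert, Finset.mem_filter, Finset.mem_range]
      constructor
      · rintro ⟨a, b, rfl | c⟩
        · exact .inl rfl
        · exact .inr ⟨a, b, c⟩
      · rintro (rfl | ⟨a, b, c⟩)
        · exact ⟨hv, ⟨hv, hvr, hpu⟩, .inl rfl⟩
        · exact ⟨a, b, .inr c⟩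
    · simp only [Finset.mem_filter, Finset.mem_range]
      constructor
      · rintro ⟨a, b, rfl | c⟩
        · exact absurd b.2.2 hpu
        · exact ⟨a, b, c⟩
      · rintro ⟨a, b, c⟩
        exact ⟨a, b, .inr c⟩
  have hpnot : ∀ u, p ∉ doneChildren T ord e u := by
    intro u hmem
    obtain ⟨-, -, t, a, b, c⟩ := Finset.mem_filter.1 hmem
    have := ho.inj t t' b (by omega) (c.trans hpt.symm)
    omega
  have hvnot : ∀ u, v ∉ doneChildren T ord e u := by
    intro u hmem
    obtain ⟨-, -, t, a, b, c⟩ := Finset.mem_filter.1 hmem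
    have := ho.inj t s b (by omega) c
    omega
  have hvp : v ≠ p := by
    intro hvp
    have := ho.inj t' s (by omega) (by omega) (hpt.trans hvp.symm)
    omega
  have hsum : ∀ u, ∑ c ∈ doneChildren T ord e u, Function.update sz p (sz p + sz v) c =
      ∑ c ∈ doneChildren T ord e u, sz c := fun u => Finset.sum_congr rfl fun c hc => by
    rw [Function.update_of_ne]; rintro rfl; exact hpnot u hc
  refine ⟨?_, ?_, ?_⟩
  · intro u hu
    rw [hsplit]
    split_ifs with hpu
    · rw [Finset.sum_insert (hvnot u), hsum, ← hpu, Function.update_self,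
        Function.update_of_ne hvp, h.eq p hpm]
      omega
    · rw [hsum, Function.update_of_ne (Ne.symm hpu), h.eq u hu]
  · have htot := h.total
    rw [show T.m - e = s + 1 by omega, Finset.sum_range_succ] at htot
    rw [show T.m - (e + 1) = s by omega]
    have h1 : ∑ t ∈ Finset.range s, Function.update sz p (sz p + sz v) (ord t) =
        ∑ t ∈ Finset.range s, (sz (ord t) + if t = t' then sz v else 0) := by
      refine Finset.sum_congr rfl fun t ht => ?_
      have hts : t < s := by simpa using ht
      split_ifs with htt
      · rw [htt, hpt, Function.update_self]
      · rw [Function.update_of_ne, add_zero]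
        intro heq
        exact htt (ho.inj t t' (by omega) (by omega) (heq.trans hpt.symm))
    rw [h1, Finset.sum_add_distrib, Finset.sum_ite_eq' , if_pos (by simpa using ht')]
    exact htot
  · rw [Function.update_of_ne (by omega), h.last]

/-- One step of the computation of the sizes. -/
def sizeBody : Prog :=
  nset 22 (.load 11 (.sub (.sub eM (.lit 1)) (nv 20))) ;;
    .storeN 12 (.load 1 (nv 22)) (.add (.load 12 (.load 1 (nv 22))) (.load 12 (nv 22)))

/-- Initialising the sizes. -/
def sizeInit : Prog := .storeN 12 (nv 20) (.lit 1)

/-- Computing the sizes of the subtrees. -/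
def sizeProg : Prog := forTo 20 eM sizeInit ;; forTo 20 (.sub eM (.lit 1)) sizeBody

theorem sizeProg_wp (h : Inp T n sg σ) (ho : Order T (σ.nat 11)) (h0 : σ.nat 12 = fun _ => 0) :
    WP ω sizeProg ((T.m + 1) * (sizeInit.wc + eM.cost + 20) +
      (T.m - 1 + 1) * (sizeBody.wc + (NExp.sub eM (.lit 1)).cost + 20)) σ fun τ =>
      Sizes T (τ.nat 12) := by
  classical
  have hm := T.root_lt
  refine WP.comp (R := fun τ => ∀ v, τ.nat 12 v = if v < T.m then 1 else 0) ?_ ?_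
  · refine WP.forTo (I := fun k τ => ∀ v, τ.nat 12 v = if v < k then 1 else 0) rfl ?_ ?_ ?_
    · intro τ ha; simp [eM, NExp.eval, (h.agrees rfl ha).m]
    · simp [h0]
    · intro k τ hk ha hkv hi
      refine WP.run rfl ?_
      intro v
      simp only [sizeInit, run_storeN, nv_eval, hkv, NExp.eval, State.setNat_nat]
      by_cases hvk : v = k
      · subst hvk; simp
      · simp [Function.update_of_ne hvk, hi v]
        congr 1
        simp; omega
  intro σ₁ ha₁ hs₁
  have h₁ := h.agrees rfl ha₁
  have ho₁ : σ₁.nat 11 = σ.nat 11 := ha₁.nat 11 rfl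
  have hI : ∀ τ, Agrees (forTo 20 (.sub eM (.lit 1)) sizeBody) σ₁ τ → Inp T n sg τ ∧
      τ.nat 11 = σ.nat 11 := fun τ ha => ⟨h₁.agrees rfl ha, (ha.nat 11 rfl).trans ho₁⟩
  refine (WP.forTo (I := fun e τ => SizeInv T (σ.nat 11) e (τ.nat 12)) rfl ?_ ?_ ?_).mono
    le_rfl fun τ _ h => h.sizes ho
  · intro τ ha; simp [eM, NExp.eval, (hI τ ha).1.m]
  · have hemp : ∀ u, doneChildren T (σ.nat 11) 0 u = ∅ := fun u => by
      refine Finset.filter_eq_empty_iff.2 ?_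
      rintro c - ⟨-, t, a, b, -⟩
      omega
    simp only [State.setNat_nat, Nat.reduceEqDiff, if_false]
    refine ⟨fun u hu => by simp [hemp, hs₁, hu], ?_, by simp [hs₁]⟩
    rw [Finset.sum_congr rfl (g := fun _ => 1)]
    · simp
    · intro t ht
      rw [hs₁, if_pos (ho.lt t (by simpa using ht))]
  · intro e τ he ha hev hinv
    refine WP.run rfl ?_
    obtain ⟨hi, hord⟩ := hI τ ha
    have := hinv.step ho he
    simpa [sizeBody, NExp.eval, eM, hi.m, hi.par, hord, hev] using this

/-! ## Heavy children -/

/-- The specification of the table of heavy children; `T.m` is the dummy child of a leaf. -/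
structure Heavy (T : NodeTree) (sz hv : ℕ → ℕ) : Prop where
  last : hv T.m = T.m
  child : ∀ u, u < T.m → hv u = T.m ∨ T.IsChild (hv u) u
  max : ∀ c u, T.IsChild c u → sz c ≤ sz (hv u)

/-- Initialising the heavy children. -/
def heavyInit : Prog := .storeN 13 (nv 20) eM

/-- One step of the computation of the heavy children. -/
def heavyBody : Prog :=
  when (.and (neN (nv 20) eRoot) (.ltN (.load 12 (.load 13 (.load 1 (nv 20)))) (.load 12 (nv 20))))
    (.storeN 13 (.load 1 (nv 20)) (nv 20))

/-- Computing the heavy children. -/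
def heavyProg : Prog := forTo 20 (.add eM (.lit 1)) heavyInit ;; forTo 20 eM heavyBody

theorem heavyProg_wp (h : Inp T n sg σ) :
    WP ω heavyProg ((T.m + 1 + 1) * (heavyInit.wc + (NExp.add eM (.lit 1)).cost + 20) +
      (T.m + 1) * (heavyBody.wc + eM.cost + 20)) σ fun τ => Heavy T (σ.nat 12) (τ.nat 13) := by
  have hm := T.root_lt
  refine WP.comp (R := fun τ => ∀ v, v ≤ T.m → τ.nat 13 v = T.m) ?_ ?_
  · refine (WP.forTo (I := fun k τ => ∀ v, v < k → τ.nat 13 v = T.m) (N := T.m + 1)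
      rfl ?_ ?_ ?_).mono le_rfl fun τ _ h v hv => h v (by omega)
    · intro τ ha; simp [eM, NExp.eval, (h.agrees rfl ha).m]
    · simp
    · intro k τ hk ha hkv hi
      refine WP.run rfl ?_
      intro v hv
      simp only [heavyInit, run_storeN, nv_eval, hkv, NExp.eval, State.setNat_nat, eM,
        (h.agrees rfl ha).m]
      by_cases hvk : v = k
      · subst hvk; simp
      · simp [Function.update_of_ne hvk, hi v (by omega)]
  intro σ₁ ha₁ hs₁
  have h₁ := h.agrees rfl ha₁
  have ho₁ : σ₁.nat 12 = σ.nat 12 := ha₁.nat 12 rfl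
  have hI : ∀ τ, Agrees (forTo 20 eM heavyBody) σ₁ τ → Inp T n sg τ ∧
      τ.nat 12 = σ.nat 12 := fun τ ha => ⟨h₁.agrees rfl ha, (ha.nat 12 rfl).trans ho₁⟩
  refine (WP.forTo (I := fun k τ => τ.nat 13 T.m = T.m ∧
    (∀ u, u < T.m → τ.nat 13 u = T.m ∨ T.IsChild (τ.nat 13 u) u) ∧
    ∀ c u, c < k → T.IsChild c u → σ.nat 12 c ≤ σ.nat 12 (τ.nat 13 u)) rfl ?_ ?_ ?_).mono
    le_rfl fun τ _ h => ⟨h.1, h.2.1, fun c u hc => h.2.2 c u hc.1 hc⟩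
  · intro τ ha; simp [eM, NExp.eval, (hI τ ha).1.m]
  · simp [hs₁]
    intro u hu; left; exact hs₁ u hu.le
  · intro k τ hk ha hkv ⟨h1, h2, h3⟩
    refine WP.run rfl ?_
    obtain ⟨hi, hsz⟩ := hI τ ha
    have hpk := T.par_lt k hk
    simp only [heavyBody, run_when, BExp.Holds, neN_holds, NExp.eval, nv_eval, hkv, eRoot, hi.root,
      hi.par, hsz, run_storeN]
    split_ifs with hc
    · obtain ⟨hc1, hc2⟩ := hc
      simp only [State.setNat_nat, Nat.reduceEqDiff, if_false, if_true]
      refine ⟨by rw [Function.update_of_ne (by omega), h1], fun u hu => ?_, fun c u hck hcu => ?_⟩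
      · by_cases hup : u = T.par k
        · subst hup
          rw [Function.update_self]
          exact .inr ⟨hk, hc1, rfl⟩
        · rw [Function.update_of_ne hup]; exact h2 u hu
      · by_cases hup : u = T.par k
        · subst hup
          rw [Function.update_self]
          by_cases hck' : c = k
          · rw [hck']
          · exact (h3 c _ (by omega) hcu).trans hc2.le
        · rw [Function.update_of_ne hup]
          refine h3 c u ?_ hcu
          have : c ≠ k := by rintro rfl; exact hup hcu.2.2.symm
          omega
    · simp only [State.setNat_nat, Nat.reduceEqDiff, if_false]
      refine ⟨h1, h2, fun c u hck hcu => ?_⟩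
      by_cases hck' : c = k
      · subst hck'
        obtain ⟨-, hr, rfl⟩ := hcu
        by_contra hcon
        exact hc ⟨hr, not_le.1 hcon⟩
      · exact h3 c u (by omega) hcu

/-! ## Jumps along heavy paths -/

/-- The specification of the table of jumps. -/
def Jump (T : NodeTree) (L : ℕ) (hv J : ℕ → ℕ) : Prop :=
  ∀ k v, k ≤ L → v ≤ T.m → J (v + k * (T.m + 1)) = hv^[2 ^ k] v

/-- One step of the computation of the table of jumps. -/
def jumpBody : Prog :=
  .storeN 13 (.add (nv 20) (.add eM (.lit 1)))
    (.load 13 (.add (.load 13 (nv 20))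
      (.mul (.div (nv 20) (.add eM (.lit 1))) (.add eM (.lit 1)))))

/-- The bound of the loop computing the table of jumps. -/
def jumpBound : NExp := .mul (nv 15) (.add eM (.lit 1))

/-- Computing the table of jumps. -/
def jumpProg : Prog := forTo 20 jumpBound jumpBody

theorem Heavy.le {sz hv : ℕ → ℕ} (h : Heavy T sz hv) {v : ℕ} (hvm : v ≤ T.m) : hv v ≤ T.m := by
  rcases hvm.eq_or_lt with rfl | hlt
  · exact h.last.le
  · rcases h.child v hlt with h | h
    · exact h.le
    · exact h.1.le

theorem Heavy.iter_le {sz hv : ℕ → ℕ} (h : Heavy T sz hv) {v : ℕ} (hvm : v ≤ T.m) (k : ℕ) :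
    hv^[k] v ≤ T.m := by
  induction k generalizing v with
  | zero => exact hvm
  | succ k ih => rw [Function.iterate_succ_apply]; exact ih (h.le hvm)

theorem jumpProg_wp {L : ℕ} {sz : ℕ → ℕ} (h : Inp T n sg σ) (hL : σ.nat 15 0 = L)
    (hh : Heavy T sz (σ.nat 13)) :
    WP ω jumpProg ((L * (T.m + 1) + 1) * (jumpBody.wc + jumpBound.cost + 20)) σ fun τ =>
      ∃ hv, Heavy T sz hv ∧ Jump T L hv (τ.nat 13) := by
  have hI : ∀ τ, Agrees jumpProg σ τ → Inp T n sg τ ∧ τ.nat 15 0 = L :=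
    fun τ ha => ⟨h.agrees rfl ha, by rw [ha.nat 15 rfl, hL]⟩
  set hv := σ.nat 13 with hhv
  -- Level 0 of the table is the array of heavy children itself, so the first `T.m + 1` entries are
  -- valid from the start. Step `e` fills entry `e + (T.m + 1)` by composing two jumps of the
  -- preceding level.
  refine (WP.forTo (I := fun e τ => ∀ k v, v ≤ T.m → v + k * (T.m + 1) < e + (T.m + 1) →
    τ.nat 13 (v + k * (T.m + 1)) = hv^[2 ^ k] v) (N := L * (T.m + 1)) rfl ?_ ?_ ?_).mono
    le_rfl fun τ _ h => ⟨hv, hh, fun k v hk hv => h k v hv ?_⟩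
  · intro τ ha; simp [eM, jumpBound, NExp.eval, (hI τ ha).1.m, (hI τ ha).2]
  · intro k v hvm hlt
    have hk : k = 0 := by
      by_contra hk
      have : 1 * (T.m + 1) ≤ k * (T.m + 1) := Nat.mul_le_mul_right _ (by omega)
      omega
    subst hk
    simp [hhv]
  · intro e τ he ha hev hinv
    refine WP.run rfl ?_
    obtain ⟨hi, hL'⟩ := hI τ ha
    intro k v hvm hlt
    simp only [jumpBody, run_storeN, NExp.eval, eM, nv_eval, hev, hi.m, State.setNat_nat,
      Nat.reduceEqDiff, if_false, if_true]
    by_cases heq : v + k * (T.m + 1) = e + (T.m + 1)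
    · obtain ⟨k, rfl⟩ : ∃ j, k = j + 1 := ⟨k - 1, by
        rcases k with _ | k
        · omega
        · simp⟩
      have he' : e = v + k * (T.m + 1) := by rw [Nat.succ_mul] at heq; omega
      rw [heq, Function.update_self]
      have hdiv : e / (T.m + 1) = k := by
        rw [he', Nat.add_mul_div_right _ _ (by omega), Nat.div_eq_of_lt (by omega), zero_add]
      rw [hdiv]
      have e1 : τ.nat 13 e = hv^[2 ^ k] v := by
        rw [he']; exact hinv k v hvm (by omega)
      have hle := hh.iter_le hvm (2 ^ k)
      rw [e1, hinv k _ hle (by omega), ← Function.iterate_add_apply, pow_succ, Nat.mul_two]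
    · rw [Function.update_of_ne heq]
      exact hinv k v hvm (by omega)
  · have : k * (T.m + 1) ≤ L * (T.m + 1) := Nat.mul_le_mul_right _ hk
    omega

end Congestion

namespace Congestion

open RealRAM
variable {T : NodeTree} {n : ℕ} {sg : ℕ → Segment} {σ τ : State} {ω : ℕ → Bool}

/-! ## Finding the lowest node containing a square -/

/-- The memory contains the tables needed for the search. -/
structure TreeTab (T : NodeTree) (L : ℕ) (σ : State) : Prop where
  child : ChildTab T (σ.nat 10)
  jump : ∃ sz hv, Sizes T sz ∧ Heavy T sz hv ∧ Jump T L hv (σ.nat 13)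
  L : σ.nat 15 0 = L

theorem TreeTab.agrees {L : ℕ} {P : Prog} (h : TreeTab T L σ)
    (hP : (P.wN 10 || P.wN 13 || P.wN 15) = false) (ha : Agrees P σ τ) : TreeTab T L τ := by
  simp only [Bool.or_eq_false_iff] at hP
  obtain ⟨⟨h10, h13⟩, h15⟩ := hP
  exact ⟨by rw [ha.nat 10 h10]; exact h.child, by rw [ha.nat 13 h13]; exact h.jump,
    by rw [ha.nat 15 h15]; exact h.L⟩

/-- The square stored in the real arrays 20 (`x`), 21 (`y`) and 22 (side). -/
structure Qry (x y g : ℝ) (σ : State) : Prop where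
  x : σ.real 20 0 = x
  y : σ.real 21 0 = y
  g : σ.real 22 0 = g

theorem Qry.agrees {x y g : ℝ} {P : Prog} (h : Qry x y g σ)
    (hP : (P.wR 20 || P.wR 21 || P.wR 22) = false) (ha : Agrees P σ τ) : Qry x y g τ := by
  simp only [Bool.or_eq_false_iff] at hP
  obtain ⟨⟨h0, h1⟩, h2⟩ := hP
  exact ⟨by rw [ha.real 20 h0]; exact h.x, by rw [ha.real 21 h1]; exact h.y,
    by rw [ha.real 22 h2]; exact h.g⟩

/-- The test whether the cell of `w` strictly contains the stored square. -/
def ccB (w : NExp) : BExp :=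
  .and (leR (.load 4 w) (rv 20)) (.and (leR (.add (rv 20) (rv 22)) (.add (.load 4 w) (.load 6 w)))
    (.and (leR (.load 5 w) (rv 21)) (.and
      (leR (.add (rv 21) (rv 22)) (.add (.load 5 w) (.load 6 w))) (.ltR (rv 22) (.load 6 w)))))

theorem ccB_holds {x y g : ℝ} (h : Inp T n sg σ) (hq : Qry x y g σ) (w : NExp) :
    (ccB w).Holds σ ↔ T.CC x y g (w.eval σ) := by
  simp [ccB, BExp.Holds, NodeTree.CC, RExp.eval, h.X, h.Y, h.D, hq.x, hq.y, hq.g]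

/-- One step of descending a heavy path. -/
def liftBody : Prog :=
  nset 35 (.load 13 (.add (nv 30) (.mul (.sub (nv 15) (nv 33)) (.add eM (.lit 1))))) ;;
    when (ccB (nv 35)) (nset 30 (nv 35))

/-- The number `L + 1`. -/
def eL1 : NExp := .add (nv 15) (.lit 1)

/-- Descending a heavy path. -/
def liftProg : Prog := forTo 33 eL1 liftBody

section heavy

variable {sz hv : ℕ → ℕ} {x y g : ℝ}

theorem not_CC_last (hg : 0 < g) : ¬ T.CC x y g T.m := fun h => by
  have := h.2.2.2.2; rw [T.D_end] at this; linarith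

theorem Heavy.CC (hh : Heavy T sz hv) (hg : 0 < g) {w : ℕ} (hw : w ≤ T.m)
    (h : T.CC x y g (hv w)) : T.CC x y g w := by
  rcases hw.eq_or_lt with rfl | hw
  · rw [hh.last] at h; exact h
  rcases hh.child w hw with h' | h'
  · rw [h'] at h; exact absurd h (not_CC_last hg)
  · have := h.par h'.1; rwa [h'.2.2] at this

theorem Heavy.CC_iter (hh : Heavy T sz hv) (hg : 0 < g) {w : ℕ} (hw : w ≤ T.m) (k : ℕ)
    (h : T.CC x y g (hv^[k] w)) : T.CC x y g w := by
  induction k with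
  | zero => exact h
  | succ k ih =>
    rw [Function.iterate_succ_apply'] at h
    exact ih (hh.CC hg (hh.iter_le hw k) h)

/-- Sizes drop by at least one along a heavy path, so any number of steps from `T.m` on ends at the
dummy. -/
theorem Heavy.size_iter (hs : Sizes T sz) (hh : Heavy T sz hv) {w : ℕ} (hw : w < T.m) (k : ℕ) :
    hv^[k] w = T.m ∨ sz (hv^[k] w) + k ≤ sz w := by
  induction k with
  | zero => exact .inr le_rfl
  | succ k ih =>
    rw [Function.iterate_succ_apply']
    rcases ih with ih | ih
    · rw [ih, hh.last]; exact .inl rfl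
    · rcases (hh.iter_le hw.le k).eq_or_lt with h | h
      · rw [h, hh.last]; exact .inl rfl
      · rcases hh.child _ h with h' | h'
        · exact .inl h'
        · have := hs.child _ _ h'
          right; omega

end heavy

open Classical in
theorem liftBody_run {x y g : ℝ} {w : ℕ} (h : Inp T n sg σ) (hq : Qry x y g σ)
    (hw : σ.nat 13 (σ.nat 30 0 + (σ.nat 15 0 - σ.nat 33 0) * (T.m + 1)) = w) :
    Prog.run ω liftBody σ = if T.CC x y g w then (σ.setNat 35 0 w).setNat 30 0 w
      else σ.setNat 35 0 w := by
  simp only [liftBody, run_seq, run_when, run_nset]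
  rw [ccB_holds (x := x) (y := y) (g := g)
    (h.agrees rfl (State.agrees_setNat _ 35 _ _ liftBody rfl))
    (hq.agrees rfl (State.agrees_setNat _ 35 _ _ liftBody rfl))]
  simp only [NExp.eval, nv_eval, State.setNat_nat, if_true, Function.update_self, eM, h.m, hw]

/-- Binary search on the heavy path: strict containment of the square is inherited by ancestors, so
it holds on an initial piece of the path. The current node contains the square, and the node a power
of two further down does not; each round halves that power until it is 1. At the beginning, 2^(L+1)
steps lead off the path. -/
theorem liftProg_wp {L u : ℕ} {x y g : ℝ} {sz hv : ℕ → ℕ} (h : Inp T n sg σ) (hL : σ.nat 15 0 = L)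
    (hs : Sizes T sz) (hh : Heavy T sz hv) (hJ : Jump T L hv (σ.nat 13))
    (hpow : T.m < 2 ^ L) (hq : Qry x y g σ) (hg : 0 < g)
    (hu : σ.nat 30 0 = u) (hum : u < T.m) (hcu : T.CC x y g u) :
    WP ω liftProg ((L + 1 + 1) * (liftBody.wc + eL1.cost + 20)) σ fun τ =>
      ∃ j, τ.nat 30 0 = hv^[j] u ∧ T.CC x y g (hv^[j] u) ∧ ¬ T.CC x y g (hv (hv^[j] u)) := by
  have hI : ∀ τ, Agrees liftProg σ τ → Inp T n sg τ ∧ Qry x y g τ ∧ τ.nat 15 0 = L ∧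
      τ.nat 13 = σ.nat 13 := fun τ ha => ⟨h.agrees rfl ha, hq.agrees rfl ha, by
        rw [ha.nat 15 rfl, hL], ha.nat 13 rfl⟩
  refine (WP.forTo (I := fun k τ => ∃ j, τ.nat 30 0 = hv^[j] u ∧ T.CC x y g (hv^[j] u) ∧
    ¬ T.CC x y g (hv^[2 ^ (L + 1 - k)] (hv^[j] u))) (N := L + 1) rfl ?_ ?_ ?_).mono le_rfl ?_
  · intro τ ha; simp [eL1, NExp.eval, (hI τ ha).2.2.1]
  · refine ⟨0, by simpa using hu, hcu, ?_⟩
    rcases hh.size_iter hs hum (2 ^ (L + 1)) with h' | h'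
    · simp only [Nat.sub_zero, Function.iterate_zero, id]
      rw [h']; exact not_CC_last hg
    · have := hs.le u hum
      rw [pow_succ] at h'; omega
  · rintro k τ hk ha hkv ⟨j, hj, hc, hn⟩
    obtain ⟨hi, hq', hL', hJ'⟩ := hI τ ha
    refine WP.run rfl ?_
    have hjm := hh.iter_le hum.le j
    have hw : τ.nat 13 (τ.nat 30 0 + (L - k) * (T.m + 1)) = hv^[2 ^ (L - k)] (hv^[j] u) := by
      rw [hJ', hj]; exact hJ _ _ (by omega) hjm
    rw [← hL', ← hkv] at hw
    rw [liftBody_run hi hq' hw, hL', hkv]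
    split_ifs with hcc
    · refine ⟨2 ^ (L - k) + j, ?_, ?_, ?_⟩
      · simp [Function.iterate_add_apply]
      · rwa [Function.iterate_add_apply]
      · rwa [Function.iterate_add_apply, ← Function.iterate_add_apply _ (2 ^ _) (2 ^ _),
          show L + 1 - (k + 1) = L - k by omega, ← Nat.two_mul, ← pow_succ',
          show L - k + 1 = L + 1 - k by omega]
    · refine ⟨j, by simpa using hj, hc, ?_⟩
      rwa [show L + 1 - (k + 1) = L - k by omega]
  · rintro τ - ⟨j, h1, h2, h3⟩
    exact ⟨j, h1, h2, by simpa using h3⟩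

/-- Testing one child of the node in array 31. -/
def stepBody : Prog :=
  nset 35 (.load 10 (.add (.mul (.lit 4) (nv 31)) (nv 34))) ;;
    when (.and (.ltN (.lit 0) (nv 35)) (ccB (.sub (nv 35) (.lit 1))))
      (nset 30 (.sub (nv 35) (.lit 1)))

/-- Descending to a child of the node in array 31, if possible. -/
def stepProg : Prog := forTo 34 (.lit 4) stepBody

open Classical in
theorem stepBody_run {x y g : ℝ} {w : ℕ} (h : Inp T n sg σ) (hq : Qry x y g σ)
    (hw : σ.nat 10 (4 * σ.nat 31 0 + σ.nat 34 0) = w) :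
    Prog.run ω stepBody σ = if 0 < w ∧ T.CC x y g (w - 1) then
      (σ.setNat 35 0 w).setNat 30 0 (w - 1) else σ.setNat 35 0 w := by
  simp only [stepBody, run_seq, run_when, run_nset, BExp.Holds]
  rw [ccB_holds (x := x) (y := y) (g := g)
    (h.agrees rfl (State.agrees_setNat _ 35 _ _ stepBody rfl))
    (hq.agrees rfl (State.agrees_setNat _ 35 _ _ stepBody rfl))]
  simp only [NExp.eval, nv_eval, State.setNat_nat, if_true, Function.update_self, hw]

theorem stepProg_wp {u : ℕ} {x y g : ℝ} (h : Inp T n sg σ) (hct : ChildTab T (σ.nat 10))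
    (hq : Qry x y g σ) (hu : σ.nat 30 0 = u) (hu' : σ.nat 31 0 = u) :
    WP ω stepProg ((4 + 1) * (stepBody.wc + (NExp.lit 4).cost + 20)) σ fun τ =>
      (τ.nat 30 0 = u ∧ T.Stuck x y g u) ∨ (T.IsChild (τ.nat 30 0) u ∧ T.CC x y g (τ.nat 30 0)) := by
  have hI : ∀ τ, Agrees stepProg σ τ → Inp T n sg τ ∧ Qry x y g τ ∧ τ.nat 10 = σ.nat 10 ∧
      τ.nat 31 0 = u := fun τ ha => ⟨h.agrees rfl ha, hq.agrees rfl ha, ha.nat 10 rfl,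
        by rw [ha.nat 31 rfl, hu']⟩
  refine (WP.forTo (I := fun k τ =>
    (τ.nat 30 0 = u ∧ ∀ c, T.IsChild c u → T.qd c < k → ¬ T.CC x y g c) ∨
    (T.IsChild (τ.nat 30 0) u ∧ T.CC x y g (τ.nat 30 0))) (N := 4) rfl ?_ ?_ ?_).mono le_rfl ?_
  · intro τ ha; rfl
  · left; exact ⟨by simpa using hu, fun _ _ h => absurd h (Nat.not_lt_zero _)⟩
  · intro k τ hk ha hkv hinv
    obtain ⟨hi, hq', hct', h31⟩ := hI τ ha
    refine WP.run rfl ?_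
    rw [stepBody_run hi hq' rfl, h31, hkv, hct']
    have hd : (4 * u + k) / 4 = u := by omega
    have hm : (4 * u + k) % 4 = k := by omega
    split_ifs with hcc
    · right
      rcases hct.sound (4 * u + k) with h0 | ⟨c, h1, h2, h3⟩
      · omega
      rw [h1, Nat.add_sub_cancel] at hcc
      rw [hd] at h2
      simp [h1, h2, hcc.2]
    · rcases hinv with ⟨h1, h2⟩ | hinv
      · left
        refine ⟨by simpa using h1, fun c hc hck => ?_⟩
        rcases Nat.lt_succ_iff_lt_or_eq.1 hck with hck | hck
        · exact h2 c hc hck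
        · have := hct.complete c hc.1 hc.2.1
          rw [hc.2.2, hck] at this
          rw [this] at hcc
          simpa using hcc
      · right; simpa using hinv
  · rintro τ - (⟨h1, h2⟩ | h1)
    · exact .inl ⟨h1, fun c hc => h2 c hc (T.qd_lt c)⟩
    · exact .inr h1

/-- One round of the search: descend along a heavy path and then to a light child. -/
def roundProg : Prog := liftProg ;; nset 31 (nv 30) ;; stepProg

/-- The running time of a round. -/
def roundCost (L : ℕ) : ℕ := (L + 1 + 1) * (liftBody.wc + eL1.cost + 20) +
  ((nset 31 (nv 30)).wc + (4 + 1) * (stepBody.wc + (NExp.lit 4).cost + 20))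

/-- The search. -/
def searchProg : Prog := nset 30 eRoot ;; forTo 32 eL1 roundProg

/-- The running time of the search. -/
def searchCost (L : ℕ) : ℕ := (nset 30 eRoot).wc + (L + 1 + 1) * (roundCost L + eL1.cost + 20)

/-- Unless the search is finished, a round ends at a child other than the heavy one. The sizes of
the two siblings add up to less than that of the parent and the heavy child is the larger, so the
size at least halves. After `L + 1` rounds a positive size would contradict `T.m < 2 ^ L`. -/
theorem searchProg_wp {L : ℕ} {x y g : ℝ} (h : Inp T n sg σ) (ht : TreeTab T L σ)
    (hpow : T.m < 2 ^ L) (hq : Qry x y g σ) (hg : 0 < g) (hr : T.CC x y g T.root) :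
    WP ω searchProg (searchCost L) σ fun τ => τ.nat 30 0 < T.m ∧ T.CC x y g (τ.nat 30 0) ∧
      T.Stuck x y g (τ.nat 30 0) := by
  obtain ⟨sz, hv, hs, hh, hJ⟩ := ht.jump
  refine WP.comp (R := fun τ => τ.nat 30 0 = T.root) (WP.run rfl ?_) ?_
  · simp [eRoot, NExp.eval, h.root]
  intro σ₁ ha₁ hr₁
  have h₁ := h.agrees rfl ha₁
  have ht₁ := ht.agrees rfl ha₁
  have hq₁ := hq.agrees rfl ha₁
  have hJ₁ : σ₁.nat 13 = σ.nat 13 := ha₁.nat 13 rfl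
  refine (WP.forTo (I := fun r τ => τ.nat 30 0 < T.m ∧ T.CC x y g (τ.nat 30 0) ∧
    (T.Stuck x y g (τ.nat 30 0) ∨ sz (τ.nat 30 0) * 2 ^ r ≤ T.m)) (N := L + 1) rfl ?_ ?_ ?_).mono
    le_rfl ?_
  · intro τ ha; simp [eL1, NExp.eval, (ht₁.agrees rfl ha).L]
  · simp [hr₁, hr, T.root_lt, hs.le _ T.root_lt]
  · rintro r τ hrL ha hrv ⟨hu, hcu, hst⟩
    have hi := h₁.agrees rfl ha
    have ht' := ht₁.agrees rfl ha
    have hq' := hq₁.agrees rfl ha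
    have hJ' : τ.nat 13 = σ.nat 13 := (ha.nat 13 rfl).trans hJ₁
    generalize hud : τ.nat 30 0 = u at *
    refine WP.comp (liftProg_wp hi ht'.L hs hh (hJ' ▸ hJ) hpow hq' hg hud hu hcu) ?_
    rintro τ₁ ha₁ ⟨j, hj, hc, hn⟩
    have hi1 := hi.agrees rfl ha₁
    refine WP.comp (R := fun τ => τ.nat 30 0 = hv^[j] u ∧ τ.nat 31 0 = hv^[j] u) (WP.run rfl ?_) ?_
    · simp [hj]
    rintro τ₂ ha₂ ⟨h30, h31⟩
    refine (stepProg_wp (hi1.agrees rfl ha₂) ((ht'.agrees rfl ha₁).agrees rfl ha₂).child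
      ((hq'.agrees rfl ha₁).agrees rfl ha₂) h30 h31).mono le_rfl ?_
    intro τ₃ _ hfin
    simp only [State.setNat_nat, Nat.reduceEqDiff, if_false]
    have hm1 : hv^[j] u < T.m := lt_of_le_of_ne (hh.iter_le hu.le j) (by
      intro heq; rw [heq] at hc; exact not_CC_last hg hc)
    rcases hfin with ⟨e1, e2⟩ | ⟨e1, e2⟩
    · rw [e1]; exact ⟨hm1, hc, .inl e2⟩
    · refine ⟨e1.1, e2, ?_⟩
      -- At a node that is already stuck no child contains the square, so the search cannot have
      -- moved on.
      rcases hst with hst | hst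
      · exfalso
        rcases j with _ | j
        · exact hst _ e1 e2
        · rw [Function.iterate_succ_apply] at hc
          have hc' := hh.CC_iter hg (hh.le hu.le) j hc
          rcases hh.child u hu with h' | h'
          · rw [h'] at hc'; exact not_CC_last hg hc'
          · exact hst _ h' hc'
      · right
        have hne : τ₃.nat 30 0 ≠ hv (hv^[j] u) := fun he => hn (he ▸ e2)
        have hmax := hh.max _ _ e1
        -- The dummy has size 0, so by maximality it is the heavy child of leaves only, whereas here
        -- a child exists.
        have hchild : T.IsChild (hv (hv^[j] u)) (hv^[j] u) := by
          rcases hh.child _ hm1 with h' | h'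
          · rw [h', hs.last] at hmax
            have := hs.pos _ e1.1
            omega
          · exact h'
        have hp := hs.pair _ _ _ e1 hchild hne
        have hsz : sz (hv^[j] u) ≤ sz u := by
          rcases hh.size_iter hs hu j with h' | h' <;> omega
        rw [pow_succ, ← mul_assoc]
        calc sz (τ₃.nat 30 0) * 2 ^ r * 2 = (2 * sz (τ₃.nat 30 0)) * 2 ^ r := by ring
          _ ≤ sz u * 2 ^ r := Nat.mul_le_mul_right _ (by omega)
          _ ≤ _ := hst
  · rintro τ - ⟨a, b, c | c⟩
    · exact ⟨a, b, c⟩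
    · exfalso
      have := hs.pos _ a
      have : 1 * 2 ^ (L + 1) ≤ sz (τ.nat 30 0) * 2 ^ (L + 1) := Nat.mul_le_mul_right _ this
      rw [pow_succ] at *
      omega

end Congestion

-- Assigning segments to cells: sums of short lengths and lists of long segments.

namespace Congestion

open RealRAM
variable {T : NodeTree} {n : ℕ} {sg : ℕ → Segment} {σ τ : State} {ω : ℕ → Bool}

/-! ## Testing whether a segment meets a cell -/

/-- The maximum of two real expressions. -/
def maxE (x y : RExp) : RExp :=
  .div (.add (.add x y) (.sqrt (.mul (.sub x y) (.sub x y)))) (.lit 2)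
/-- The minimum of two real expressions. -/
def minE (x y : RExp) : RExp :=
  .div (.sub (.add x y) (.sqrt (.mul (.sub x y) (.sub x y)))) (.lit 2)

@[simp] theorem maxE_eval (σ : State) (x y : RExp) :
    (maxE x y).eval σ = max (x.eval σ) (y.eval σ) := by
  simp only [maxE, RExp.eval, Real.sqrt_mul_self_eq_abs]
  rcases le_total (x.eval σ) (y.eval σ) with h | h
  · rw [max_eq_right h, abs_of_nonpos (by linarith)]; push_cast; ring
  · rw [max_eq_left h, abs_of_nonneg (by linarith)]; push_cast; ring

@[simp] theorem minE_eval (σ : State) (x y : RExp) :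
    (minE x y).eval σ = min (x.eval σ) (y.eval σ) := by
  simp only [minE, RExp.eval, Real.sqrt_mul_self_eq_abs]
  rcases le_total (x.eval σ) (y.eval σ) with h | h
  · rw [min_eq_left h, abs_of_nonpos (by linarith)]; push_cast; ring
  · rw [min_eq_right h, abs_of_nonneg (by linarith)]; push_cast; ring

/-- The segment number stored in array 41. -/
def eS : NExp := nv 41
/-- The node stored in array 36. -/
def eV : NExp := nv 36

/-- The parameter at which the segment enters the slab of the cell in one coordinate. -/
def slabE (p q l : ℕ) : RExp :=
  minE (.div (.sub (.load l eV) (.load p eS)) (.sub (.load q eS) (.load p eS)))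
    (.div (.sub (.add (.load l eV) (.load 6 eV)) (.load p eS)) (.sub (.load q eS) (.load p eS)))

/-- The coordinate of the point with the parameter in array 24. -/
def coordE (p q : ℕ) : RExp := .add (.load p eS) (.mul (rv 24) (.sub (.load q eS) (.load p eS)))

/-- The test whether a coordinate of the point with the parameter in array 24 is in the slab. -/
def slabB (p q l : ℕ) : BExp :=
  .and (leR (.load l eV) (coordE p q)) (leR (coordE p q) (.add (.load l eV) (.load 6 eV)))

/-- Test whether the segment in array 41 meets the closed cell of the node in array 36; the answer
is written to array 37. -/
def meetsProg : Prog :=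
  rset 24 (maxE (.lit 0) (maxE (slabE 0 2 4) (slabE 1 3 5))) ;;
    .ite (.and (leR (rv 24) (.lit 1)) (.and (slabB 0 2 4) (slabB 1 3 5)))
      (nset 37 (.lit 1)) (nset 37 (.lit 0))

/-- The segment number `s` meets the closed cell of the node `v`. -/
def Hits (T : NodeTree) (sg : ℕ → Segment) (s v : ℕ) : Prop :=
  (sg s).Meets (T.X v) (T.Y v) (T.D v)

open Classical in
theorem meetsProg_run (h : Inp T n sg σ) : ∃ t, Prog.run ω meetsProg σ =
    (σ.setReal 24 0 t).setNat 37 0 (if Hits T sg (σ.nat 41 0) (σ.nat 36 0) then 1 else 0) := by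
  refine ⟨(sg (σ.nat 41 0)).enter (T.X (σ.nat 36 0)) (T.Y (σ.nat 36 0)) (T.D (σ.nat 36 0)), ?_⟩
  have hb := (sg (σ.nat 41 0)).meets_iff (T.X (σ.nat 36 0)) (T.Y (σ.nat 36 0)) (T.D (σ.nat 36 0))
  have he : (maxE (.lit 0) (maxE (slabE 0 2 4) (slabE 1 3 5))).eval σ =
      (sg (σ.nat 41 0)).enter (T.X (σ.nat 36 0)) (T.Y (σ.nat 36 0)) (T.D (σ.nat 36 0)) := by
    simp [slabE, Segment.enter, RExp.eval, eS, eV, h.X, h.Y, h.D, h.px, h.py, h.qx, h.qy]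
  simp only [meetsProg, run_seq, run_rset, he, run_ite, run_nset]
  generalize (sg (σ.nat 41 0)).enter (T.X (σ.nat 36 0)) (T.Y (σ.nat 36 0)) (T.D (σ.nat 36 0)) = t
    at *
  have hiff : BExp.Holds (σ.setReal 24 0 t) (.and (leR (rv 24) (.lit 1))
      (.and (slabB 0 2 4) (slabB 1 3 5))) ↔ Hits T sg (σ.nat 41 0) (σ.nat 36 0) := by
    rw [Hits, hb]
    simp [BExp.Holds, slabB, coordE, RExp.eval, eS, eV, h.X, h.Y, h.D, h.px, h.py, h.qx, h.qy,
      and_assoc]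
  simp only [hiff]
  split_ifs <;> simp [NExp.eval]

/-! ## Grid squares around a segment -/

/-- The side length of the grid squares used for the segment `s`: the smallest power of two that is
larger than the length of `s`. -/
noncomputable def gside (s : Segment) : ℝ := 2 * (2 : ℝ) ^ Int.log 2 s.len

/-- The coordinate of the lower left corner of a grid square near the segment. -/
noncomputable def gcoord (s : Segment) (k : Fin 2) (a : ℕ) : ℝ :=
  (-(⌊-(min (s.p k) (s.q k) / gside s)⌋ : ℝ) - 1 + a) * gside s

theorem gside_eq (s : Segment) : gside s = (2 : ℝ) ^ (Int.log 2 s.len + 1) := by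
  rw [gside, zpow_add₀ (by norm_num), zpow_one, mul_comm]

theorem gside_pos (s : Segment) : 0 < gside s := by rw [gside_eq]; positivity

theorem len_lt_gside (s : Segment) : s.len < gside s := by
  rw [gside_eq]
  have := Int.lt_zpow_succ_log_self (b := 2) (by norm_num) s.len
  exact_mod_cast this

theorem gside_le {s : Segment} (h : 0 < s.len) : gside s ≤ 2 * s.len := by
  have := Int.zpow_log_le_self (b := 2) (by norm_num) h
  rw [gside]
  have h' : (2 : ℝ) ^ Int.log 2 s.len ≤ s.len := by exact_mod_cast this
  linarith

/-- A node is at most as large as the grid squares of a segment if and only if the segment is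
long relative to it. -/
theorem long_iff {s : Segment} (hs : 0 < s.len) {v : ℕ} (hv : v < T.m) :
    T.D v / 2 ≤ s.len ↔ T.D v ≤ gside s := by
  constructor
  · intro h
    rcases NodeTree.D_le_or (z := Int.log 2 s.len + 1) hv with h' | h' <;> rw [← gside_eq] at h'
    · exact h'
    · have := len_lt_gside s; linarith
  · intro h
    have := gside_le hs
    linarith

theorem gcoord_isGrid (s : Segment) (a b : ℕ) :
    IsGrid (gcoord s 0 a) (gcoord s 1 b) (gside s) :=
  ⟨_, -⌊-(min (s.p 0) (s.q 0) / gside s)⌋ - 1 + a, -⌊-(min (s.p 1) (s.q 1) / gside s)⌋ - 1 + b,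
    gside_eq s, by rw [gcoord]; push_cast; ring, by rw [gcoord]; push_cast; ring⟩

theorem gcoord_inj {s : Segment} {k : Fin 2} {a a' : ℕ} {x : ℝ} (h1 : gcoord s k a ≤ x)
    (h2 : x < gcoord s k a + gside s) (h3 : gcoord s k a' ≤ x)
    (h4 : x < gcoord s k a' + gside s) : a = a' := by
  have hg := gside_pos s
  unfold gcoord at *
  set w : ℝ := -(⌊-(min (s.p k) (s.q k) / gside s)⌋ : ℝ) - 1
  have e1 : (w + a) * gside s < (w + a' + 1) * gside s := by linarith
  have e2 : (w + a') * gside s < (w + a + 1) * gside s := by linarith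
  rw [mul_lt_mul_iff_left₀ hg] at e1 e2
  have f1 : (a : ℝ) < a' + 1 := by linarith
  have f2 : (a' : ℝ) < a + 1 := by linarith
  have f1' : a < a' + 1 := by exact_mod_cast f1
  have f2' : a' < a + 1 := by exact_mod_cast f2
  omega

/-- With q the minimal coordinate divided by the grid width, a closed grid interval met by the
projection has q - 1 ≤ c < q + 1, since the projection is shorter than the width. In terms of the
ceiling of q exactly two integers remain; the floor of q would leave three cases, as q may itself be
an integer. -/
theorem exists_gcoord {s : Segment} {k : Fin 2} {c : ℤ} {t : ℝ} (h0 : 0 ≤ t) (h1 : t ≤ 1)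
    (hx : c * gside s ≤ s.p k + t * (s.q k - s.p k))
    (hx' : s.p k + t * (s.q k - s.p k) ≤ c * gside s + gside s) :
    ∃ a < 2, gcoord s k a = c * gside s := by
  have hg := gside_pos s
  have hl := len_lt_gside s
  have hd := abs_le.1 (s.abs_coord_le_len k)
  set mn := min (s.p k) (s.q k) with hmn
  have hlow : mn ≤ s.p k + t * (s.q k - s.p k) := by
    rcases le_total (s.p k) (s.q k) with h | h
    · have := min_le_left (s.p k) (s.q k)
      nlinarith
    · have := min_le_right (s.p k) (s.q k)
      nlinarith
  have hhigh : s.p k + t * (s.q k - s.p k) < mn + gside s := by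
    rcases le_total (s.p k) (s.q k) with h | h
    · rw [hmn, min_eq_left h]; nlinarith
    · rw [hmn, min_eq_right h]; nlinarith
  have e1 : (c : ℝ) < mn / gside s + 1 := by
    rw [← mul_lt_mul_iff_left₀ hg, add_mul, div_mul_cancel₀ _ hg.ne']; linarith
  have e2 : mn / gside s ≤ c + 1 := by
    rw [div_le_iff₀ hg]; linarith
  set f := ⌊-(mn / gside s)⌋ with hf
  have g1 : (f : ℝ) ≤ -(mn / gside s) := Int.floor_le _
  have g3 : -(c + 1) ≤ f := by rw [hf, Int.le_floor]; push_cast; linarith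
  have g4 : c < -f + 1 := by
    have : (c : ℝ) < ((-f + 1 : ℤ) : ℝ) := by push_cast; linarith
    exact_mod_cast this
  have g5 : (c : ℝ) = -f - 1 ∨ (c : ℝ) = -f := by
    rcases (by omega : c = -f - 1 ∨ c = -f) with h | h
    · left; rw [h]; push_cast; ring
    · right; rw [h]; push_cast; ring
  rcases g5 with h | h
  · exact ⟨0, by norm_num, by rw [gcoord, ← hmn, ← hf, h]; push_cast; ring⟩
  · exact ⟨1, by norm_num, by rw [gcoord, ← hmn, ← hf, h]; push_cast; ring⟩

/-- The lower left corner of the grid square with number `e % 4` of the segment `e / 4`. -/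
noncomputable def qx (sg : ℕ → Segment) (e : ℕ) : ℝ := gcoord (sg (e / 4)) 0 (e % 2)
/-- The lower left corner of the grid square with number `e % 4` of the segment `e / 4`. -/
noncomputable def qy (sg : ℕ → Segment) (e : ℕ) : ℝ := gcoord (sg (e / 4)) 1 (e / 2 % 2)

theorem exists_square {s : ℕ} {c r : ℤ}
    (h : (sg s).Meets (c * gside (sg s)) (r * gside (sg s)) (gside (sg s))) :
    ∃ e, e / 4 = s ∧ qx sg e = c * gside (sg s) ∧ qy sg e = r * gside (sg s) := by
  obtain ⟨t, h0, h1, x1, x2, y1, y2⟩ := h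
  obtain ⟨a, ha, hxa⟩ := exists_gcoord h0 h1 x1 x2
  obtain ⟨b, hb, hyb⟩ := exists_gcoord h0 h1 y1 y2
  refine ⟨4 * s + 2 * b + a, by omega, ?_, ?_⟩
  · rw [qx, show (4 * s + 2 * b + a) / 4 = s by omega, show (4 * s + 2 * b + a) % 2 = a by omega, hxa]
  · rw [qy, show (4 * s + 2 * b + a) / 4 = s by omega,
      show (4 * s + 2 * b + a) / 2 % 2 = b by omega, hyb]

theorem isGrid_q (sg : ℕ → Segment) (e : ℕ) : IsGrid (qx sg e) (qy sg e) (gside (sg (e / 4))) :=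
  gcoord_isGrid _ _ _

/-- Two children of a node lying in the same smaller grid square are equal. -/
theorem children_inside_eq {x y g : ℝ} (hq : IsGrid x y g) {p v w : ℕ} (hp : p < T.m)
    (hgp : g < T.D p) (hv : T.IsChild v p) (hw : T.IsChild w p) (hvi : T.Inside x y g v)
    (hwi : T.Inside x y g w) : v = w := by
  obtain ⟨z, c, r, rfl, rfl, rfl⟩ := hq
  have hg : (0 : ℝ) < 2 ^ z := by positivity
  obtain ⟨c', r', h1, h2⟩ := T.grid p hp
  -- The half side of `p` is a multiple of the grid width, so the grid square does not cross the
  -- lines between the quadrants of `p`.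
  have hhalf : ∃ b : ℤ, T.D p / 2 = b * (2 : ℝ) ^ z := by
    have : (2 : ℝ) ^ (z + 1) ≤ T.D p := by
      rcases NodeTree.D_le_or (z := z) hp with h | h
      · linarith
      · rwa [zpow_add₀ (by norm_num), zpow_one, mul_comm]
    rcases this.eq_or_lt with h | h
    · exact ⟨1, by rw [← h, zpow_add₀ (by norm_num), zpow_one]; push_cast; ring⟩
    · obtain ⟨b, -, hb⟩ := NodeTree.exists_mult hp h
      exact ⟨b, by rw [hb, zpow_add₀ (by norm_num), zpow_one]; ring⟩
  obtain ⟨b, hb⟩ := hhalf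
  have key : ∀ (a i : ℤ) (P xv xw Dv Dw : ℝ), P = a * T.D p → i * (2 : ℝ) ^ z ≤ xv → 0 < Dv →
      0 < Dw → xv + Dv ≤ i * (2 : ℝ) ^ z + 2 ^ z → i * (2 : ℝ) ^ z ≤ xw →
      xw + Dw ≤ i * (2 : ℝ) ^ z + 2 ^ z → (P + T.D p / 2 ≤ xv ↔ P + T.D p / 2 ≤ xw) := by
    intro a i P xv xw Dv Dw hP k1 kv kw k2 k3 k4
    have e : P + T.D p / 2 = ((2 * a * b + b : ℤ) : ℝ) * (2 : ℝ) ^ z := by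
      rw [hP, show T.D p = 2 * (T.D p / 2) by ring, hb]; push_cast; ring
    rw [e]
    rcases le_or_gt (2 * a * b + b) i with h | h
    · have : ((2 * a * b + b : ℤ) : ℝ) ≤ i := by exact_mod_cast h
      have := mul_le_mul_of_nonneg_right this hg.le
      exact ⟨fun _ => by linarith, fun _ => by linarith⟩
    · have : ((i + 1 : ℤ) : ℝ) ≤ (2 * a * b + b : ℤ) := by exact_mod_cast h
      have := mul_le_mul_of_nonneg_right this hg.le
      push_cast at this ⊢
      exact ⟨fun _ => by linarith, fun _ => by linarith⟩
  obtain ⟨v1, v2, v3, v4⟩ := hvi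
  obtain ⟨w1, w2, w3, w4⟩ := hwi
  have hDv := NodeTree.D_pos hv.1
  have hDw := NodeTree.D_pos hw.1
  refine T.sib v w hv.1 hw.1 hv.2.1 hw.2.1 (hv.2.2.trans hw.2.2.symm) ?_ ?_ <;> rw [hv.2.2]
  · exact key c' c _ _ _ _ _ h1 v1 hDv hDw v2 w1 w2
  · exact key r' r _ _ _ _ _ h2 v3 hDv hDw v4 w3 w4

/-! ## Entries -/

/-- The node `v` is the entry for the grid square number `e`: it is the root and the segment is
long relative to the root, or it is a maximal node inside the grid square whose parent is larger
than the grid square. -/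
def RegEnt (T : NodeTree) (sg : ℕ → Segment) (e v : ℕ) : Prop :=
  v < T.m ∧ 0 < (sg (e / 4)).len ∧
    -- The condition `e % 4 = 0` singles out one of the four squares, so that a segment is
    -- registered at the root only once.
    ((v = T.root ∧ T.D T.root / 2 ≤ (sg (e / 4)).len ∧ e % 4 = 0) ∨
     (v ≠ T.root ∧ gside (sg (e / 4)) < T.D (T.par v) ∧
      T.Inside (qx sg e) (qy sg e) (gside (sg (e / 4))) v))

theorem RegEnt.long {e v : ℕ} (h : RegEnt T sg e v) : T.D v / 2 ≤ (sg (e / 4)).len := by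
  obtain ⟨hv, hl, ⟨rfl, h, -⟩ | ⟨-, -, h⟩⟩ := h
  · exact h
  · rw [long_iff hl hv]
    linarith [h.1, h.2.1]

theorem RegEnt.short_par {e v : ℕ} (h : RegEnt T sg e v) (hr : v ≠ T.root) :
    (sg (e / 4)).len < T.D (T.par v) / 2 := by
  obtain ⟨hv, hl, ⟨rfl, h, -⟩ | ⟨-, h, -⟩⟩ := h
  · exact absurd rfl hr
  · by_contra! hcon
    rw [long_iff hl (T.par_lt v hv)] at hcon
    linarith

/-- The grid square through which a node is entered is unique. -/
theorem RegEnt.inj {e e' v : ℕ} (h : RegEnt T sg e v) (h' : RegEnt T sg e' v)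
    (hs : e / 4 = e' / 4) : e = e' := by
  obtain ⟨hv, hl, ⟨rfl, -, h1⟩ | ⟨hr, -, h1⟩⟩ := h <;>
    obtain ⟨-, -, ⟨h0, -, h2⟩ | ⟨hr', -, h2⟩⟩ := h'
  · omega
  · exact absurd rfl hr'
  · exact absurd h0 hr
  · have hD := NodeTree.D_pos hv
    obtain ⟨a1, a2, a3, a4⟩ := h1
    obtain ⟨b1, b2, b3, b4⟩ := h2
    unfold qx qy at *
    rw [← hs] at b1 b2 b3 b4
    have hx := gcoord_inj a1 (by linarith) b1 (by linarith)
    have hy := gcoord_inj a3 (by linarith) b3 (by linarith)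
    omega

/-- A segment that is long relative to `v` but not to its parent enters `v`. -/
theorem exists_regEnt {s v : ℕ} (hv : v < T.m) (hl : 0 < (sg s).len) (hlong : T.D v / 2 ≤ (sg s).len)
    (hpar : v ≠ T.root → (sg s).len < T.D (T.par v) / 2) (hm : Hits T sg s v) :
    ∃ e, e / 4 = s ∧ RegEnt T sg e v := by
  by_cases hr : v = T.root
  · refine ⟨4 * s, by omega, hv, ?_, .inl ⟨hr, ?_, by omega⟩⟩ <;>
      rw [show 4 * s / 4 = s by omega]
    · exact hl
    · rwa [← hr]
  · have hDle := (long_iff hl hv).1 hlong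
    rw [gside_eq] at hDle
    obtain ⟨c, r, hin⟩ := NodeTree.exists_grid_containing hv hDle
    rw [← gside_eq] at hin
    obtain ⟨e, he, hx, hy⟩ := exists_square
      (Segment.Meets.mono hm hin.1 hin.2.1 hin.2.2.1 hin.2.2.2)
    refine ⟨e, he, hv, by rwa [he], .inr ⟨hr, ?_, ?_⟩⟩ <;> rw [he]
    · by_contra! hcon
      rw [← long_iff hl (T.par_lt v hv)] at hcon
      exact absurd (hpar hr) (not_lt.2 hcon)
    · rwa [hx, hy]

/-- The test whether the cell of `w` is inside the stored square. -/
def insideB (w : NExp) : BExp :=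
  .and (leR (rv 20) (.load 4 w)) (.and (leR (.add (.load 4 w) (.load 6 w)) (.add (rv 20) (rv 22)))
    (.and (leR (rv 21) (.load 5 w)) (leR (.add (.load 5 w) (.load 6 w)) (.add (rv 21) (rv 22)))))

theorem insideB_holds {x y g : ℝ} (h : Inp T n sg σ) (hq : Qry x y g σ) (w : NExp) :
    (insideB w).Holds σ ↔ T.Inside x y g (w.eval σ) := by
  simp [insideB, BExp.Holds, NodeTree.Inside, RExp.eval, h.X, h.Y, h.D, hq.x, hq.y, hq.g]

/-- Testing whether one child of the node in array 30 is the entry for the number in array 40. -/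
def entBody : Prog :=
  nset 35 (.load 10 (.add (.mul (.lit 4) (nv 30)) (nv 34))) ;;
    when (.and (.ltN (.lit 0) (nv 35)) (insideB (.sub (nv 35) (.lit 1))))
      (.storeN 14 (nv 40) (nv 35))

/-- Finding the child of the node in array 30 that is the entry for the number in array 40. -/
def entProg : Prog := forTo 34 (.lit 4) entBody

open Classical in
theorem entBody_run {x y g : ℝ} {w : ℕ} (h : Inp T n sg σ) (hq : Qry x y g σ)
    (hw : σ.nat 10 (4 * σ.nat 30 0 + σ.nat 34 0) = w) :
    Prog.run ω entBody σ = if 0 < w ∧ T.Inside x y g (w - 1) then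
      (σ.setNat 35 0 w).setNat 14 (σ.nat 40 0) w else σ.setNat 35 0 w := by
  simp only [entBody, run_seq, run_when, run_nset, BExp.Holds]
  have hb : ∀ k w, (insideB w).Holds (σ.setNat 35 0 k) ↔ _ := fun k w => insideB_holds
    (h.agrees rfl (State.agrees_setNat _ 35 _ _ entBody rfl))
    (hq.agrees rfl (State.agrees_setNat _ 35 _ _ entBody rfl)) w
  simp only [hb]
  simp only [NExp.eval, nv_eval, State.setNat_nat, if_true, Function.update_self, hw, run_storeN]
  split_ifs <;> simp_all

theorem entProg_wp {e u : ℕ} {x y g : ℝ} (h : Inp T n sg σ) (hct : ChildTab T (σ.nat 10))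
    (hq : Qry x y g σ) (hu : σ.nat 30 0 = u) (he : σ.nat 40 0 = e) (h0 : σ.nat 14 e = 0)
    (huniq : ∀ v w, T.IsChild v u → T.IsChild w u → T.Inside x y g v → T.Inside x y g w → v = w) :
    WP ω entProg ((4 + 1) * (entBody.wc + (NExp.lit 4).cost + 20)) σ fun τ =>
      (∀ e', e' ≠ e → τ.nat 14 e' = σ.nat 14 e') ∧
      ∀ v, τ.nat 14 e = v + 1 ↔ T.IsChild v u ∧ T.Inside x y g v := by
  have hI : ∀ τ, Agrees entProg σ τ → Inp T n sg τ ∧ Qry x y g τ ∧ τ.nat 10 = σ.nat 10 ∧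
      τ.nat 30 0 = u ∧ τ.nat 40 0 = e := fun τ ha => ⟨h.agrees rfl ha, hq.agrees rfl ha,
        ha.nat 10 rfl, by rw [ha.nat 30 rfl, hu], by rw [ha.nat 40 rfl, he]⟩
  refine (WP.forTo (I := fun k τ => (∀ e', e' ≠ e → τ.nat 14 e' = σ.nat 14 e') ∧
    ∀ v, τ.nat 14 e = v + 1 ↔ T.IsChild v u ∧ T.Inside x y g v ∧ T.qd v < k)
    (N := 4) rfl ?_ ?_ ?_).mono le_rfl ?_
  · intro τ ha; rfl
  · simp [h0]
  · rintro k τ hk ha hkv ⟨h1, h2⟩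
    obtain ⟨hi, hq', hct', h30, h40⟩ := hI τ ha
    refine WP.run rfl ?_
    rw [entBody_run hi hq' rfl, h30, hkv, hct', h40]
    have hd : (4 * u + k) / 4 = u := by omega
    have hm : (4 * u + k) % 4 = k := by omega
    split_ifs with hcc
    · rcases hct.sound (4 * u + k) with h0 | ⟨c, c1, c2, c3⟩
      · omega
      rw [hd] at c2
      rw [c1, Nat.add_sub_cancel] at hcc
      rw [c1]
      simp only [State.setNat_nat, Nat.reduceEqDiff, if_true, if_false, Function.update_self]
      refine ⟨fun e' he' => by rw [Function.update_of_ne he']; exact h1 e' he', fun v => ?_⟩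
      constructor
      · intro hv
        obtain rfl : c = v := by omega
        exact ⟨c2, hcc.2, by omega⟩
      · rintro ⟨v1, v2, -⟩
        rw [huniq _ _ v1 c2 v2 hcc.2]
    · simp only [State.setNat_nat, Nat.reduceEqDiff, if_false]
      refine ⟨h1, fun v => ?_⟩
      rw [h2 v]
      constructor
      · rintro ⟨v1, v2, v3⟩; exact ⟨v1, v2, by omega⟩
      · rintro ⟨v1, v2, v3⟩
        refine ⟨v1, v2, ?_⟩
        rcases Nat.lt_succ_iff_lt_or_eq.1 v3 with h | h
        · exact h
        · have := hct.complete v v1.1 v1.2.1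
          rw [v1.2.2, h] at this
          rw [this] at hcc
          exact absurd ⟨Nat.succ_pos v, by simpa using v2⟩ hcc
  · rintro τ - ⟨h1, h2⟩
    refine ⟨h1, fun v => (h2 v).trans ?_⟩
    simp [T.qd_lt v]

end Congestion

namespace RealRAM
theorem WP.when {ω : ℕ → Bool} {b : BExp} {P : Prog} {T : ℕ} {σ : State} {R : State → Prop}
    (h : b.Holds σ → WP ω P T σ R) (h' : ¬ b.Holds σ → R σ) :
    WP ω (when b P) (b.cost + (T + 1)) σ R :=
  WP.ite h fun hb => ⟨1, le_rfl, σ, .skip σ, h' hb⟩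
end RealRAM

namespace Congestion

open RealRAM
variable {T : NodeTree} {n : ℕ} {sg : ℕ → Segment} {σ τ : State} {ω : ℕ → Bool}

/-! ## Accumulating the lengths of short segments -/

/-- The array `A` contains at `w` the total length of the segments in `F w`, which are short
segments hitting the cell of `w`; the array `st` contains the last segment added plus one. -/
structure ShortInv (T : NodeTree) (sg : ℕ → Segment) (cur : ℕ) (F : ℕ → Finset ℕ) (st : ℕ → ℕ)
    (A : ℕ → ℝ) : Prop where
  sum : ∀ w, w < T.m → A w = ∑ s ∈ F w, (sg s).len
  le : ∀ w s, w < T.m → s ∈ F w → s ≤ cur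
  valid : ∀ w s, w < T.m → s ∈ F w → (sg s).len < T.D w / 2 ∧ Hits T sg s w
  stamp : ∀ w s, w < T.m → st w = s + 1 → s ∈ F w
  le_stamp : ∀ w s, w < T.m → s ∈ F w → s + 1 ≤ st w

theorem ShortInv.mono {cur cur' : ℕ} {F : ℕ → Finset ℕ} {st : ℕ → ℕ} {A : ℕ → ℝ}
    (h : ShortInv T sg cur F st A) (hc : cur ≤ cur') : ShortInv T sg cur' F st A :=
  ⟨h.sum, fun w s hw hs => (h.le w s hw hs).trans hc, h.valid, h.stamp, h.le_stamp⟩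

/-- One stamp per node prevents double counting among the squares of a segment, because segments are
processed in increasing order: if `cur` were already in `F v`, the stamp would be at least `cur +
1`, and it belongs to a member of `F v`, none of which exceeds `cur`. -/
theorem ShortInv.insert {cur v : ℕ} {F : ℕ → Finset ℕ} {st : ℕ → ℕ} {A : ℕ → ℝ}
    (h : ShortInv T sg cur F st A) (hv : v < T.m) (hst : st v ≠ cur + 1)
    (hl : (sg cur).len < T.D v / 2) (hm : Hits T sg cur v) :
    ShortInv T sg cur (Function.update F v (insert cur (F v))) (Function.update st v (cur + 1))
      (Function.update A v (A v + (sg cur).len)) := by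
  have hnot : cur ∉ F v := by
    intro hmem
    have h1 := h.le_stamp v cur hv hmem
    obtain ⟨s, hs⟩ : ∃ s, st v = s + 1 := ⟨st v - 1, by omega⟩
    have := h.le v s hv (h.stamp v s hv hs)
    omega
  refine ⟨fun w hw => ?_, fun w s hw => ?_, fun w s hw => ?_, fun w s hw => ?_, fun w s hw => ?_⟩ <;>
    rcases eq_or_ne w v with rfl | hwv <;>
    first | simp only [Function.update_of_ne hwv] | simp only [Function.update_self]
  · rw [Finset.sum_insert hnot, h.sum w hw, add_comm]
  · exact h.sum w hw
  · intro hs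
    rcases Finset.mem_insert.1 hs with rfl | hs
    · exact le_rfl
    · exact h.le w s hw hs
  · exact h.le w s hw
  · intro hs
    rcases Finset.mem_insert.1 hs with rfl | hs
    · exact ⟨hl, hm⟩
    · exact h.valid w s hw hs
  · exact h.valid w s hw
  · intro hs
    rw [show s = cur by omega]; exact Finset.mem_insert_self _ _
  · exact h.stamp w s hw
  · intro hs
    rcases Finset.mem_insert.1 hs with rfl | hs
    · exact le_rfl
    · have := h.le w s hw hs; omega
  · exact h.le_stamp w s hw

/-- Accounting for the segment in array 41 at the node in array 36, and moving to its parent. -/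
def visitBody : Prog :=
  meetsProg ;; when (.and (.ltN (.lit 0) (nv 37)) (neN (.load 17 eV) (.add eS (.lit 1))))
    (.storeN 17 eV (.add eS (.lit 1)) ;; .storeR 10 eV (.add (.load 10 eV) (rv 23))) ;;
  nset 36 (.load 1 eV)

theorem visitBody_run {s v : ℕ} (h : Inp T n sg σ) (hs : σ.nat 41 0 = s) (hv : σ.nat 36 0 = v) :
    (Prog.run ω visitBody σ).nat 36 0 = T.par v ∧
    (Hits T sg s v ∧ σ.nat 17 v ≠ s + 1 ∧
      (Prog.run ω visitBody σ).nat 17 = Function.update (σ.nat 17) v (s + 1) ∧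
      (Prog.run ω visitBody σ).real 10 =
        Function.update (σ.real 10) v (σ.real 10 v + σ.real 23 0) ∨
    ¬ (Hits T sg s v ∧ σ.nat 17 v ≠ s + 1) ∧ (Prog.run ω visitBody σ).nat 17 = σ.nat 17 ∧
      (Prog.run ω visitBody σ).real 10 = σ.real 10) := by
  classical
  obtain ⟨t, ht⟩ := meetsProg_run (ω := ω) h
  rw [hs, hv] at ht
  simp only [visitBody, run_seq, ht, run_when, BExp.Holds, neN_holds, run_nset]
  by_cases hh : Hits T sg s v <;> by_cases hst : σ.nat 17 v = s + 1 <;>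
    simp [hh, hst, eV, eS, NExp.eval, RExp.eval, hv, hs, h.par]

/-- The number of ancestors visited for a grid square. -/
def walkBound (c₂ : ℕ) : NExp := .add (nv 15) (.lit (c₂ + 1))

/-- Visiting the ancestors of the node in array 30. -/
def walkProg (c₂ : ℕ) : Prog := nset 36 (nv 30) ;; forTo 33 (walkBound c₂) visitBody

theorem NodeTree.D_le_iter {u : ℕ} (hu : u < T.m) (k : ℕ) : T.D u ≤ T.D (T.par^[k] u) := by
  induction k with
  | zero => exact le_rfl
  | succ k ih =>
    rw [Function.iterate_succ_apply']
    exact ih.trans (NodeTree.D_le_par (NodeTree.iter_lt hu k))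

/-- A fixed number of parent steps is made without testing for the root. The root is its own parent,
and the stamp makes repeated visits harmless. A segment short at `u` is short at all ancestors,
whose cells are at least as large. -/
theorem walkProg_wp {c₂ L s u : ℕ} {F : ℕ → Finset ℕ} (h : Inp T n sg σ) (hL : σ.nat 15 0 = L)
    (hs : σ.nat 41 0 = s) (hlen : σ.real 23 0 = (sg s).len) (hu : σ.nat 30 0 = u) (hum : u < T.m)
    (hshort : (sg s).len < T.D u / 2) (hF : ShortInv T sg s F (σ.nat 17) (σ.real 10)) :
    WP ω (walkProg c₂) (3 + (nset 36 (nv 30)).wc + (L + (c₂ + 1) + 1) *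
      (visitBody.wc + (walkBound c₂).cost + 20)) σ fun τ =>
      ∃ F', ShortInv T sg s F' (τ.nat 17) (τ.real 10) ∧ (∀ w, F w ⊆ F' w) ∧
        ∀ k, k < L + (c₂ + 1) → Hits T sg s (T.par^[k] u) → s ∈ F' (T.par^[k] u) := by
  refine (WP.comp (R := fun τ => τ.nat 36 0 = u) (WP.run rfl ?_) ?_).mono
    (T := (nset 36 (nv 30)).wc + (L + (c₂ + 1) + 1) * (visitBody.wc + (walkBound c₂).cost + 20))
    (by omega) fun _ _ h => h
  · simp [hu]
  intro σ₁ ha₁ h36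
  have h₁ := h.agrees rfl ha₁
  have hI : ∀ τ, Agrees (forTo 33 (walkBound c₂) visitBody) σ₁ τ → Inp T n sg τ ∧
      τ.nat 15 0 = L ∧ τ.nat 41 0 = s ∧ τ.real 23 0 = (sg s).len := fun τ ha =>
    ⟨h₁.agrees rfl ha, by rw [ha.nat 15 rfl, ha₁.nat 15 rfl, hL],
      by rw [ha.nat 41 rfl, ha₁.nat 41 rfl, hs], by rw [ha.real 23 rfl, ha₁.real 23 rfl, hlen]⟩
  refine (WP.forTo (I := fun j τ => τ.nat 36 0 = T.par^[j] u ∧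
    ∃ F', ShortInv T sg s F' (τ.nat 17) (τ.real 10) ∧ (∀ w, F w ⊆ F' w) ∧
        ∀ k, k < j → Hits T sg s (T.par^[k] u) → s ∈ F' (T.par^[k] u)) rfl ?_ ?_ ?_).mono
    le_rfl fun τ _ h => h.2
  · intro τ ha; simp [walkBound, NExp.eval, (hI τ ha).2.1]
  · refine ⟨by simpa using h36, F, ?_, fun _ => subset_rfl, by simp⟩
    simp only [State.setNat_nat, Nat.reduceEqDiff, if_false, State.setNat_real]
    rw [ha₁.nat 17 rfl, ha₁.real 10 rfl]; exact hF
  · rintro j τ hj ha hjv ⟨hv, F', hF', hsub, hmem⟩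
    obtain ⟨hi, hL', hs', hlen'⟩ := hI τ ha
    refine WP.run rfl ?_
    have hvm := NodeTree.iter_lt hum j
    obtain ⟨r1, r2⟩ := visitBody_run (ω := ω) hi hs' hv
    simp only [State.setNat_nat, Nat.reduceEqDiff, if_false, State.setNat_real]
    refine ⟨by rw [r1, Function.iterate_succ_apply'], ?_⟩
    set v := T.par^[j] u with hvd
    rcases r2 with ⟨hh, hst, e1, e2⟩ | ⟨hn, e1, e2⟩
    · rw [e1, e2, hlen']
      refine ⟨_, hF'.insert hvm hst (by linarith [NodeTree.D_le_iter hum j]) hh, fun w => ?_, ?_⟩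
      · by_cases hwv : w = v
        · rw [hwv, Function.update_self]; exact (hsub v).trans (Finset.subset_insert _ _)
        · rw [Function.update_of_ne hwv]; exact hsub w
      · intro k hk hhk
        by_cases hwv : T.par^[k] u = v
        · rw [hwv, Function.update_self]; exact Finset.mem_insert_self _ _
        · rw [Function.update_of_ne hwv]
          refine hmem k ?_ hhk
          have : k ≠ j := by rintro rfl; exact hwv rfl
          omega
    · rw [e1, e2]
      refine ⟨F', hF', hsub, fun k hk hhk => ?_⟩
      rcases Nat.lt_succ_iff_lt_or_eq.1 hk with hk | rfl
      · exact hmem k hk hhk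
      · refine hF'.stamp _ _ hvm ?_
        by_contra hcon
        exact hn ⟨hhk, hcon⟩

/-! ## Processing all grid squares -/

/-- The length of the segment in array 41. -/
def lenE : RExp :=
  .sqrt (.add (.mul (.sub (.load 0 eS) (.load 2 eS)) (.sub (.load 0 eS) (.load 2 eS)))
    (.mul (.sub (.load 1 eS) (.load 3 eS)) (.sub (.load 1 eS) (.load 3 eS))))

/-- The coordinate of a grid square of the segment in array 41. -/
def gcE (p q : ℕ) (a : NExp) : RExp :=
  .mul (.add (.sub (.sub (.lit 0)
    (.floor (.sub (.lit 0) (.div (minE (.load p eS) (.load q eS)) (rv 22))))) (.lit 1))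
      (.ofNat a)) (rv 22)

/-- Computing the grid square number `e`, where `e` is in array 40. -/
def gridProg : Prog :=
  rset 22 (.mul (.lit 2) (.powTwo (rv 23))) ;;
  rset 20 (gcE 0 2 (.sub (nv 40) (.mul (.lit 2) (.div (nv 40) (.lit 2))))) ;;
  rset 21 (gcE 1 3 (.sub (.div (nv 40) (.lit 2)) (.mul (.lit 2) (.div (.div (nv 40) (.lit 2)) (.lit 2)))))

theorem gridProg_run {e : ℕ} (h : Inp T n sg σ) (he : σ.nat 40 0 = e) (hs : σ.nat 41 0 = e / 4)
    (hl : σ.real 23 0 = (sg (e / 4)).len) :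
    Qry (qx sg e) (qy sg e) (gside (sg (e / 4))) (Prog.run ω gridProg σ) := by
  have h1 : e - 2 * (e / 2) = e % 2 := by omega
  have h2 : e / 2 - 2 * (e / 2 / 2) = e / 2 % 2 := by omega
  constructor <;>
    simp [gridProg, gcE, RExp.eval, NExp.eval, he, hs, hl, eS, h.px, h.py, h.qx, h.qy, h1, h2, qx, qy,
      gcoord, gside]

/-- Registering the root as an entry. -/
def rootEntProg : Prog :=
  when (.not (.ltN (.lit 0) (.sub (nv 40) (.mul (.lit 4) (.div (nv 40) (.lit 4))))))
    (.storeN 14 (nv 40) (.add eRoot (.lit 1)))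

/-- Computing the segment number and its length. -/
def prepProg : Prog := nset 41 (.div (nv 40) (.lit 4)) ;; rset 23 lenE

/-- Searching the node of a grid square, and processing the result. -/
def locateProg (c₂ : ℕ) : Prog := searchProg ;; entProg ;; walkProg c₂

/-- Processing the grid square number `e`, where `e` is in array 40. -/
def squareBody (c₂ : ℕ) : Prog :=
  prepProg ;; when (.ltR (.lit 0) (rv 23))
    (.ite (leR (.div (.load 6 eRoot) (.lit 2)) (rv 23)) rootEntProg
      (gridProg ;; when (ccB eRoot) (locateProg c₂)))

/-- Processing all grid squares. -/
def squaresProg (c₂ : ℕ) : Prog := forTo 40 (.mul (.lit 4) (.load 0 (.lit 0))) (squareBody c₂)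

/-- The result of processing all grid squares. -/
structure EntriesSpec (T : NodeTree) (n : ℕ) (sg : ℕ → Segment) (B : ℕ) (ent : ℕ → ℕ)
    (A : ℕ → ℝ) : Prop where
  ent : ∀ e v, e < 4 * n → (ent e = v + 1 ↔ RegEnt T sg e v)
  short : ∃ F : ℕ → Finset ℕ, ∀ w, w < T.m → A w = ∑ s ∈ F w, (sg s).len ∧
    (∀ s ∈ F w, s < n ∧ (sg s).len < T.D w / 2 ∧ Hits T sg s w) ∧
    ∀ s, s < n → 0 < (sg s).len → (sg s).len < T.D w / 2 → Hits T sg s w →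
      T.D w ≤ 2 ^ B * (2 * gside (sg s)) → s ∈ F w

/-- The condition under which the segment of the grid square number `e` is accounted for at `w`. -/
def Visited (T : NodeTree) (sg : ℕ → Segment) (B e w : ℕ) : Prop :=
  0 < (sg (e / 4)).len ∧ (sg (e / 4)).len < T.D T.root / 2 ∧ Hits T sg (e / 4) w ∧
    ∃ u, u < T.m ∧ T.CC (qx sg e) (qy sg e) (gside (sg (e / 4))) u ∧
      T.Stuck (qx sg e) (qy sg e) (gside (sg (e / 4))) u ∧ ∃ k < B + 1, T.par^[k] u = w

theorem NodeTree.D_le_root {w : ℕ} (hw : w < T.m) : T.D w ≤ T.D T.root := by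
  obtain ⟨k, hk⟩ := NodeTree.reach_root hw
  have := NodeTree.D_le_iter hw k
  rwa [hk] at this

theorem NodeTree.CC.root {x y g : ℝ} {w : ℕ} (hw : w < T.m) (h : T.CC x y g w) :
    T.CC x y g T.root := by
  obtain ⟨k, hk⟩ := NodeTree.reach_root hw
  have := h.iter hw k
  rwa [hk] at this

/-- A node of maximal level among those strictly containing the square. -/
theorem exists_stuck {x y g : ℝ} (h : T.CC x y g T.root) :
    ∃ u, u < T.m ∧ T.CC x y g u ∧ T.Stuck x y g u := by
  classical
  have hfin : (T.lev '' {u | u < T.m ∧ T.CC x y g u}).Finite :=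
    ((Set.finite_lt_nat T.m).subset fun u hu => hu.1).image _
  obtain ⟨l, ⟨u, ⟨hu, hc⟩, rfl⟩, hmax⟩ := hfin.exists_maximal ⟨_, T.root, ⟨T.root_lt, h⟩, rfl⟩
  refine ⟨u, hu, hc, fun c hch hcc => ?_⟩
  have h1 := hmax ⟨c, ⟨hch.1, hcc⟩, rfl⟩
  have h2 := T.lev_lt c hch.1 hch.2.1
  rw [hch.2.2] at h2
  exact absurd (h1 h2.le) (not_le.2 h2)

/-- Choose a grid square inside the cell of `w` at a point where the segment meets it; it is one of
the four squares of `s`. The lowest node `u` strictly containing it is `w` or a descendant of `w`,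
with side at least twice the grid width. Sides double on the way up, so the bound on `T.D w` leaves
at most `B` steps from `u` to `w`. -/
theorem exists_visited {B s w : ℕ} (hw : w < T.m) (hl : 0 < (sg s).len)
    (hlw : (sg s).len < T.D w / 2) (hh : Hits T sg s w)
    (hB : T.D w ≤ 2 ^ B * (2 * gside (sg s))) : ∃ e, e / 4 = s ∧ Visited T sg B e w := by
  obtain ⟨t, h0, h1, x1, x2, y1, y2⟩ := hh
  have hg := gside_pos (sg s)
  have hgw : gside (sg s) < T.D w := by
    by_contra! hcon
    rw [← long_iff hl hw] at hcon
    linarith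
  have hgw' := hgw
  rw [gside_eq] at hgw'
  obtain ⟨c, r, hcc, c1, c2, r1, r2⟩ := NodeTree.exists_grid_in hw hgw' x1 x2 y1 y2
  rw [← gside_eq] at hcc c1 c2 r1 r2
  obtain ⟨e, he, hx, hy⟩ := exists_square (sg := sg) (s := s) ⟨t, h0, h1, c1, c2, r1, r2⟩
  rw [← hx, ← hy] at hcc
  refine ⟨e, he, ?_⟩
  have hq := isGrid_q sg e
  rw [Visited, he]
  rw [he] at hq
  refine ⟨hl, by linarith [NodeTree.D_le_root hw], ⟨t, h0, h1, x1, x2, y1, y2⟩, ?_⟩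
  obtain ⟨u, hu, hcu, hst⟩ := exists_stuck (hcc.root hw)
  obtain ⟨k, hk, hk'⟩ := NodeTree.iter_growth hu (hst.ancestor hg hu hw hcu hcc)
  refine ⟨u, hu, hcu, hst, k, ?_, hk⟩
  have hgu : 2 * gside (sg s) ≤ T.D u := by
    rcases NodeTree.D_le_or (z := Int.log 2 (sg s).len + 1) hu with h | h <;> rw [← gside_eq] at h
    · exact absurd hcu.2.2.2.2 (not_lt.2 h)
    · exact h
  have h3 : (2 : ℝ) ^ k * (2 * gside (sg s)) ≤ 2 ^ B * (2 * gside (sg s)) :=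
    le_trans (by gcongr) (hk'.trans hB)
  have h4 : (2 : ℝ) ^ k ≤ 2 ^ B := le_of_mul_le_mul_right h3 (by positivity)
  have := (pow_le_pow_iff_right₀ (by norm_num : (1 : ℝ) < 2)).1 h4
  omega

/-- The running time of `locateProg`. -/
def locateCost (c₂ L : ℕ) : ℕ := searchCost L + ((4 + 1) * (entBody.wc + (NExp.lit 4).cost + 20) +
  (3 + (nset 36 (nv 30)).wc + (L + (c₂ + 1) + 1) * (visitBody.wc + (walkBound c₂).cost + 20)))

/-- The running time of `squareBody`. -/
def squareCost (c₂ L : ℕ) : ℕ := prepProg.wc + ((BExp.ltR (.lit 0) (rv 23)).cost +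
  (((leR (.div (.load 6 eRoot) (.lit 2)) (rv 23)).cost + (rootEntProg.wc +
    (gridProg.wc + ((ccB eRoot).cost + (locateCost c₂ L + 1))))) + 1))

/-- The invariant of the processing of all grid squares. -/
structure SquaresInv (T : NodeTree) (sg : ℕ → Segment) (B e : ℕ) (ent st : ℕ → ℕ) (A : ℕ → ℝ) :
    Prop where
  done : ∀ e' v, e' < e → (ent e' = v + 1 ↔ RegEnt T sg e' v)
  todo : ∀ e', e ≤ e' → ent e' = 0
  short : ∃ F, ShortInv T sg (e / 4) F st A ∧ (∀ w s, w < T.m → s ∈ F w → 4 * s < e) ∧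
    (∀ e' w, e' < e → Visited T sg B e' w → e' / 4 ∈ F w)

theorem SquaresInv.step {B e : ℕ} {ent st ent' : ℕ → ℕ} {A : ℕ → ℝ}
    (h : SquaresInv T sg B e ent st A) (h1 : ∀ e', e' ≠ e → ent' e' = ent e')
    (h2 : ∀ v, ent' e = v + 1 ↔ RegEnt T sg e v) (h3 : ∀ w, ¬ Visited T sg B e w) :
    SquaresInv T sg B (e + 1) ent' st A := by
  obtain ⟨F, hF, hlt, hF'⟩ := h.short
  refine ⟨fun e' v he' => ?_, fun e' he' => by rw [h1 e' (by omega), h.todo e' (by omega)], F,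
    hF.mono (by omega), fun w s hw hs => by have := hlt w s hw hs; omega, fun e' w he' hv => ?_⟩
  · rcases Nat.lt_succ_iff_lt_or_eq.1 he' with he' | rfl
    · rw [h1 e' (by omega), h.done e' v he']
    · exact h2 v
  · rcases Nat.lt_succ_iff_lt_or_eq.1 he' with he' | rfl
    · exact hF' e' w he' hv
    · exact absurd hv (h3 w)

/-- Degenerate segments need nothing, and a segment long at the root can enter only there. Otherwise
an entry forces its parent, hence the root, to strictly contain the grid square. So nothing is to be
done if the root does not, and if it does, the search finds that parent. -/
theorem squareBody_wp {c₂ L e : ℕ} (h : Inp T n sg σ) (ht : TreeTab T L σ)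
    (hpow : T.m < 2 ^ L) (he : σ.nat 40 0 = e)
    (hinv : SquaresInv T sg (L + c₂) e (σ.nat 14) (σ.nat 17) (σ.real 10)) :
    WP ω (squareBody c₂) (squareCost c₂ L) σ fun τ =>
      SquaresInv T sg (L + c₂) (e + 1) (τ.nat 14) (τ.nat 17) (τ.real 10) := by
  set s := e / 4 with hs
  refine WP.comp (R := fun τ => τ.nat 41 0 = s ∧ τ.real 23 0 = (sg s).len) (WP.run rfl ?_) ?_
  · simp [prepProg, lenE, eS, NExp.eval, RExp.eval, he, ← hs, h.px, h.py, h.qx, h.qy,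
      Segment.len_eq]
  rintro σ₁ ha₁ ⟨hs₁, hl₁⟩
  replace h := h.agrees rfl ha₁
  replace ht := ht.agrees rfl ha₁
  rw [← ha₁.nat 14 rfl, ← ha₁.nat 17 rfl, ← ha₁.real 10 rfl] at hinv
  rw [← ha₁.nat 40 rfl] at he
  have h0 := hinv.todo e le_rfl
  refine WP.when (fun hpos => ?_) (fun hpos => ?_)
  swap
  · simp only [BExp.Holds, RExp.eval, rv_eval, hl₁, Int.cast_zero] at hpos
    refine hinv.step (fun _ _ => rfl) (fun v => ?_) (fun w hv => hpos hv.1)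
    rw [h0]
    exact ⟨fun h => by omega, fun h => absurd h.2.1 hpos⟩
  simp only [BExp.Holds, RExp.eval, rv_eval, hl₁, Int.cast_zero] at hpos
  refine WP.ite (fun hlong => ?_) (fun hshort => ?_)
  · simp only [leR_holds, RExp.eval, rv_eval, hl₁, h.D, eRoot, NExp.eval, h.root] at hlong
    push_cast at hlong
    refine WP.run rfl ?_
    have hr0 : ∀ w, ¬ Visited T sg (L + c₂) e w := fun w hv => absurd hv.2.1 (not_lt.2 hlong)
    have hreg : ∀ v, RegEnt T sg e v ↔ v = T.root ∧ e % 4 = 0 := by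
      intro v
      constructor
      · rintro ⟨hv, -, ⟨a, -, b⟩ | ⟨-, b, -⟩⟩
        · exact ⟨a, b⟩
        · rw [long_iff hpos T.root_lt] at hlong
          have := NodeTree.D_le_root (T.par_lt v hv)
          linarith
      · rintro ⟨rfl, b⟩
        exact ⟨T.root_lt, hpos, .inl ⟨rfl, hlong, b⟩⟩
    have hmod : e - 4 * (e / 4) = e % 4 := by omega
    simp only [rootEntProg, run_when, BExp.Holds, NExp.eval, nv_eval, he, hmod, eRoot, h.root,
      run_storeN, not_lt, Nat.le_zero]
    split_ifs with h4
    · simp only [State.setNat_nat, Nat.reduceEqDiff, if_false, if_true, State.setNat_real]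
      refine hinv.step (fun e' he' => Function.update_of_ne he' _ _) (fun v => ?_) hr0
      rw [hreg, Function.update_self]
      exact ⟨fun h => ⟨by omega, h4⟩, fun h => by rw [h.1]⟩
    · refine hinv.step (fun _ _ => rfl) (fun v => ?_) hr0
      rw [hreg, h0]
      exact ⟨fun h => by omega, fun h => absurd h.2 h4⟩
  · simp only [leR_holds, RExp.eval, rv_eval, hl₁, h.D, eRoot, NExp.eval, h.root, not_le] at hshort
    push_cast at hshort
    refine WP.comp (R := Qry (qx sg e) (qy sg e) (gside (sg s))) (WP.run rfl ?_) ?_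
    · exact gridProg_run h he hs₁ hl₁
    rintro σ₂ ha₂ hq₂
    replace h := h.agrees rfl ha₂
    replace ht := ht.agrees rfl ha₂
    rw [← ha₂.nat 14 rfl, ← ha₂.nat 17 rfl, ← ha₂.real 10 rfl] at hinv
    rw [← ha₂.nat 14 rfl] at h0
    rw [← ha₂.nat 40 rfl] at he
    rw [← ha₂.nat 41 rfl] at hs₁
    rw [← ha₂.real 23 rfl] at hl₁
    have hg := gside_pos (sg s)
    have hgrid := isGrid_q sg e
    rw [← hs] at hgrid
    have hreg : ∀ v, RegEnt T sg e v → v < T.m ∧ v ≠ T.root ∧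
        gside (sg s) < T.D (T.par v) ∧ T.Inside (qx sg e) (qy sg e) (gside (sg s)) v := by
      rintro v ⟨hv, -, ⟨-, b, -⟩ | ⟨a, b, c⟩⟩
      · rw [← hs] at b; linarith
      · exact ⟨hv, a, b, c⟩
    refine WP.when (fun hcc => ?_) (fun hcc => ?_)
    swap
    · rw [ccB_holds h hq₂, eRoot, NExp.eval, NExp.eval, h.root] at hcc
      refine hinv.step (fun _ _ => rfl) (fun v => ?_) ?_
      · rw [h0]
        refine ⟨fun h => by omega, fun hv => ?_⟩
        obtain ⟨a, b, c, d⟩ := hreg v hv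
        exact absurd ((NodeTree.stuck_of_child_inside hgrid a b d c).1.root (T.par_lt v a)) hcc
      · rintro w ⟨-, -, -, u, hu, hcu, -⟩
        exact hcc (hcu.root hu)
    rw [ccB_holds h hq₂, eRoot, NExp.eval, NExp.eval, h.root] at hcc
    refine WP.comp (searchProg_wp h ht hpow hq₂ hg hcc) ?_
    rintro σ₃ ha₃ ⟨hu, hcu, hst⟩
    replace h := h.agrees rfl ha₃
    replace ht := ht.agrees rfl ha₃
    replace hq₂ := hq₂.agrees rfl ha₃
    rw [← ha₃.nat 14 rfl, ← ha₃.nat 17 rfl, ← ha₃.real 10 rfl] at hinv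
    rw [← ha₃.nat 14 rfl] at h0
    rw [← ha₃.nat 40 rfl] at he
    rw [← ha₃.nat 41 rfl] at hs₁
    rw [← ha₃.real 23 rfl] at hl₁
    generalize hud : σ₃.nat 30 0 = u at hu hcu hst
    have hgu := hcu.2.2.2.2
    refine WP.comp (entProg_wp h ht.child hq₂ hud he h0 fun v w hv hw hvi hwi =>
      children_inside_eq hgrid hu hgu hv hw hvi hwi) ?_
    rintro σ₄ ha₄ ⟨e1, e2⟩
    replace h := h.agrees rfl ha₄
    obtain ⟨F, hF, -, hFv⟩ := hinv.short
    rw [← ha₄.nat 17 rfl, ← ha₄.real 10 rfl] at hF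
    rw [← ha₄.nat 41 rfl] at hs₁
    rw [← ha₄.real 23 rfl] at hl₁
    rw [← ha₄.nat 30 rfl] at hud
    refine (walkProg_wp (ω := ω) (c₂ := c₂) h (ht.agrees rfl ha₄).L hs₁ hl₁ hud hu ?_ hF).mono le_rfl ?_
    · by_contra! hcon
      rw [long_iff hpos hu] at hcon
      linarith
    rintro σ₅ ha₅ ⟨F', hF', hsub, hmem⟩
    rw [← ha₅.nat 14 rfl] at e1 e2
    refine ⟨fun e' v he' => ?_, fun e' he' => ?_, F', hF'.mono (by omega),
      fun w s' hw hs' => by have := hF'.le w s' hw hs'; omega, fun e' w he' hv => ?_⟩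
    · rcases Nat.lt_succ_iff_lt_or_eq.1 he' with he' | rfl
      · rw [e1 e' (by omega), hinv.done e' v he']
      · rw [e2 v]
        constructor
        · rintro ⟨a, b⟩
          refine ⟨a.1, hpos, .inr ⟨a.2.1, ?_, b⟩⟩
          rw [a.2.2]; exact hgu
        · intro hv
          obtain ⟨a, b, c, d⟩ := hreg v hv
          -- The parent of any registered entry and the located node are both lowest nodes strictly
          -- containing the square, so they coincide.
          obtain ⟨k1, k2⟩ := NodeTree.stuck_of_child_inside hgrid a b d c
          exact ⟨⟨a, b, hst.unique hg hu (T.par_lt v a) hcu k1 k2 |>.symm⟩, d⟩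
    · rw [e1 e' (by omega), hinv.todo e' (by omega)]
    · rcases Nat.lt_succ_iff_lt_or_eq.1 he' with he' | rfl
      · exact hsub w (hFv e' w he' hv)
      · obtain ⟨-, -, hh, u', hu', hcu', hst', k, hk, rfl⟩ := hv
        obtain rfl := hst.unique hg hu hu' hcu hcu' hst'
        exact hmem k (by omega) hh

theorem squaresProg_wp {c₂ L : ℕ} (h : Inp T n sg σ) (ht : TreeTab T L σ) (hpow : T.m < 2 ^ L)
    (h14 : σ.nat 14 = fun _ => 0) (h17 : σ.nat 17 = fun _ => 0) (h10 : σ.real 10 = fun _ => 0) :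
    WP ω (squaresProg c₂) ((4 * n + 1) * (squareCost c₂ L +
      (NExp.mul (.lit 4) (.load 0 (.lit 0))).cost + 20)) σ fun τ =>
      EntriesSpec T n sg (L + c₂) (τ.nat 14) (τ.real 10) := by
  refine (WP.forTo (I := fun e τ => SquaresInv T sg (L + c₂) e (τ.nat 14) (τ.nat 17) (τ.real 10))
    (N := 4 * n) rfl ?_ ?_ ?_).mono le_rfl ?_
  · intro τ ha; simp [NExp.eval, (h.agrees rfl ha).n]
  · simp only [State.setNat_nat, Nat.reduceEqDiff, if_false, State.setNat_real, h14, h17, h10]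
    refine ⟨fun _ _ h => by omega, fun _ _ => rfl, fun _ => ∅, ?_, by simp, fun _ _ h => by omega⟩
    exact ⟨by simp, by simp, by simp, by simp, by simp⟩
  · rintro e τ he ha hev hinv
    refine (squareBody_wp (h.agrees rfl ha) (ht.agrees rfl ha) hpow hev hinv).mono le_rfl ?_
    intro τ' _ h
    simpa using h
  · rintro τ - hinv
    refine ⟨fun e v he => hinv.done e v he, ?_⟩
    obtain ⟨F, hF, hlt, hFv⟩ := hinv.short
    refine ⟨F, fun w hw => ⟨hF.sum w hw, fun s hs => ⟨by have := hlt w s hw hs; omega,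
      hF.valid w s hw hs⟩, fun s hs hl hlw hh hB => ?_⟩⟩
    obtain ⟨e, rfl, hv⟩ := exists_visited hw hl hlw hh hB
    exact hFv e w (by omega) hv

end Congestion

namespace Congestion

open RealRAM
variable {T : NodeTree} {n : ℕ} {sg : ℕ → Segment} {σ τ : State} {ω : ℕ → Bool}

/-! ## Listing the long segments at every node -/

open Classical in
/-- The kept segments that are long relative to `v` and hit the cell of `v`. -/
noncomputable def longSet (T : NodeTree) (sg : ℕ → Segment) (R : Finset ℕ) (v : ℕ) : Finset ℕ :=
  R.filter fun s => 0 < (sg s).len ∧ T.D v / 2 ≤ (sg s).len ∧ Hits T sg s v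

open Classical in
/-- The kept segments that hit `v` and have been registered at `v` by one of the first `e` grid
squares. -/
noncomputable def entSet (T : NodeTree) (sg : ℕ → Segment) (R : Finset ℕ) (e v : ℕ) : Finset ℕ :=
  R.filter fun s => Hits T sg s v ∧ ∃ e' < e, e' / 4 = s ∧ RegEnt T sg e' v

theorem entSet_subset (R : Finset ℕ) (e v : ℕ) : entSet T sg R e v ⊆ longSet T sg R v := by
  classical
  intro s hs
  obtain ⟨hR, hh, e', he', rfl, hr⟩ := Finset.mem_filter.1 hs
  exact Finset.mem_filter.2 ⟨hR, hr.2.1, hr.long, hh⟩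

theorem longSet_root {R : Finset ℕ} (hR : ∀ s ∈ R, s < n) :
    longSet T sg R T.root = entSet T sg R (4 * n) T.root := by
  classical
  refine Finset.Subset.antisymm (fun s hs => ?_) (entSet_subset _ _ _)
  obtain ⟨hsR, hl, hlong, hh⟩ := Finset.mem_filter.1 hs
  obtain ⟨e, he, hr⟩ := exists_regEnt T.root_lt hl hlong (fun h => absurd rfl h) hh
  have := hR s hsR
  exact Finset.mem_filter.2 ⟨hsR, hh, e, by omega, he, hr⟩

theorem Hits.par {s v : ℕ} (hv : v < T.m) (h : Hits T sg s v) : Hits T sg s (T.par v) := by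
  obtain ⟨a, b, c, d⟩ := NodeTree.sub_par hv
  exact Segment.Meets.mono h a b c d

-- The recursion behind the lists. A segment long at `v` is either long at the parent too, and then
-- also meets the larger cell of the parent, or it becomes long at `v` and has an entry there.
-- Conversely, long at the parent implies long at `v`, whose side is not larger.
open Classical in
theorem longSet_child {R : Finset ℕ} (hR : ∀ s ∈ R, s < n) {v : ℕ} (hv : v < T.m) :
    longSet T sg R v = entSet T sg R (4 * n) v ∪
      (longSet T sg R (T.par v)).filter fun s => Hits T sg s v := by
  ext s
  rw [Finset.mem_union, Finset.mem_filter]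
  constructor
  · intro hs
    obtain ⟨hsR, hl, hlong, hh⟩ := Finset.mem_filter.1 hs
    by_cases hp : T.D (T.par v) / 2 ≤ (sg s).len
    · exact .inr ⟨Finset.mem_filter.2 ⟨hsR, hl, hp, hh.par hv⟩, hh⟩
    · obtain ⟨e, he, hr⟩ := exists_regEnt hv hl hlong (fun _ => not_le.1 hp) hh
      have := hR s hsR
      exact .inl (Finset.mem_filter.2 ⟨hsR, hh, e, by omega, he, hr⟩)
  · rintro (hs | ⟨hs, hh⟩)
    · exact entSet_subset _ _ _ hs
    · obtain ⟨hsR, hl, hlong, -⟩ := Finset.mem_filter.1 hs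
      exact Finset.mem_filter.2 ⟨hsR, hl, by linarith [NodeTree.D_le_par hv], hh⟩

/-- The list stored for the node `v` enumerates `F`. -/
def ListOf (cap : ℕ) (cnt lst : ℕ → ℕ) (v : ℕ) (F : Finset ℕ) : Prop :=
  cnt v = F.card ∧ (Finset.range (cnt v)).image (fun k => lst (v * cap + k)) = F

/-- The invariant of the computation of the lists: unless there was an overflow, the list of `v`
enumerates `P v`. -/
structure PassInv (T : NodeTree) (G P : ℕ → Finset ℕ) (cap : ℕ) (cnt lst : ℕ → ℕ) (ovf : ℕ) :
    Prop where
  le : ∀ v, v < T.m → cnt v ≤ cap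
  overflow : ovf ≠ 0 → ∃ v < T.m, cap < (G v).card
  ok : ovf = 0 → ∀ v, v < T.m → ListOf cap cnt lst v (P v)

theorem index_inj {cap v w i j : ℕ} (hi : i < cap) (hj : j < cap)
    (h : v * cap + i = w * cap + j) : v = w ∧ i = j := by
  have h1 : (v * cap + i) / cap = v := by
    rw [mul_comm, Nat.mul_add_div (by omega), Nat.div_eq_of_lt hi, add_zero]
  have h2 : (w * cap + j) / cap = w := by
    rw [mul_comm, Nat.mul_add_div (by omega), Nat.div_eq_of_lt hj, add_zero]
  have : v = w := by rw [← h1, h, h2]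
  subst this
  exact ⟨rfl, by omega⟩

theorem ListOf.congr {cap v : ℕ} {cnt cnt' lst lst' : ℕ → ℕ} {F : Finset ℕ}
    (h : ListOf cap cnt lst v F) (hc : cnt' v = cnt v)
    (hl : ∀ k < cnt v, lst' (v * cap + k) = lst (v * cap + k)) : ListOf cap cnt' lst' v F := by
  refine ⟨hc.trans h.1, ?_⟩
  rw [← h.2, hc]
  exact Finset.image_congr fun k hk => hl k (by simpa using hk)

theorem ListOf.append {cap v s : ℕ} {cnt lst : ℕ → ℕ} {F : Finset ℕ}
    (h : ListOf cap cnt lst v F) (hs : s ∉ F) :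
    ListOf cap (Function.update cnt v (cnt v + 1)) (Function.update lst (v * cap + cnt v) s) v
      (insert s F) := by
  refine ⟨by rw [Function.update_self, Finset.card_insert_of_notMem hs, h.1], ?_⟩
  rw [Function.update_self, Finset.range_add_one, Finset.image_insert, Function.update_self]
  congr 1
  rw [← h.2]
  refine Finset.image_congr fun k hk => ?_
  have : k < cnt v := by simpa using hk
  exact Function.update_of_ne (by omega) _ _

theorem ListOf.get_mem {cap v k : ℕ} {cnt lst : ℕ → ℕ} {F : Finset ℕ}
    (h : ListOf cap cnt lst v F) (hk : k < cnt v) : lst (v * cap + k) ∈ F := by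
  rw [← h.2]
  exact Finset.mem_image_of_mem _ (by simpa using hk)

theorem ListOf.get_inj {cap v j k : ℕ} {cnt lst : ℕ → ℕ} {F : Finset ℕ}
    (h : ListOf cap cnt lst v F) (hj : j < cnt v) (hk : k < cnt v)
    (he : lst (v * cap + j) = lst (v * cap + k)) : j = k := by
  have hinj : Set.InjOn (fun k => lst (v * cap + k)) (Finset.range (cnt v)) := by
    rw [← Finset.card_image_iff, h.2, Finset.card_range, h.1]
  exact hinj (by simpa using hj) (by simpa using hk) he

/-- Each node owns a block of `cap` cells and these blocks are disjoint, so writing below the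
capacity leaves all other lists intact. -/
theorem PassInv.append_lt {G P : ℕ → Finset ℕ} {cap v s ovf : ℕ} {cnt lst : ℕ → ℕ}
    (h : PassInv T G P cap cnt lst ovf) (hlt : cnt v < cap)
    (hs : ovf = 0 → s ∉ P v) :
    PassInv T G (Function.update P v (insert s (P v))) cap (Function.update cnt v (cnt v + 1))
      (Function.update lst (v * cap + cnt v) s) ovf := by
  refine ⟨fun w hw => ?_, h.overflow, fun ho w hw => ?_⟩
  · by_cases hwv : w = v
    · subst hwv; rw [Function.update_self]; omega
    · rw [Function.update_of_ne hwv]; exact h.le w hw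
  · by_cases hwv : w = v
    · subst hwv
      rw [Function.update_self]
      exact (h.ok ho w hw).append (hs ho)
    · rw [Function.update_of_ne hwv]
      have hl := h.le w hw
      refine (h.ok ho w hw).congr (Function.update_of_ne hwv _ _) fun k hk =>
        Function.update_of_ne ?_ _ _
      intro heq
      exact hwv (index_inj (by omega) hlt heq).1

/-- The overflow flag is a certificate: a full list of distinct elements of `G v` and one further
element of `G v` show that `G v` exceeds the capacity. -/
theorem PassInv.append_ge {G P P' : ℕ → Finset ℕ} {cap v s ovf : ℕ} {cnt lst : ℕ → ℕ}
    (h : PassInv T G P cap cnt lst ovf) (hv : v < T.m) (hlt : ¬ cnt v < cap)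
    (hs : ovf = 0 → s ∉ P v ∧ insert s (P v) ⊆ G v) : PassInv T G P' cap cnt lst 1 := by
  refine ⟨h.le, fun _ => ?_, fun h => absurd h one_ne_zero⟩
  by_cases ho : ovf = 0
  · obtain ⟨h1, h2⟩ := hs ho
    have := Finset.card_le_card h2
    rw [Finset.card_insert_of_notMem h1, ← (h.ok ho v hv).1] at this
    exact ⟨v, hv, by omega⟩
  · exact h.overflow ho

theorem PassInv.congr {G P P' : ℕ → Finset ℕ} {cap ovf : ℕ} {cnt lst : ℕ → ℕ}
    (h : PassInv T G P cap cnt lst ovf) (hP : ovf = 0 → ∀ v, v < T.m → P' v = P v) :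
    PassInv T G P' cap cnt lst ovf :=
  ⟨h.le, h.overflow, fun ho v hv => by rw [hP ho v hv]; exact h.ok ho v hv⟩

/-- Appending the segment in array 41 to the list of the node in array 36. -/
def appendProg : Prog :=
  .ite (.ltN (.load 19 eV) (nv 16))
    (.storeN 50 (.add (.mul eV (nv 16)) (.load 19 eV)) eS ;;
      .storeN 19 eV (.add (.load 19 eV) (.lit 1)))
    (nset 51 (.lit 1))

/-- Appending the segment in array 41 to the list of the node in array 36 if it hits its cell. -/
def tryAppend : Prog := meetsProg ;; when (.ltN (.lit 0) (nv 37)) appendProg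

theorem tryAppend_run {s v : ℕ} (h : Inp T n sg σ) (hs : σ.nat 41 0 = s) (hv : σ.nat 36 0 = v) :
    (Hits T sg s v ∧ σ.nat 19 v < σ.nat 16 0 ∧
      (Prog.run ω tryAppend σ).nat 19 = Function.update (σ.nat 19) v (σ.nat 19 v + 1) ∧
      (Prog.run ω tryAppend σ).nat 50 =
        Function.update (σ.nat 50) (v * σ.nat 16 0 + σ.nat 19 v) s ∧
      (Prog.run ω tryAppend σ).nat 51 0 = σ.nat 51 0) ∨
    (Hits T sg s v ∧ ¬ σ.nat 19 v < σ.nat 16 0 ∧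
      (Prog.run ω tryAppend σ).nat 19 = σ.nat 19 ∧ (Prog.run ω tryAppend σ).nat 50 = σ.nat 50 ∧
      (Prog.run ω tryAppend σ).nat 51 0 = 1) ∨
    (¬ Hits T sg s v ∧
      (Prog.run ω tryAppend σ).nat 19 = σ.nat 19 ∧ (Prog.run ω tryAppend σ).nat 50 = σ.nat 50 ∧
      (Prog.run ω tryAppend σ).nat 51 0 = σ.nat 51 0) := by
  classical
  obtain ⟨t, ht⟩ := meetsProg_run (ω := ω) h
  rw [hs, hv] at ht
  simp only [tryAppend, run_seq, ht, run_when, run_ite, BExp.Holds, appendProg]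
  by_cases hh : Hits T sg s v <;> by_cases hst : σ.nat 19 v < σ.nat 16 0 <;>
    simp [hh, hst, eV, eS, NExp.eval, hv, hs]

/-- Trying to append a segment preserves the invariant. -/
theorem tryAppend_inv {G P P' : ℕ → Finset ℕ} {cap s v : ℕ} (h : Inp T n sg σ)
    (hs : σ.nat 41 0 = s) (hv : σ.nat 36 0 = v) (hvm : v < T.m) (hcap : σ.nat 16 0 = cap)
    (hinv : PassInv T G P cap (σ.nat 19) (σ.nat 50) (σ.nat 51 0))
    (hhit : σ.nat 51 0 = 0 → Hits T sg s v → s ∉ P v ∧ insert s (P v) ⊆ G v ∧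
      P' = Function.update P v (insert s (P v)))
    (hnot : σ.nat 51 0 = 0 → ¬ Hits T sg s v → ∀ w, w < T.m → P' w = P w) :
    PassInv T G P' cap ((Prog.run ω tryAppend σ).nat 19) ((Prog.run ω tryAppend σ).nat 50)
      ((Prog.run ω tryAppend σ).nat 51 0) := by
  rcases tryAppend_run (ω := ω) h hs hv with
    ⟨hh, h1, e1, e2, e3⟩ | ⟨hh, h1, e1, e2, e3⟩ | ⟨hh, e1, e2, e3⟩ <;> rw [e1, e2, e3]
  · rw [hcap] at h1 ⊢
    exact (hinv.append_lt h1 fun ho => (hhit ho hh).1).congr fun ho w _ => by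
      rw [(hhit ho hh).2.2]
  · rw [hcap] at h1
    exact hinv.append_ge hvm h1 fun ho => ⟨(hhit ho hh).1, (hhit ho hh).2.1⟩
  · exact hinv.congr fun ho => hnot ho hh

/-- The memory contains what is needed for computing the lists, for the set `R` of kept
segments. -/
structure PassPre (T : NodeTree) (n : ℕ) (sg : ℕ → Segment) (cap : ℕ) (R : Finset ℕ) (σ : State) :
    Prop where
  inp : Inp T n sg σ
  ord : Order T (σ.nat 11)
  ent : ∀ e v, e < 4 * n → (σ.nat 14 e = v + 1 ↔ RegEnt T sg e v)
  keep : ∀ s, s < n → (0 < σ.nat 18 s ↔ s ∈ R)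
  sub : ∀ s ∈ R, s < n
  cap : σ.nat 16 0 = cap

theorem PassPre.agrees {cap : ℕ} {R : Finset ℕ} {P : Prog} (h : PassPre T n sg cap R σ)
    (hP : inputSafe P = true) (hP' : (P.wN 11 || P.wN 14 || P.wN 16 || P.wN 18) = false)
    (ha : Agrees P σ τ) : PassPre T n sg cap R τ := by
  simp only [Bool.or_eq_false_iff] at hP'
  obtain ⟨⟨⟨h11, h14⟩, h16⟩, h18⟩ := hP'
  exact ⟨h.inp.agrees hP ha, by rw [ha.nat 11 h11]; exact h.ord, by rw [ha.nat 14 h14]; exact h.ent,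
    by rw [ha.nat 18 h18]; exact h.keep, h.sub, by rw [ha.nat 16 h16]; exact h.cap⟩

/-- The invariant for the arrays of a state. -/
def PassInvS (T : NodeTree) (G P : ℕ → Finset ℕ) (cap : ℕ) (σ : State) : Prop :=
  PassInv T G P cap (σ.nat 19) (σ.nat 50) (σ.nat 51 0)

/-- Clearing the lists. -/
def passInit : Prog := nset 51 (.lit 0) ;; forTo 40 eM (.storeN 19 (nv 40) (.lit 0))

theorem passInit_wp {cap : ℕ} {R : Finset ℕ} (h : PassPre T n sg cap R σ) :
    WP ω passInit ((nset 51 (.lit 0)).wc + (T.m + 1) * ((Prog.storeN 19 (nv 40) (.lit 0)).wc +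
      eM.cost + 20)) σ (PassInvS T (longSet T sg R) (entSet T sg R 0) cap) := by
  classical
  refine WP.comp (R := fun τ => τ.nat 51 0 = 0) (WP.run rfl (by simp [NExp.eval])) ?_
  intro σ₁ ha₁ h51
  have h₁ := h.agrees rfl rfl ha₁
  refine (WP.forTo (I := fun k τ => τ.nat 51 0 = 0 ∧ ∀ v, v < k → τ.nat 19 v = 0) (N := T.m)
    rfl ?_ ?_ ?_).mono le_rfl ?_
  · intro τ ha; simp [eM, NExp.eval, (h₁.agrees rfl rfl ha).inp.m]
  · simpa using h51
  · rintro k τ hk ha hkv ⟨h1, h2⟩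
    refine WP.run rfl ⟨by simpa using h1, fun v hv => ?_⟩
    simp only [run_storeN, NExp.eval, nv_eval, hkv, State.setNat_nat, Nat.reduceEqDiff, if_false,
      if_true]
    by_cases hvk : v = k
    · rw [hvk, Function.update_self]
    · rw [Function.update_of_ne hvk]; exact h2 v (by omega)
  · rintro τ - ⟨h1, h2⟩
    refine ⟨fun v hv => by rw [h2 v hv]; omega, fun h => absurd h1 h, fun _ v hv => ?_⟩
    have : entSet T sg R 0 v = ∅ := Finset.filter_eq_empty_iff.2 (by simp)
    simp [ListOf, this, h2 v hv]

/-- Appending the segment of the grid square number `e` (array 40) to its entry node. -/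
def entPassBody : Prog :=
  nset 41 (.div (nv 40) (.lit 4)) ;;
    when (.and (.ltN (.lit 0) (.load 14 (nv 40))) (.ltN (.lit 0) (.load 18 eS)))
      (nset 36 (.sub (.load 14 (nv 40)) (.lit 1)) ;; tryAppend)

/-- Appending all segments to their entry nodes. -/
def entPass : Prog := forTo 40 (.mul (.lit 4) (.load 0 (.lit 0))) entPassBody

theorem entSet_succ_of_ne {R : Finset ℕ} {e w : ℕ}
    (h : ¬ (e / 4 ∈ R ∧ Hits T sg (e / 4) w ∧ RegEnt T sg e w)) :
    entSet T sg R (e + 1) w = entSet T sg R e w := by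
  classical
  refine Finset.filter_congr fun s hs => and_congr_right fun hh => ?_
  constructor
  · rintro ⟨e', he', rfl, hr⟩
    rcases Nat.lt_succ_iff_lt_or_eq.1 he' with he' | rfl
    · exact ⟨e', he', rfl, hr⟩
    · exact absurd ⟨hs, hh, hr⟩ h
  · rintro ⟨e', he', h⟩
    exact ⟨e', by omega, h⟩

theorem entSet_succ_of_reg {R : Finset ℕ} {e w : ℕ} (hs : e / 4 ∈ R) (hh : Hits T sg (e / 4) w)
    (hr : RegEnt T sg e w) :
    entSet T sg R (e + 1) w = insert (e / 4) (entSet T sg R e w) := by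
  classical
  ext s
  simp only [entSet, Finset.mem_insert, Finset.mem_filter]
  constructor
  · rintro ⟨hsR, hsh, e', he', rfl, hr'⟩
    rcases Nat.lt_succ_iff_lt_or_eq.1 he' with he' | rfl
    · exact .inr ⟨hsR, hsh, e', he', rfl, hr'⟩
    · exact .inl rfl
  · rintro (rfl | ⟨hsR, hsh, e', he', h⟩)
    · exact ⟨hs, hh, e, by omega, rfl, hr⟩
    · exact ⟨hsR, hsh, e', by omega, h⟩

theorem entPass_wp {cap : ℕ} {R : Finset ℕ} (h : PassPre T n sg cap R σ)
    (hinv : PassInvS T (longSet T sg R) (entSet T sg R 0) cap σ) :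
    WP ω entPass ((4 * n + 1) * (entPassBody.wc + (NExp.mul (.lit 4) (.load 0 (.lit 0))).cost + 20))
      σ (PassInvS T (longSet T sg R) (entSet T sg R (4 * n)) cap) := by
  classical
  refine WP.forTo (I := fun e τ => PassInvS T (longSet T sg R) (entSet T sg R e) cap τ) rfl ?_ ?_ ?_
  · intro τ ha; simp [NExp.eval, (h.agrees rfl rfl ha).inp.n]
  · simpa [PassInvS] using hinv
  · intro e τ he ha hev hinv
    replace h := h.agrees rfl rfl ha
    refine WP.run rfl ?_
    simp only [PassInvS, State.setNat_nat, Nat.reduceEqDiff, if_false]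
    simp only [entPassBody, run_seq, run_nset, run_when, BExp.Holds, NExp.eval, nv_eval, eS,
      State.setNat_nat, Nat.reduceEqDiff, if_false, if_true, Function.update_self, hev]
    split_ifs with hc
    · obtain ⟨hc1, hc2⟩ := hc
      rw [h.keep _ (by omega)] at hc2
      obtain ⟨v, hv⟩ := Nat.exists_eq_succ_of_ne_zero hc1.ne'
      have hr := (h.ent e v he).1 hv
      rw [hv, Nat.succ_sub_one]
      refine tryAppend_inv (s := e / 4) (v := v) (P := entSet T sg R e)
        ((h.inp.agrees (P := entPassBody) rfl (State.agrees_setNat _ 41 0 _ _ rfl)).agrees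
          (P := entPassBody) rfl (State.agrees_setNat _ 36 0 _ _ rfl)) (by simp) (by simp) hr.1
        (by simpa using h.cap) (by simpa [PassInvS] using hinv) (fun _ hh => ⟨?_, ?_, ?_⟩)
        (fun _ hh w hw => ?_)
      -- By `RegEnt.inj`, different grid squares of one segment do not register the same node, so
      -- the segment is new in the list.
      · intro hmem
        obtain ⟨-, -, e', he', hs, hr'⟩ := Finset.mem_filter.1 hmem
        exact absurd (hr'.inj hr hs) (by omega)
      · rw [← entSet_succ_of_reg hc2 hh hr]; exact entSet_subset _ _ _
      · funext w
        by_cases hwv : w = v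
        · rw [hwv, Function.update_self, entSet_succ_of_reg hc2 hh hr]
        · rw [Function.update_of_ne hwv, entSet_succ_of_ne]
          rintro ⟨-, -, hr'⟩
          have := (h.ent e w he).2 hr'
          omega
      · refine entSet_succ_of_ne ?_
        rintro ⟨-, hh', hr'⟩
        have := (h.ent e w he).2 hr'
        obtain rfl : w = v := by omega
        exact hh hh'
    · simp only [State.setNat_nat, Nat.reduceEqDiff, if_false]
      refine PassInv.congr hinv fun _ w hw => entSet_succ_of_ne ?_
      rintro ⟨hR, -, hr⟩
      have := (h.ent e w he).2 hr
      exact hc ⟨by omega, (h.keep _ (by omega)).2 hR⟩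

/-- Appending the `k`-th segment (array 42) in the list of the parent (array 44). -/
def pushBody : Prog := nset 41 (.load 50 (.add (.mul (nv 44) (nv 16)) (nv 42))) ;; tryAppend

/-- Passing the list of the parent on to the node number `t` in the order (array 40). -/
def downBody : Prog :=
  nset 36 (.load 11 (nv 40)) ;; when (.ltN (.lit 0) (nv 40))
    ((nset 44 (.load 1 eV) ;; nset 43 (.load 19 (nv 44))) ;; forTo 42 (nv 43) pushBody)

/-- Passing the lists down the tree. -/
def downPass : Prog := forTo 40 eM downBody

open Classical in
/-- The lists after the first `t` nodes have received the segments of their parents. -/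
noncomputable def downSet (T : NodeTree) (n : ℕ) (sg : ℕ → Segment) (R : Finset ℕ) (ord : ℕ → ℕ)
    (t v : ℕ) : Finset ℕ :=
  if ∃ t' < t, ord t' = v then longSet T sg R v else entSet T sg R (4 * n) v

/-- The running time of `downBody`. -/
def downCost (cap : ℕ) : ℕ := (nset 36 (.load 11 (nv 40))).wc +
  ((BExp.ltN (.lit 0) (nv 40)).cost + (((nset 44 (.load 1 eV) ;; nset 43 (.load 19 (nv 44))).wc +
    (cap + 1) * (pushBody.wc + (nv 43).cost + 20)) + 1))

theorem downSet_succ {R : Finset ℕ} {ord : ℕ → ℕ} {t : ℕ} (w : ℕ) :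
    downSet T n sg R ord (t + 1) w =
      Function.update (downSet T n sg R ord t) (ord t) (longSet T sg R (ord t)) w := by
  by_cases hw : w = ord t
  · subst hw
    rw [Function.update_self, downSet, if_pos ⟨t, by omega, rfl⟩]
  · rw [Function.update_of_ne hw, downSet, downSet]
    congr 1
    simp only [eq_iff_iff]
    constructor
    · rintro ⟨t', ht', rfl⟩
      exact ⟨t', lt_of_le_of_ne (by omega) (by rintro rfl; exact hw rfl), rfl⟩
    · rintro ⟨t', ht', h⟩
      exact ⟨t', by omega, h⟩

-- In an order with parents first, the list of the parent is complete when `v` is reached. Inherited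
-- segments are long at the parent, whereas entries at `v` are short there, so no segment is
-- appended twice. At the root the entries alone are the full list.
open Classical in
theorem downBody_wp {cap t : ℕ} {R : Finset ℕ} (h : PassPre T n sg cap R σ) (ht : t < T.m)
    (htv : σ.nat 40 0 = t)
    (hinv : PassInvS T (longSet T sg R) (downSet T n sg R (σ.nat 11) t) cap σ) :
    WP ω downBody (downCost cap) σ
      (PassInvS T (longSet T sg R) (downSet T n sg R (σ.nat 11) (t + 1)) cap) := by
  set ord := σ.nat 11 with hord
  set v := ord t with hv
  have hvm : v < T.m := h.ord.lt t ht
  refine WP.comp (R := fun τ => τ.nat 36 0 = v) (WP.run rfl ?_) ?_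
  · simp [NExp.eval, htv, ← hord, hv]
  intro σ₁ ha₁ h36
  have h₁ := h.agrees rfl rfl ha₁
  have hinv₁ : PassInvS T (longSet T sg R) (downSet T n sg R ord t) cap σ₁ := by
    rw [PassInvS, ha₁.nat 19 rfl, ha₁.nat 50 rfl, ha₁.nat 51 rfl]; exact hinv
  have ht₁ : σ₁.nat 40 0 = t := by rw [ha₁.nat 40 rfl, htv]
  have hPv : downSet T n sg R ord t v = entSet T sg R (4 * n) v := by
    rw [downSet, if_neg]
    rintro ⟨t', ht', he⟩
    have := h.ord.inj t' t (by omega) ht he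
    omega
  refine WP.when (fun hpos => ?_) (fun hpos => ?_)
  swap
  · simp only [BExp.Holds, NExp.eval, nv_eval, ht₁, not_lt, Nat.le_zero] at hpos
    subst hpos
    refine PassInv.congr hinv₁ fun _ w hw => ?_
    have hvr : v = T.root := h.ord.zero
    rw [downSet_succ, ← hv]
    by_cases hwv : w = v
    · rw [hwv, Function.update_self, hPv, hvr, longSet_root h.sub]
    · rw [Function.update_of_ne hwv]
  simp only [BExp.Holds, NExp.eval, nv_eval, ht₁] at hpos
  obtain ⟨hvr, t', ht', htp⟩ := h.ord.par t ht (by omega)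
  change v ≠ T.root at hvr
  change ord t' = T.par v at htp
  set p := T.par v with hp
  have hpm : p < T.m := T.par_lt v hvm
  have hvp : v ≠ p := by
    intro heq
    have := h.ord.inj t t' ht (by omega) (heq.trans htp.symm)
    omega
  have hPp : downSet T n sg R ord t p = longSet T sg R p := by
    rw [downSet, if_pos ⟨t', ht', htp⟩]
  refine WP.comp (R := fun τ => τ.nat 44 0 = p ∧ τ.nat 43 0 = σ₁.nat 19 p) (WP.run rfl ?_) ?_
  · simp [NExp.eval, eV, h36, h₁.inp.par, hp]
  rintro σ₂ ha₂ ⟨h44, h43⟩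
  have h₂ := h₁.agrees rfl rfl ha₂
  have hinv₂ : PassInvS T (longSet T sg R) (downSet T n sg R ord t) cap σ₂ := by
    rw [PassInvS, ha₂.nat 19 rfl, ha₂.nat 50 rfl, ha₂.nat 51 rfl]; exact hinv₁
  rw [← ha₂.nat 19 rfl] at h43
  rw [← ha₂.nat 36 rfl] at h36
  set c := σ₂.nat 19 p with hc
  -- The capacity bounds the counts even after an overflow, when the contents of the lists are
  -- meaningless; the running time stays under control.
  have hccap : c ≤ cap := hinv₂.le p hpm
  set l := fun k => σ₂.nat 50 (p * cap + k) with hl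
  have hI : ∀ τ, Agrees (forTo 42 (nv 43) pushBody) σ₂ τ → PassPre T n sg cap R τ ∧
      τ.nat 43 0 = c ∧ τ.nat 44 0 = p ∧ τ.nat 36 0 = v := fun τ ha =>
    ⟨h₂.agrees rfl rfl ha, by rw [ha.nat 43 rfl, h43], by rw [ha.nat 44 rfl, h44],
      by rw [ha.nat 36 rfl, h36]⟩
  have hlist : σ₂.nat 51 0 = 0 → ListOf cap (σ₂.nat 19) (σ₂.nat 50) p (longSet T sg R p) :=
    fun ho => hPp ▸ hinv₂.ok ho p hpm
  -- After `k` elements of the parent's list, the list of `v` holds its entries and those of the `k`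
  -- elements that meet its cell. The parent's list `l` is not changed meanwhile, as `v ≠ p`.
  set Q : ℕ → ℕ → Finset ℕ := fun k => Function.update (downSet T n sg R ord t) v
    (entSet T sg R (4 * n) v ∪ ((Finset.range k).image l).filter fun s => Hits T sg s v) with hQ
  refine (WP.forTo (I := fun k τ => PassInvS T (longSet T sg R) (Q k) cap τ ∧
    (∀ k < c, τ.nat 50 (p * cap + k) = l k) ∧ (τ.nat 51 0 = 0 → σ₂.nat 51 0 = 0)) (N := c)
    rfl ?_ ?_ ?_).mono (Nat.mul_le_mul_right _ (by omega)) ?_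
  · intro τ ha; simp [(hI τ ha).2.1]
  · simp only [PassInvS, State.setNat_nat, Nat.reduceEqDiff, if_false]
    refine ⟨PassInv.congr hinv₂ fun _ w hw => ?_, fun k _ => rfl, fun h => h⟩
    simp only [hQ]
    by_cases hwv : w = v
    · rw [hwv, Function.update_self, hPv]; simp
    · rw [Function.update_of_ne hwv]
  · rintro k τ hk ha hkv ⟨hinv, hlk, hov⟩
    obtain ⟨hpre, h43', h44', h36'⟩ := hI τ ha
    refine WP.run rfl ?_
    have hE : (NExp.load 50 (.add (.mul (nv 44) (nv 16)) (nv 42))).eval τ = l k := by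
      simp only [NExp.eval, nv_eval, h44', hpre.cap, hkv]
      exact hlk k hk
    simp only [PassInvS, State.setNat_nat, Nat.reduceEqDiff, if_false, pushBody, run_seq, run_nset,
      hE]
    set τ' := τ.setNat 41 0 (l k) with hτ'
    have hi' : Inp T n sg τ' := hpre.inp.agrees (P := pushBody) rfl (State.agrees_setNat _ 41 0 _ _ rfl)
    have h41 : τ'.nat 41 0 = l k := by simp [hτ']
    have h36'' : τ'.nat 36 0 = v := by simp [hτ', h36']
    have h16 : τ'.nat 16 0 = cap := by simpa [hτ'] using hpre.cap
    have hinv' : PassInv T (longSet T sg R) (Q k) cap (τ'.nat 19) (τ'.nat 50) (τ'.nat 51 0) := by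
      simpa [hτ', PassInvS] using hinv
    have h51 : τ'.nat 51 0 = τ.nat 51 0 := by simp [hτ']
    have h50 : τ'.nat 50 = τ.nat 50 := by simp [hτ']
    have himg : (Finset.range (k + 1)).image l = insert (l k) ((Finset.range k).image l) := by
      rw [Finset.range_add_one, Finset.image_insert]
    refine ⟨tryAppend_inv (P := Q k) hi' h41 h36'' hvm h16 hinv' (fun ho hh => ?_)
      (fun ho hh w hw => ?_), ?_, ?_⟩
    · have hL := hlist (hov (h51 ▸ ho))
      have hmem : l k ∈ longSet T sg R p := hL.get_mem hk
      obtain ⟨m1, m2, m3, -⟩ := Finset.mem_filter.1 hmem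
      have hQv : Q k v = entSet T sg R (4 * n) v ∪
          ((Finset.range k).image l).filter fun s => Hits T sg s v := Function.update_self ..
      refine ⟨?_, ?_, ?_⟩
      · rw [hQv, Finset.mem_union]
        rintro (hm | hm)
        · obtain ⟨-, -, e', he', hse, hr⟩ := Finset.mem_filter.1 hm
          have := hr.short_par hvr
          rw [hse] at this
          linarith
        · obtain ⟨k', hk', hkk⟩ := Finset.mem_image.1 (Finset.mem_filter.1 hm).1
          rw [Finset.mem_range] at hk'
          have := hL.get_inj (by omega) hk hkk
          omega
      · intro s hs
        rw [longSet_child h.sub hvm, Finset.mem_union, Finset.mem_filter]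
        rcases Finset.mem_insert.1 hs with rfl | hs
        · exact .inr ⟨hmem, hh⟩
        · rw [hQv, Finset.mem_union] at hs
          rcases hs with hs | hs
          · exact .inl hs
          · obtain ⟨hs1, hs2⟩ := Finset.mem_filter.1 hs
            obtain ⟨k', hk', rfl⟩ := Finset.mem_image.1 hs1
            rw [Finset.mem_range] at hk'
            exact .inr ⟨hL.get_mem (by omega), hs2⟩
      · rw [hQv]
        simp only [hQ, Function.update_idem, himg, Finset.filter_insert, if_pos hh,
          Finset.union_insert]
    · simp only [hQ, himg, Finset.filter_insert, if_neg hh]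
    · intro j hj
      rcases tryAppend_run (ω := ω) hi' h41 h36'' with
        ⟨-, h1, e1, e2, e3⟩ | ⟨-, h1, e1, e2, e3⟩ | ⟨-, e1, e2, e3⟩
      · rw [e2, Function.update_of_ne, h50, hlk j hj]
        rw [h16] at h1 ⊢
        intro heq
        exact hvp (index_inj (by omega) h1 heq).1.symm
      · rw [e2, h50, hlk j hj]
      · rw [e2, h50, hlk j hj]
    · rcases tryAppend_run (ω := ω) hi' h41 h36'' with
        ⟨-, h1, e1, e2, e3⟩ | ⟨-, h1, e1, e2, e3⟩ | ⟨-, e1, e2, e3⟩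
      · rw [e3, h51]; exact hov
      · rw [e3]; intro h; omega
      · rw [e3, h51]; exact hov
  · rintro τ - ⟨hinv, -, hov⟩
    refine PassInv.congr hinv fun ho w hw => ?_
    have hL := hlist (hov ho)
    rw [downSet_succ, ← hv]
    simp only [hQ]
    by_cases hwv : w = v
    · rw [hwv, Function.update_self, Function.update_self, longSet_child h.sub hvm, ← hp, ← hL.2]
    · rw [Function.update_of_ne hwv, Function.update_of_ne hwv]

theorem downPass_wp {cap : ℕ} {R : Finset ℕ} (h : PassPre T n sg cap R σ)
    (hinv : PassInvS T (longSet T sg R) (entSet T sg R (4 * n)) cap σ) :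
    WP ω downPass ((T.m + 1) * (downCost cap + eM.cost + 20)) σ
      (PassInvS T (longSet T sg R) (longSet T sg R) cap) := by
  refine (WP.forTo (I := fun t τ => PassInvS T (longSet T sg R) (downSet T n sg R (σ.nat 11) t) cap τ)
    (N := T.m) rfl ?_ ?_ ?_).mono le_rfl ?_
  · intro τ ha; simp [eM, NExp.eval, (h.agrees rfl rfl ha).inp.m]
  · simp only [PassInvS, State.setNat_nat, Nat.reduceEqDiff, if_false]
    exact PassInv.congr hinv fun _ w hw => by simp [downSet]
  · intro t τ ht ha htv hinv
    have h11 : τ.nat 11 = σ.nat 11 := ha.nat 11 rfl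
    rw [← h11] at hinv ⊢
    refine (downBody_wp (h.agrees rfl rfl ha) ht htv hinv).mono le_rfl fun τ' _ h' => ?_
    simpa [PassInvS] using h'
  · intro τ _ h'
    refine PassInv.congr h' fun _ w hw => ?_
    rw [downSet, if_pos (h.ord.surj hw)]

/-- Computing the lists of all nodes. -/
def passProg : Prog := passInit ;; entPass ;; downPass

/-- The running time of `passProg`. -/
def passCost (n m cap : ℕ) : ℕ := ((nset 51 (.lit 0)).wc + (m + 1) *
  ((Prog.storeN 19 (nv 40) (.lit 0)).wc + eM.cost + 20)) +
  ((4 * n + 1) * (entPassBody.wc + (NExp.mul (.lit 4) (.load 0 (.lit 0))).cost + 20) +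
    (m + 1) * (downCost cap + eM.cost + 20))

theorem passProg_wp {cap : ℕ} {R : Finset ℕ} (h : PassPre T n sg cap R σ) :
    WP ω passProg (passCost n T.m cap) σ fun τ =>
      (τ.nat 51 0 ≠ 0 → ∃ v < T.m, cap < (longSet T sg R v).card) ∧
      (τ.nat 51 0 = 0 → ∀ v < T.m, τ.nat 19 v = (longSet T sg R v).card) ∧
      ∀ v < T.m, τ.nat 19 v ≤ cap := by
  refine WP.comp (passInit_wp h) fun σ₁ ha₁ h₁ => ?_
  refine WP.comp (entPass_wp (h.agrees rfl rfl ha₁) h₁) fun σ₂ ha₂ h₂ => ?_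
  refine (downPass_wp ((h.agrees rfl rfl ha₁).agrees rfl rfl ha₂) h₂).mono le_rfl fun τ _ hτ => ?_
  exact ⟨hτ.overflow, fun ho v hv => (hτ.ok ho v hv).1, hτ.le⟩

end Congestion

-- The complete algorithm: preparation, sampling rounds, running time.

namespace RealRAM

@[simp] theorem run_flip (ω : ℕ → Bool) (σ : State) (a : ℕ) (i : NExp) :
    Prog.run ω (.flip a i) σ =
      { σ.setNat a (i.eval σ) (if ω σ.coins then 1 else 0) with coins := σ.coins + 1 } := rfl

end RealRAM

namespace Congestion

open RealRAM
variable {T : NodeTree} {n : ℕ} {sg : ℕ → Segment} {σ τ : State} {ω : ℕ → Bool}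

/-! ## Preprocessing -/

/-- The number of segments. -/
def eN : NExp := .load 0 (.lit 0)

/-- The number of bits of `n + m`. -/
def bits (n m : ℕ) : ℕ := Nat.log 2 (n + m) + 1

/-- One step of the computation of `bits n m`. -/
def bitsBody : Prog :=
  when (.ltN (nv 60) (.add (.add eN eM) (.lit 1)))
    (nset 60 (.mul (.lit 2) (nv 60)) ;; nset 15 (.add (nv 15) (.lit 1)))

/-- Computing `bits n m` in array 15. -/
def bitsProg : Prog := (nset 15 (.lit 1) ;; nset 60 (.lit 2)) ;; forTo 61 (.add eN eM) bitsBody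

/-- The loop makes n + m iterations, which is affordable, and idles once the power of two exceeds n
+ m. The minimum in the invariant shows that this happens in time, since doubling gains at least one
per iteration. -/
theorem bitsProg_wp (h : Inp T n sg σ) :
    WP ω bitsProg ((nset 15 (.lit 1) ;; nset 60 (.lit 2)).wc + (n + T.m + 1) *
      (bitsBody.wc + (NExp.add eN eM).cost + 20)) σ fun τ => τ.nat 15 0 = bits n T.m := by
  refine WP.comp (R := fun τ => τ.nat 15 0 = 1 ∧ τ.nat 60 0 = 2) (WP.run rfl (by simp [NExp.eval])) ?_
  rintro σ₁ ha₁ ⟨h15, h60⟩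
  have h₁ := h.agrees rfl ha₁
  have hm := T.root_lt
  refine (WP.forTo (I := fun k τ => 1 ≤ τ.nat 15 0 ∧ τ.nat 60 0 = 2 ^ τ.nat 15 0 ∧
    2 ^ (τ.nat 15 0 - 1) ≤ n + T.m ∧ min (k + 2) (n + T.m + 1) ≤ τ.nat 60 0) (N := n + T.m)
    rfl ?_ ?_ ?_).mono le_rfl ?_
  · intro τ ha; simp [eM, eN, NExp.eval, (h₁.agrees rfl ha).m, (h₁.agrees rfl ha).n]
  · simp only [State.setNat_nat, Nat.reduceEqDiff, if_false, h15, h60]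
    refine ⟨le_rfl, rfl, ?_, ?_⟩ <;> simp; omega
  · rintro k τ hk ha hkv ⟨h1, h2, h3, h4⟩
    have hi := h₁.agrees rfl ha
    refine WP.run rfl ?_
    simp only [bitsBody, run_when, run_seq, run_nset, BExp.Holds, NExp.eval, nv_eval, eN, eM, hi.n,
      hi.m]
    obtain ⟨l, hl⟩ := Nat.exists_eq_add_of_le' h1
    split_ifs with hc
    · simp [hl, h2] at hc ⊢
      rw [hl] at h2
      refine ⟨by ring, by omega, by omega⟩
    · simp only [State.setNat_nat, Nat.reduceEqDiff, if_false]
      exact ⟨h1, h2, h3, by omega⟩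
  · rintro τ - ⟨h1, h2, h3, h4⟩
    obtain ⟨l, hl⟩ := Nat.exists_eq_add_of_le' h1
    rw [hl] at h2 h3
    rw [hl, bits, (Nat.log_eq_iff (m := l) (by omega)).2 ⟨h3, by omega⟩]

/-- Marking all segments as kept, and testing whether a segment is not degenerate. -/
def markBody : Prog := .storeN 18 (nv 41) (.lit 1) ;; when (.ltR (.lit 0) lenE) (rset 7 (.lit 1))

/-- Marking all segments as kept, and testing whether a segment is not degenerate. -/
def markProg : Prog := forTo 41 eN markBody

open Classical in
/-- A lower bound for the congestion: `1` if a segment is not degenerate. -/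
noncomputable def baseValue (n : ℕ) (sg : ℕ → Segment) : ℝ :=
  if ∃ s < n, 0 < (sg s).len then 1 else 0

theorem lenE_eval (h : Inp T n sg σ) : lenE.eval σ = (sg (σ.nat 41 0)).len := by
  rw [Segment.len_eq]
  simp [lenE, RExp.eval, eS, h.px, h.py, h.qx, h.qy]

theorem markProg_wp (h : Inp T n sg σ) (h7 : σ.real 7 0 = 0) :
    WP ω markProg ((n + 1) * (markBody.wc + eN.cost + 20)) σ fun τ =>
      (∀ s < n, τ.nat 18 s = 1) ∧ τ.real 7 0 = baseValue n sg := by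
  refine WP.forTo (I := fun k τ => (∀ s < k, τ.nat 18 s = 1) ∧ τ.real 7 0 = baseValue k sg)
    (N := n) rfl ?_ ?_ ?_
  · intro τ ha; simp [eN, NExp.eval, (h.agrees rfl ha).n]
  · simp [baseValue, h7]
  · rintro k τ hk ha hkv ⟨h1, h2⟩
    have hi := h.agrees rfl ha
    refine WP.run rfl ?_
    have hl : lenE.eval (τ.setNat 18 k 1) = (sg k).len := by
      rw [lenE_eval (hi.agrees (P := markProg) rfl (State.agrees_setNat _ 18 k 1 _ rfl))]
      simp [hkv]
    simp only [markBody, run_seq, run_storeN, run_when, BExp.Holds, RExp.eval, nv_eval, hkv,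
      NExp.eval, hl, run_rset]
    have hup : ∀ s < k + 1, Function.update (τ.nat 18) k 1 s = 1 := fun s hs => by
      by_cases hsk : s = k
      · rw [hsk, Function.update_self]
      · rw [Function.update_of_ne hsk]; exact h1 s (by omega)
    split_ifs with hc
    · refine ⟨by simpa using hup, ?_⟩
      rw [baseValue, if_pos ⟨k, by omega, by exact_mod_cast hc⟩]
      simp
    · refine ⟨by simpa using hup, ?_⟩
      simp only [State.setNat_real, h2, baseValue]
      congr 1
      rw [eq_iff_iff]
      constructor
      · rintro ⟨s, hs, hpos⟩; exact ⟨s, by omega, hpos⟩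
      · rintro ⟨s, hs, hpos⟩
        refine ⟨s, lt_of_le_of_ne (by omega) ?_, hpos⟩
        rintro rfl
        exact hc (by exact_mod_cast hpos)

/-- Computing the tables that are used for point location. -/
def tableProg : Prog := childProg ;; bfsProg ;; sizeProg ;; heavyProg ;; jumpProg

/-- The running time of `tableProg`. -/
def tableCost (m L : ℕ) : ℕ := (m + 1) * (childBody.wc + eM.cost + 20) +
  ((8 + (4 * m + 1) * (bfsBody.wc + (NExp.mul (.lit 4) eM).cost + 20)) +
  (((m + 1) * (sizeInit.wc + eM.cost + 20) +
      (m - 1 + 1) * (sizeBody.wc + (NExp.sub eM (.lit 1)).cost + 20)) +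
  (((m + 1 + 1) * (heavyInit.wc + (NExp.add eM (.lit 1)).cost + 20) +
      (m + 1) * (heavyBody.wc + eM.cost + 20)) +
  (L * (m + 1) + 1) * (jumpBody.wc + jumpBound.cost + 20))))

theorem tableProg_wp {L : ℕ} (h : Inp T n sg σ) (hL : σ.nat 15 0 = L)
    (h10 : σ.nat 10 = fun _ => 0) (h12 : σ.nat 12 = fun _ => 0) :
    WP ω tableProg (tableCost T.m L) σ fun τ => TreeTab T L τ ∧ Order T (τ.nat 11) := by
  refine WP.comp (childProg_wp h h10) fun σ₁ a₁ hct => ?_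
  have i₁ := h.agrees rfl a₁
  refine WP.comp (bfsProg_wp i₁ hct) fun σ₂ a₂ ho => ?_
  have i₂ := i₁.agrees rfl a₂
  refine WP.comp (sizeProg_wp i₂ ho (by rw [a₂.nat 12 rfl, a₁.nat 12 rfl, h12])) fun σ₃ a₃ hs => ?_
  have i₃ := i₂.agrees rfl a₃
  refine WP.comp (heavyProg_wp i₃) fun σ₄ a₄ hh => ?_
  have i₄ := i₃.agrees rfl a₄
  have hL' : σ₄.nat 15 0 = L := by
    rw [a₄.nat 15 rfl, a₃.nat 15 rfl, a₂.nat 15 rfl, a₁.nat 15 rfl, hL]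
  refine (jumpProg_wp i₄ hL' hh).mono le_rfl fun τ a₅ hj => ?_
  obtain ⟨hv, h1, h2⟩ := hj
  refine ⟨⟨?_, ⟨_, hv, hs, h1, h2⟩, by rw [a₅.nat 15 rfl, hL']⟩, ?_⟩
  · rw [a₅.nat 10 rfl, a₄.nat 10 rfl, a₃.nat 10 rfl, a₂.nat 10 rfl]; exact hct
  · rw [a₅.nat 11 rfl, a₄.nat 11 rfl, a₃.nat 11 rfl]; exact ho

/-- The preprocessing. -/
def prepareProg (c₁ c₂ : ℕ) : Prog :=
  bitsProg ;; tableProg ;; squaresProg c₂ ;; markProg ;;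
    (nset 16 (.mul (.lit c₁) (nv 15)) ;; nset 62 (.lit 1))

/-- The running time of the preprocessing. -/
def prepareCost (c₁ c₂ n m L : ℕ) : ℕ :=
  ((nset 15 (.lit 1) ;; nset 60 (.lit 2)).wc + (n + m + 1) *
      (bitsBody.wc + (NExp.add eN eM).cost + 20)) +
  (tableCost m L + ((4 * n + 1) * (squareCost c₂ L +
      (NExp.mul (.lit 4) (.load 0 (.lit 0))).cost + 20) +
  ((n + 1) * (markBody.wc + eN.cost + 20) +
    (nset 16 (.mul (.lit c₁) (nv 15)) ;; nset 62 (.lit 1)).wc)))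

/-- The memory at the beginning: the input, and zero wherever this matters. -/
structure Start (T : NodeTree) (n : ℕ) (sg : ℕ → Segment) (σ : State) : Prop where
  inp : Inp T n sg σ
  nat : ∀ a, 2 ≤ a → σ.nat a = fun _ => 0
  real : ∀ a, 7 ≤ a → σ.real a = fun _ => 0
  coins : σ.coins = 0

/-- The memory after the preprocessing. -/
structure Prepared (T : NodeTree) (n : ℕ) (sg : ℕ → Segment) (c₁ c₂ : ℕ) (σ : State) : Prop where
  inp : Inp T n sg σ
  ord : Order T (σ.nat 11)
  ent : EntriesSpec T n sg (bits n T.m + c₂) (σ.nat 14) (σ.real 10)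
  L : σ.nat 15 0 = bits n T.m
  cap : σ.nat 16 0 = c₁ * bits n T.m
  keep : ∀ s < n, σ.nat 18 s = 1
  base : σ.real 7 0 = baseValue n sg
  scale : σ.nat 62 0 = 1
  found : σ.nat 63 0 = 0
  coins : σ.coins = 0

theorem lt_two_pow_bits (n m : ℕ) : n + m < 2 ^ bits n m := Nat.lt_pow_succ_log_self (by omega) _

theorem prepareProg_wp {c₁ c₂ : ℕ} (h : Start T n sg σ) :
    WP ω (prepareProg c₁ c₂) (prepareCost c₁ c₂ n T.m (bits n T.m)) σ
      (Prepared T n sg c₁ c₂) := by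
  refine WP.comp (bitsProg_wp h.inp) fun σ₁ a₁ hL₁ => ?_
  have i₁ := h.inp.agrees rfl a₁
  refine WP.comp (tableProg_wp i₁ hL₁ (by rw [a₁.nat 10 rfl, h.nat 10 (by omega)])
    (by rw [a₁.nat 12 rfl, h.nat 12 (by omega)])) fun σ₂ a₂ h₂ => ?_
  obtain ⟨ht, ho⟩ := h₂
  have i₂ := i₁.agrees rfl a₂
  refine WP.comp (squaresProg_wp (c₂ := c₂) i₂ ht ((Nat.le_add_left _ _).trans_lt
    (lt_two_pow_bits n T.m)) (by rw [a₂.nat 14 rfl, a₁.nat 14 rfl, h.nat 14 (by omega)])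
    (by rw [a₂.nat 17 rfl, a₁.nat 17 rfl, h.nat 17 (by omega)])
    (by rw [a₂.real 10 rfl, a₁.real 10 rfl, h.real 10 (by omega)])) fun σ₃ a₃ he => ?_
  have i₃ := i₂.agrees rfl a₃
  refine WP.comp (markProg_wp i₃ (by rw [a₃.real 7 rfl, a₂.real 7 rfl, a₁.real 7 rfl,
    h.real 7 (by omega)])) fun σ₄ a₄ h₄ => ?_
  have i₄ := i₃.agrees rfl a₄
  have hL₄ : σ₄.nat 15 0 = bits n T.m := by rw [a₄.nat 15 rfl, a₃.nat 15 rfl, ht.L]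
  refine (WP.run (R := fun τ => τ.nat 16 0 = c₁ * bits n T.m ∧ τ.nat 62 0 = 1) rfl
    (by simp [NExp.eval, hL₄])).mono le_rfl fun τ a₅ h₅ => ?_
  refine ⟨i₄.agrees rfl a₅, ?_, ?_, by rw [a₅.nat 15 rfl, hL₄], h₅.1, ?_, ?_, h₅.2, ?_, ?_⟩
  · rw [a₅.nat 11 rfl, a₄.nat 11 rfl, a₃.nat 11 rfl]; exact ho
  · rw [a₅.nat 14 rfl, a₄.nat 14 rfl, a₅.real 10 rfl, a₄.real 10 rfl]; exact he
  · rw [a₅.nat 18 rfl]; exact h₄.1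
  · rw [a₅.real 7 rfl]; exact h₄.2
  · rw [a₅.nat 63 rfl, a₄.nat 63 rfl, a₃.nat 63 rfl, a₂.nat 63 rfl, a₁.nat 63 rfl,
      h.nat 63 (by omega)]
  · rw [a₅.coins rfl, a₄.coins rfl, a₃.coins rfl, a₂.coins rfl, a₁.coins rfl, h.coins]

end Congestion

namespace Congestion

open RealRAM
variable {T : NodeTree} {n : ℕ} {sg : ℕ → Segment} {σ τ : State} {ω : ℕ → Bool}

/-! ## Sampling -/

/-- The segments that survive `i` rounds of thinning. -/
def keepSet (n : ℕ) (ω : ℕ → Bool) (i : ℕ) : Finset ℕ :=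
  (Finset.range n).filter fun s => ∀ j < i, ω (j * n + s) = true

/-- The number of long segments at `v` that survive `i` rounds of thinning. -/
noncomputable def longCount (T : NodeTree) (n : ℕ) (sg : ℕ → Segment) (ω : ℕ → Bool) (i v : ℕ) :
    ℕ := (longSet T sg (keepSet n ω i) v).card

/-- The estimate for the congestion of the cell of `v` after `i` rounds of thinning. -/
noncomputable def estimate (T : NodeTree) (n : ℕ) (sg : ℕ → Segment) (ω : ℕ → Bool) (k : ℕ)
    (A : ℕ → ℝ) (i v : ℕ) : ℝ :=
  k / (2 * (k + 1)) * (A v / (T.D v / 2) + 2 ^ i * longCount T n sg ω i v)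

/-- One step of thinning. -/
def thinBody : Prog :=
  .flip 61 (.lit 0) ;; .storeN 18 (nv 64) (.mul (.load 18 (nv 64)) (nv 61))

/-- Thinning the kept segments. -/
def thinProg : Prog := forTo 64 eN thinBody

theorem keepSet_succ (i s : ℕ) :
    s ∈ keepSet n ω (i + 1) ↔ s ∈ keepSet n ω i ∧ ω (i * n + s) = true := by
  simp only [keepSet, Finset.mem_filter, and_assoc]
  refine and_congr_right fun _ => ⟨fun h => ⟨fun j hj => h j (by omega), h i (by omega)⟩, ?_⟩
  rintro ⟨h1, h2⟩ j hj
  rcases Nat.lt_succ_iff_lt_or_eq.1 hj with hj | rfl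
  · exact h1 j hj
  · exact h2

/-- The marks of the segments that survive `i` rounds of thinning. -/
def keepMark (n : ℕ) (ω : ℕ → Bool) (i s : ℕ) : ℕ := if s ∈ keepSet n ω i then 1 else 0

theorem keepMark_succ (i s : ℕ) :
    keepMark n ω (i + 1) s = keepMark n ω i s * (if ω (i * n + s) then 1 else 0) := by
  have := keepSet_succ (n := n) (ω := ω) i s
  unfold keepMark
  by_cases h1 : s ∈ keepSet n ω i <;> by_cases h2 : ω (i * n + s) = true <;> simp [this, h1, h2]

/-- A coin is flipped for every segment, even for discarded ones, and thinning continues after a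
success. Thus coin `i * n + s` always belongs to round `i` and segment `s`, and the survivors are a
function of `ω` independent of the course of the computation. -/
theorem thinProg_wp {i : ℕ} (h : Inp T n sg σ) (hk : ∀ s < n, σ.nat 18 s = keepMark n ω i s)
    (hc : σ.coins = i * n) :
    WP ω thinProg ((n + 1) * (thinBody.wc + eN.cost + 20)) σ fun τ =>
      (∀ s < n, τ.nat 18 s = keepMark n ω (i + 1) s) ∧ τ.coins = (i + 1) * n := by
  refine (WP.forTo (I := fun k τ => τ.coins = i * n + k ∧
    ∀ s < n, τ.nat 18 s = keepMark n ω (if s < k then i + 1 else i) s) (N := n) rfl ?_ ?_ ?_).mono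
    le_rfl ?_
  · intro τ ha; simp [eN, NExp.eval, (h.agrees rfl ha).n]
  · simpa [hc] using hk
  · rintro k τ hkn ha hkv ⟨h1, h2⟩
    refine WP.run rfl ?_
    simp only [thinBody, run_seq, run_flip, run_storeN, NExp.eval, nv_eval]
    refine ⟨by simp [h1]; ring, fun s hs => ?_⟩
    simp only [State.setNat_nat, Nat.reduceEqDiff, if_false, if_true, hkv]
    by_cases hsk : s = k
    · subst hsk
      rw [Function.update_self, Function.update_self, h1, h2 s hs, if_neg (lt_irrefl s),
        if_pos (Nat.lt_succ_self s), keepMark_succ]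
    · rw [Function.update_of_ne hsk, h2 s hs]
      congr 1
      have : s < k ↔ s < k + 1 := by omega
      simp [this]
  · rintro τ - ⟨h1, h2⟩
    exact ⟨fun s hs => by rw [h2 s hs, if_pos hs], by rw [h1]; ring⟩

/-- The estimate for the node in array 40. -/
def estE (k : ℕ) : RExp :=
  .mul (.div (.lit k) (.lit (2 * (k + 1)))) (.add (.div (.load 10 (nv 40))
    (.div (.load 6 (nv 40)) (.lit 2))) (.ofNat (.mul (nv 62) (.load 19 (nv 40)))))

/-- Updating the output by the estimate for the node in array 40. -/
def bestBody (k : ℕ) : Prog := when (.ltR (rv 7) (estE k)) (rset 7 (estE k))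

/-- Updating the output by the estimates for all nodes. -/
def bestProg (k : ℕ) : Prog := forTo 40 eM (bestBody k)

/-- `x` is the maximum of `b` and the values `f 0`, …, `f (m - 1)`. -/
structure IsMax (b : ℝ) (f : ℕ → ℝ) (m : ℕ) (x : ℝ) : Prop where
  base : b ≤ x
  le : ∀ v < m, f v ≤ x
  attained : x = b ∨ ∃ v < m, x = f v

theorem bestProg_wp {k i : ℕ} (h : Inp T n sg σ) (hs : σ.nat 62 0 = 2 ^ i)
    (hcnt : ∀ v < T.m, σ.nat 19 v = longCount T n sg ω i v) :
    WP ω (bestProg k) ((T.m + 1) * ((bestBody k).wc + eM.cost + 20)) σ fun τ =>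
      IsMax (σ.real 7 0) (estimate T n sg ω k (σ.real 10) i) T.m (τ.real 7 0) := by
  refine WP.forTo (I := fun t τ => IsMax (σ.real 7 0) (estimate T n sg ω k (σ.real 10) i) t
    (τ.real 7 0)) (N := T.m) rfl ?_ ?_ ?_
  · intro τ ha; simp [eM, NExp.eval, (h.agrees rfl ha).m]
  · exact ⟨le_rfl, by simp, .inl rfl⟩
  · intro t τ ht ha htv hm
    have hi := h.agrees rfl ha
    refine WP.run rfl ?_
    have hE : (estE k).eval τ = estimate T n sg ω k (σ.real 10) i t := by
      simp only [estE, RExp.eval, NExp.eval, nv_eval, htv, ha.nat 62 rfl, hs, ha.nat 19 rfl,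
        hcnt t ht, ha.real 10 rfl, hi.D, estimate]
      push_cast; rfl
    simp only [bestBody, run_when, run_rset, BExp.Holds, rv_eval, hE, State.setNat_real]
    split_ifs with hc
    · simp only [State.setReal_real, if_true, Function.update_self]
      refine ⟨hm.base.trans hc.le, fun v hv => ?_, .inr ⟨t, by omega, rfl⟩⟩
      rcases Nat.lt_succ_iff_lt_or_eq.1 hv with hv | rfl
      · exact (hm.le v hv).trans hc.le
      · exact le_rfl
    · refine ⟨hm.base, fun v hv => ?_, hm.attained.imp_right ?_⟩
      · rcases Nat.lt_succ_iff_lt_or_eq.1 hv with hv | rfl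
        · exact hm.le v hv
        · exact not_lt.1 hc
      · rintro ⟨v, hv, he⟩; exact ⟨v, by omega, he⟩

/-- One attempt to determine the output from the kept segments. -/
def attemptProg (k : ℕ) : Prog :=
  passProg ;; when (.not (.ltN (.lit 0) (nv 51))) (nset 63 (.lit 1) ;; bestProg k)

/-- One round: an attempt unless an earlier one was successful, and thinning. -/
def roundsBody (k : ℕ) : Prog :=
  when (.not (.ltN (.lit 0) (nv 63))) (attemptProg k) ;; thinProg ;; nset 62 (.mul (.lit 2) (nv 62))

/-- All rounds. -/
def roundsProg (k : ℕ) : Prog := forTo 65 (.add (nv 15) (.lit 1)) (roundsBody k)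

/-- The running time of one round. -/
def roundsCost (k n m cap : ℕ) : ℕ :=
  ((BExp.not (.ltN (.lit 0) (nv 63))).cost + ((passCost n m cap +
    ((BExp.not (.ltN (.lit 0) (nv 51))).cost + (((nset 63 (.lit 1)).wc +
      (m + 1) * ((bestBody k).wc + eM.cost + 20)) + 1))) + 1)) +
  ((n + 1) * (thinBody.wc + eN.cost + 20) + (nset 62 (.mul (.lit 2) (nv 62))).wc)

/-- The state of the search for the output `x` after `i` rounds. -/
inductive Found (T : NodeTree) (n : ℕ) (sg : ℕ → Segment) (ω : ℕ → Bool) (k cap : ℕ) (A : ℕ → ℝ)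
    (i : ℕ) (done : ℕ) (x : ℝ) : Prop
  | no (hd : done = 0) (hx : x = baseValue n sg)
      (h : ∀ j < i, ∃ v < T.m, cap < longCount T n sg ω j v)
  | yes (hd : 0 < done) (j : ℕ) (hj : j < i)
      (h : ∀ j' < j, ∃ v < T.m, cap < longCount T n sg ω j' v)
      (hle : ∀ v < T.m, longCount T n sg ω j v ≤ cap)
      (hx : IsMax (baseValue n sg) (estimate T n sg ω k A j) T.m x)

/-- The invariant of the rounds. -/
structure RoundInv (T : NodeTree) (n : ℕ) (sg : ℕ → Segment) (ω : ℕ → Bool) (k cap : ℕ)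
    (A : ℕ → ℝ) (i : ℕ) (σ : State) : Prop where
  keep : ∀ s < n, σ.nat 18 s = keepMark n ω i s
  scale : σ.nat 62 0 = 2 ^ i
  coins : σ.coins = i * n
  found : Found T n sg ω k cap A i (σ.nat 63 0) (σ.real 7 0)

theorem attemptProg_wp {k cap i : ℕ} {A : ℕ → ℝ} (h : Inp T n sg σ) (ho : Order T (σ.nat 11))
    (he : ∀ e v, e < 4 * n → (σ.nat 14 e = v + 1 ↔ RegEnt T sg e v)) (hA : σ.real 10 = A)
    (hcap : σ.nat 16 0 = cap) (hinv : RoundInv T n sg ω k cap A i σ) (h63 : σ.nat 63 0 = 0) :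
    WP ω (attemptProg k) (passCost n T.m cap + ((BExp.not (.ltN (.lit 0) (nv 51))).cost +
      (((nset 63 (.lit 1)).wc + (T.m + 1) * ((bestBody k).wc + eM.cost + 20)) + 1))) σ fun τ =>
      Found T n sg ω k cap A (i + 1) (τ.nat 63 0) (τ.real 7 0) := by
  obtain ⟨hx, hov⟩ : σ.real 7 0 = baseValue n sg ∧ ∀ j < i, ∃ v < T.m, cap < longCount T n sg ω j v := by
    rcases hinv.found with ⟨-, hx, h⟩ | ⟨hd, -⟩
    · exact ⟨hx, h⟩
    · omega
  have hpre : PassPre T n sg cap (keepSet n ω i) σ := by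
    refine ⟨h, ho, he, fun s hs => ?_, fun s hs => ?_, hcap⟩
    · rw [hinv.keep s hs, keepMark]; split_ifs with hm <;> simp [hm]
    · exact Finset.mem_range.1 (Finset.mem_filter.1 hs).1
  refine WP.comp (passProg_wp hpre) fun σ₁ a₁ h₁ => ?_
  obtain ⟨hp1, hp2, hp3⟩ := h₁
  have e63 : σ₁.nat 63 0 = 0 := by rw [a₁.nat 63 rfl, h63]
  have e7 : σ₁.real 7 0 = baseValue n sg := by rw [a₁.real 7 rfl, hx]
  refine WP.when (fun hb => ?_) (fun hb => ?_)
  · simp only [BExp.Holds, NExp.eval, nv_eval, not_lt, Nat.le_zero] at hb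
    have hcnt := hp2 hb
    refine WP.comp (R := fun τ => τ.nat 63 0 = 1) (WP.run rfl (by simp [NExp.eval])) ?_
    intro σ₂ a₂ h₂
    refine (bestProg_wp (i := i) ((h.agrees rfl a₁).agrees rfl a₂)
      (by rw [a₂.nat 62 rfl, a₁.nat 62 rfl, hinv.scale])
      (by rw [a₂.nat 19 rfl]; exact hcnt)).mono le_rfl fun τ a₃ h₃ => ?_
    rw [a₂.real 7 rfl, e7, a₂.real 10 rfl, a₁.real 10 rfl, hA] at h₃
    refine .yes (by rw [a₃.nat 63 rfl, h₂]; omega) i (by omega) hov (fun v hv => ?_) h₃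
    exact (hcnt v hv).symm.trans_le (hp3 v hv)
  · simp only [BExp.Holds, NExp.eval, nv_eval, not_not] at hb
    refine .no e63 e7 fun j hj => ?_
    rcases Nat.lt_succ_iff_lt_or_eq.1 hj with hj | rfl
    · exact hov j hj
    · exact hp1 hb.ne'

theorem roundsProg_wp {k cap L : ℕ} {A : ℕ → ℝ} (h : Inp T n sg σ) (ho : Order T (σ.nat 11))
    (he : ∀ e v, e < 4 * n → (σ.nat 14 e = v + 1 ↔ RegEnt T sg e v)) (hA : σ.real 10 = A)
    (hcap : σ.nat 16 0 = cap) (hL : σ.nat 15 0 = L) (hinv : RoundInv T n sg ω k cap A 0 σ) :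
    WP ω (roundsProg k) ((L + 1 + 1) * (roundsCost k n T.m cap +
      (NExp.add (nv 15) (.lit 1)).cost + 20)) σ fun τ =>
      Found T n sg ω k cap A (L + 1) (τ.nat 63 0) (τ.real 7 0) := by
  refine (WP.forTo (I := RoundInv T n sg ω k cap A) (N := L + 1) rfl ?_ ?_ ?_).mono le_rfl
    fun τ _ h => h.found
  · intro τ ha; simp [NExp.eval, ha.nat 15 rfl, hL]
  · exact ⟨hinv.keep, hinv.scale, hinv.coins, hinv.found⟩
  · intro i τ hi ha hiv hinv
    have h₀ := h.agrees rfl ha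
    refine WP.comp (R := fun τ => Found T n sg ω k cap A (i + 1) (τ.nat 63 0) (τ.real 7 0)) ?_ ?_
    · refine WP.when (fun hb => ?_) (fun hb => ?_)
      · simp only [BExp.Holds, NExp.eval, nv_eval, not_lt, Nat.le_zero] at hb
        exact attemptProg_wp h₀ (by rw [ha.nat 11 rfl]; exact ho) (by rw [ha.nat 14 rfl]; exact he)
          (by rw [ha.real 10 rfl, hA]) (by rw [ha.nat 16 rfl, hcap]) hinv hb
      · simp only [BExp.Holds, NExp.eval, nv_eval, not_not] at hb
        rcases hinv.found with ⟨hd, -⟩ | ⟨hd, j, hj, h1, h2, h3⟩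
        · omega
        · exact .yes hd j (by omega) h1 h2 h3
    intro σ₁ a₁ hf
    refine WP.comp (thinProg_wp (i := i) (h₀.agrees rfl a₁) (by rw [a₁.nat 18 rfl]; exact hinv.keep)
      (by rw [a₁.coins rfl, hinv.coins])) fun σ₂ a₂ h₂ => ?_
    refine WP.run rfl ?_
    simp only [run_nset, NExp.eval, nv_eval]
    refine ⟨by simpa using h₂.1, ?_, h₂.2, ?_⟩
    · simp [a₂.nat 62 rfl, a₁.nat 62 rfl, hinv.scale]; ring
    · simpa [a₂.nat 63 rfl, a₂.real 7 rfl] using hf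

/-- The algorithm. -/
def mainProg (k c₁ c₂ : ℕ) : Prog := prepareProg c₁ c₂ ;; roundsProg k

/-- The running time of the algorithm. -/
def mainCost (k c₁ c₂ n m L : ℕ) : ℕ := prepareCost c₁ c₂ n m L +
  (L + 1 + 1) * (roundsCost k n m (c₁ * L) + (NExp.add (nv 15) (.lit 1)).cost + 20)

theorem mainProg_wp {k c₁ c₂ : ℕ} (h : Start T n sg σ) :
    WP ω (mainProg k c₁ c₂) (mainCost k c₁ c₂ n T.m (bits n T.m)) σ fun τ =>
      ∃ ent A done, EntriesSpec T n sg (bits n T.m + c₂) ent A ∧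
        Found T n sg ω k (c₁ * bits n T.m) A (bits n T.m + 1) done (τ.real 7 0) := by
  refine WP.comp (prepareProg_wp h) fun σ₁ a₁ h₁ => ?_
  refine (roundsProg_wp h₁.inp h₁.ord h₁.ent.ent rfl h₁.cap h₁.L ⟨fun s hs => ?_, h₁.scale, ?_,
    .no h₁.found h₁.base (by simp)⟩).mono le_rfl fun τ _ hτ => ⟨_, _, _, h₁.ent, hτ⟩
  · rw [h₁.keep s hs, keepMark, if_pos]
    simp [keepSet, hs]
  · rw [h₁.coins, zero_mul]

end Congestion

namespace Congestion

open RealRAM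

/-! ## The running time -/

/-- The function `f` of `n`, `m` and `L` is bounded by a multiple of `(n + m) ^ a * L ^ b`. -/
def Bounded (a b : ℕ) (f : ℕ → ℕ → ℕ → ℕ) : Prop :=
  ∃ C, ∀ n m L, 1 ≤ m → 1 ≤ L → f n m L ≤ C * ((n + m) ^ a * L ^ b)

theorem Bounded.mono {a b a' b' : ℕ} {f : ℕ → ℕ → ℕ → ℕ} (h : Bounded a b f) (ha : a ≤ a')
    (hb : b ≤ b') : Bounded a' b' f := by
  obtain ⟨C, hC⟩ := h
  refine ⟨C, fun n m L hm hL => (hC n m L hm hL).trans ?_⟩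
  gcongr
  omega

theorem Bounded.add {a b : ℕ} {f g : ℕ → ℕ → ℕ → ℕ} (hf : Bounded a b f) (hg : Bounded a b g) :
    Bounded a b fun n m L => f n m L + g n m L := by
  obtain ⟨C, hC⟩ := hf
  obtain ⟨D, hD⟩ := hg
  refine ⟨C + D, fun n m L hm hL => ?_⟩
  rw [add_mul]
  exact add_le_add (hC n m L hm hL) (hD n m L hm hL)

theorem Bounded.mul {a b a' b' : ℕ} {f g : ℕ → ℕ → ℕ → ℕ} (hf : Bounded a b f)
    (hg : Bounded a' b' g) : Bounded (a + a') (b + b') fun n m L => f n m L * g n m L := by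
  obtain ⟨C, hC⟩ := hf
  obtain ⟨D, hD⟩ := hg
  refine ⟨C * D, fun n m L hm hL => ?_⟩
  calc _ ≤ C * ((n + m) ^ a * L ^ b) * (D * ((n + m) ^ a' * L ^ b')) :=
        Nat.mul_le_mul (hC n m L hm hL) (hD n m L hm hL)
    _ = _ := by ring

theorem Bounded.const (c : ℕ) : Bounded 0 0 fun _ _ _ => c := ⟨c, by simp⟩

theorem Bounded.constAt (a b c : ℕ) : Bounded a b fun _ _ _ => c :=
  (Bounded.const c).mono (Nat.zero_le _) (Nat.zero_le _)

theorem bounded_n : Bounded 1 0 fun n _ _ => n := ⟨1, by intros; simp⟩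
theorem bounded_m : Bounded 1 0 fun _ m _ => m := ⟨1, by intros; simp⟩
theorem bounded_L : Bounded 0 1 fun _ _ L => L := ⟨1, by intros; simp⟩

theorem bounded_n_add (c : ℕ) : Bounded 1 0 fun n _ _ => n + c := bounded_n.add (.constAt _ _ _)
theorem bounded_m_add (c : ℕ) : Bounded 1 0 fun _ m _ => m + c := bounded_m.add (.constAt _ _ _)
theorem bounded_L_add (c : ℕ) : Bounded 0 1 fun _ _ L => L + c := bounded_L.add (.constAt _ _ _)

theorem bounded_mul_n_add (a c : ℕ) : Bounded 1 0 fun n _ _ => a * n + c :=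
  (((Bounded.const a).mul bounded_n).mono (by simp) (by simp)).add (.constAt _ _ _)

theorem bounded_searchCost : Bounded 0 2 fun _ _ L => searchCost L := by
  have h : Bounded 0 1 fun _ _ L => roundCost L :=
    .add ((bounded_L_add 2).mul (.const _)) (.constAt _ _ _)
  exact .add (.constAt _ _ _) ((bounded_L_add 2).mul
    ((h.add (.constAt _ _ _)).add (.constAt _ _ _)))

theorem bounded_squareCost (c₂ : ℕ) : Bounded 0 2 fun _ _ L => squareCost c₂ L := by
  have h : Bounded 0 2 fun _ _ L => locateCost c₂ L := by
    refine bounded_searchCost.add (.add (.constAt _ _ _) (.add (.constAt _ _ _) ?_))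
    exact (((bounded_L_add (c₂ + 1)).add (.constAt _ _ 1)).mul (.const _)).mono le_rfl (by simp)
  exact .add (.constAt _ _ _) (.add (.constAt _ _ _) (.add (.add (.constAt _ _ _)
    (.add (.constAt _ _ _) (.add (.constAt _ _ _) (.add (.constAt _ _ _)
      (h.add (.constAt _ _ _)))))) (.constAt _ _ _)))

theorem bounded_tableCost : Bounded 1 1 fun _ m L => tableCost m L := by
  have h1 : ∀ a b, Bounded 1 1 fun _ m _ => (m + a) * b := fun a b =>
    ((bounded_m_add a).mul (.const b)).mono (by simp) (by simp)
  have h2 : Bounded 1 0 fun _ m _ => m - 1 + 1 := ⟨1, by intros; simp; omega⟩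
  refine .add (h1 _ _) (.add (.add (.constAt _ _ _) ?_) (.add (.add (h1 _ _) ?_)
    (.add (.add ?_ (h1 _ _)) ?_)))
  · exact (((((Bounded.const 4).mul bounded_m).mono le_rfl le_rfl).add (.constAt _ _ 1)).mul
      (.const _)).mono (by simp) (by simp)
  · exact (h2.mul (.const _)).mono (by simp) (by simp)
  · exact ((((bounded_m_add 1).add (.constAt _ _ 1)).mul (.const _)).mono (by simp) (by simp))
  · exact ((((bounded_L.mul (bounded_m_add 1)).mono (a' := 1) (b' := 1) (by simp) (by simp)).add
      (.constAt _ _ 1)).mul (.const _)).mono (by simp) (by simp)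

theorem bounded_prepareCost (c₁ c₂ : ℕ) : Bounded 1 2 fun n m L => prepareCost c₁ c₂ n m L := by
  refine .add (.add (.constAt _ _ _) ?_) (.add (bounded_tableCost.mono le_rfl (by simp)) (.add ?_
    (.add ?_ (.constAt _ _ _))))
  · exact (((bounded_n.add bounded_m).add (.constAt _ _ 1)).mul (.const _)).mono (by simp) (by simp)
  · exact ((bounded_mul_n_add 4 1).mul (((bounded_squareCost c₂).add (.constAt _ _ _)).add
      (.constAt _ _ _))).mono (by simp) (by simp)
  · exact ((bounded_n_add 1).mul (.const _)).mono (by simp) (by simp)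

theorem bounded_downCost (c₁ : ℕ) : Bounded 0 1 fun _ _ L => downCost (c₁ * L) := by
  have h : Bounded 0 1 fun _ _ L => c₁ * L + 1 :=
    (((Bounded.const c₁).mul bounded_L).mono (by simp) (by simp)).add (.constAt _ _ _)
  exact .add (.constAt _ _ _) (.add (.constAt _ _ _) (.add (.add (.constAt _ _ _)
    (h.mul (.const _))) (.constAt _ _ _)))

theorem bounded_passCost (c₁ : ℕ) : Bounded 1 1 fun n m L => passCost n m (c₁ * L) := by
  refine .add (.add (.constAt _ _ _) ?_) (.add ?_ ?_)
  · exact ((bounded_m_add 1).mul (.const _)).mono (by simp) (by simp)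
  · exact ((bounded_mul_n_add 4 1).mul (.const _)).mono (by simp) (by simp)
  · exact ((bounded_m_add 1).mul (((bounded_downCost c₁).add (.constAt _ _ _)).add
      (.constAt _ _ _))).mono (by simp) (by simp)

/-- Two terms dominate: a search of cost O(L²) for each of the 4n grid squares, and L + 1 rounds
that each handle up to c₁·L list elements per node. -/
theorem bounded_mainCost (k c₁ c₂ : ℕ) : Bounded 1 2 fun n m L => mainCost k c₁ c₂ n m L := by
  have h : Bounded 1 1 fun n m L => roundsCost k n m (c₁ * L) := by
    refine .add (.add (.constAt _ _ _) (.add (.add (bounded_passCost c₁) (.add (.constAt _ _ _)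
      (.add (.add (.constAt _ _ _) ?_) (.constAt _ _ _)))) (.constAt _ _ _)))
      (.add ?_ (.constAt _ _ _))
    · exact ((bounded_m_add 1).mul (.const _)).mono (by simp) (by simp)
    · exact ((bounded_n_add 1).mul (.const _)).mono (by simp) (by simp)
  exact (bounded_prepareCost c₁ c₂).add (((bounded_L_add 2).mul ((h.add (.constAt _ _ _)).add
    (.constAt _ _ _))).mono (by simp) (by simp))

end Congestion

-- Probability: Chernoff bounds and accuracy of the sampled counts.

namespace RealRAM

open ProbabilityTheory

/-! ## Products of coins -/

instance : IsProbabilityMeasure coinMeasure := by unfold coinMeasure; infer_instance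

/-- The event that all coins in `B` show heads. -/
def allHeads (B : Finset ℕ) : Set (ℕ → Bool) := {ω | ∀ j ∈ B, ω j = true}

theorem allHeads_eq_pi (B : Finset ℕ) : allHeads B = Set.pi B fun _ => {true} := by
  ext ω; simp [allHeads, Set.mem_pi]

theorem measurableSet_allHeads (B : Finset ℕ) : MeasurableSet (allHeads B) := by
  rw [allHeads_eq_pi]
  exact MeasurableSet.pi B.countable_toSet fun _ _ => .singleton _

theorem coinMeasure_allHeads (B : Finset ℕ) : coinMeasure (allHeads B) = 2⁻¹ ^ B.card := by
  rw [allHeads_eq_pi, coinMeasure, Measure.infinitePi_pi _ fun _ _ => .singleton _]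
  simp

theorem iIndepSet_allHeads {B : ℕ → Finset ℕ} (hB : Pairwise fun s t => Disjoint (B s) (B t)) :
    iIndepSet (fun s => allHeads (B s)) coinMeasure := by
  classical
  rw [iIndepSet_iff_meas_biInter fun s => measurableSet_allHeads _]
  intro S
  have : ⋂ s ∈ S, allHeads (B s) = allHeads (S.biUnion B) := by
    ext ω
    simp only [allHeads, Set.mem_iInter, Set.mem_ofPred_eq, Finset.mem_biUnion]
    exact ⟨fun h j ⟨s, hs, hj⟩ => h s hs j hj, fun h s hs j hj => h j ⟨s, hs, hj⟩⟩
  simp only [this, coinMeasure_allHeads]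
  rw [Finset.card_biUnion fun s _ t _ hst => hB hst, Finset.prod_pow_eq_pow_sum]

theorem iIndepFun_allHeads {B : ℕ → Finset ℕ} (hB : Pairwise fun s t => Disjoint (B s) (B t)) :
    iIndepFun (fun s => (allHeads (B s)).indicator fun _ => (1 : ℝ)) coinMeasure :=
  (iIndepSet_allHeads hB).iIndepFun_indicator

theorem measurable_allHeads (B : Finset ℕ) :
    Measurable ((allHeads B).indicator fun _ => (1 : ℝ)) :=
  measurable_const.indicator (measurableSet_allHeads B)

theorem mgf_allHeads (B : Finset ℕ) (t : ℝ) :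
    mgf ((allHeads B).indicator fun _ => (1 : ℝ)) coinMeasure t =
      1 + (1 / 2) ^ B.card * (Real.exp t - 1) := by
  have h : (fun ω => Real.exp (t * (allHeads B).indicator (fun _ => (1 : ℝ)) ω)) =
      fun ω => 1 + (allHeads B).indicator (fun _ => Real.exp t - 1) ω := by
    funext ω
    by_cases hω : ω ∈ allHeads B <;> simp [hω]
  rw [mgf, h, integral_add (integrable_const _)
    ((integrable_const _).indicator (measurableSet_allHeads B)),
    integral_indicator_const _ (measurableSet_allHeads B), measureReal_def, coinMeasure_allHeads]
  simp

/-- The number of those `s` in `H` for which all coins in `B s` show heads. -/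
noncomputable def headCount (B : ℕ → Finset ℕ) (H : Finset ℕ) (ω : ℕ → Bool) : ℝ :=
  ∑ s ∈ H, (allHeads (B s)).indicator (fun _ => (1 : ℝ)) ω

variable {B : ℕ → Finset ℕ} {H : Finset ℕ} {i : ℕ}

/-- The summands are independent Bernoulli variables with parameter p = 2^(-i). Each factor obeys 1
+ p(e^t - 1) ≤ exp(p(t + t²)), using e^t - 1 ≤ t + t² for |t| ≤ 1. -/
theorem mgf_headCount_le (hB : Pairwise fun s t => Disjoint (B s) (B t))
    (hi : ∀ s ∈ H, (B s).card = i) {t : ℝ} (ht : |t| ≤ 1) :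
    mgf (headCount B H) coinMeasure t ≤ Real.exp ((1 / 2) ^ i * H.card * (t + t ^ 2)) := by
  have e : headCount B H = ∑ s ∈ H, (allHeads (B s)).indicator fun _ => (1 : ℝ) := by
    funext ω; simp [headCount]
  rw [e, (iIndepFun_allHeads hB).mgf_sum fun s => measurable_allHeads (B s)]
  have hb := abs_le.1 (Real.abs_exp_sub_one_sub_id_le ht)
  calc _ ≤ ∏ s ∈ H, Real.exp ((1 / 2) ^ i * (t + t ^ 2)) := by
        refine Finset.prod_le_prod (fun s _ => mgf_nonneg) fun s hs => ?_
        rw [mgf_allHeads, hi s hs]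
        have h2 : (1 / 2 : ℝ) ^ i * (Real.exp t - 1) ≤ (1 / 2) ^ i * (t + t ^ 2) :=
          mul_le_mul_of_nonneg_left (by linarith [hb.2]) (by positivity)
        linarith [Real.add_one_le_exp ((1 / 2 : ℝ) ^ i * (t + t ^ 2))]
    _ = _ := by
        rw [Finset.prod_const, ← Real.exp_nat_mul]; ring_nf

theorem integrable_exp_headCount (t : ℝ) :
    Integrable (fun ω => Real.exp (t * headCount B H ω)) coinMeasure := by
  have hm : Measurable (headCount B H) :=
    Finset.measurable_fun_sum _ fun s _ => measurable_allHeads (B s)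
  refine Integrable.of_bound (hm.const_mul t).exp.aestronglyMeasurable
    (Real.exp (|t| * H.card)) (.of_forall fun ω => ?_)
  rw [Real.norm_eq_abs, abs_of_pos (Real.exp_pos _), Real.exp_le_exp]
  refine (le_abs_self _).trans ?_
  rw [abs_mul]
  refine mul_le_mul_of_nonneg_left ?_ (abs_nonneg _)
  have h1 : ∀ s ∈ H, (0 : ℝ) ≤ (allHeads (B s)).indicator (fun _ => (1 : ℝ)) ω := fun s _ =>
    Set.indicator_nonneg (fun _ _ => zero_le_one) _
  rw [headCount, abs_of_nonneg (Finset.sum_nonneg h1)]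
  refine (Finset.sum_le_card_nsmul _ _ 1 fun s _ => ?_).trans (by simp)
  exact Set.indicator_le_self' (fun _ _ => zero_le_one) ω

/-- Markov's inequality for the exponential moment at t = e/2. The deviation is measured against an
upper bound `M` of the mean, not the mean itself; this allows one error scale for all nodes. -/
theorem headCount_ge_le (hB : Pairwise fun s t => Disjoint (B s) (B t))
    (hi : ∀ s ∈ H, (B s).card = i) {e M : ℝ} (he : 0 ≤ e) (he' : e ≤ 1)
    (hM : (1 / 2) ^ i * H.card ≤ M) :
    coinMeasure.real {ω | (1 / 2) ^ i * H.card + e * M ≤ headCount B H ω} ≤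
      Real.exp (-(e ^ 2 * M / 4)) := by
  have ht : |e / 2| ≤ 1 := by rw [abs_of_nonneg (by linarith)]; linarith
  refine (measure_ge_le_exp_mul_mgf _ (by linarith : (0 : ℝ) ≤ e / 2)
    (integrable_exp_headCount _)).trans ?_
  refine (mul_le_mul_of_nonneg_left (mgf_headCount_le hB hi ht) (Real.exp_pos _).le).trans ?_
  rw [← Real.exp_add, Real.exp_le_exp]
  nlinarith [mul_le_mul_of_nonneg_left hM (sq_nonneg e)]

theorem headCount_le_le (hB : Pairwise fun s t => Disjoint (B s) (B t))
    (hi : ∀ s ∈ H, (B s).card = i) {e M : ℝ} (he : 0 ≤ e) (he' : e ≤ 1)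
    (hM : (1 / 2) ^ i * H.card ≤ M) :
    coinMeasure.real {ω | headCount B H ω ≤ (1 / 2) ^ i * H.card - e * M} ≤
      Real.exp (-(e ^ 2 * M / 4)) := by
  have ht : |-(e / 2)| ≤ 1 := by rw [abs_neg, abs_of_nonneg (by linarith)]; linarith
  refine (measure_le_le_exp_mul_mgf _ (by linarith : -(e / 2) ≤ (0 : ℝ))
    (integrable_exp_headCount _)).trans ?_
  refine (mul_le_mul_of_nonneg_left (mgf_headCount_le hB hi ht) (Real.exp_pos _).le).trans ?_
  rw [← Real.exp_add, Real.exp_le_exp]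
  nlinarith [mul_le_mul_of_nonneg_left hM (sq_nonneg e)]

end RealRAM

namespace Congestion

open RealRAM
variable {T : NodeTree} {n : ℕ} {sg : ℕ → Segment} {ω : ℕ → Bool}

/-! ## Concentration of the counts -/

/-- The coins that decide whether segment `s` survives `i` rounds of thinning. -/
def coinBlock (n i s : ℕ) : Finset ℕ := if s < n then (Finset.range i).image fun j => j * n + s else ∅

theorem card_coinBlock {i s : ℕ} (hs : s < n) : (coinBlock n i s).card = i := by
  rw [coinBlock, if_pos hs, Finset.card_image_of_injective, Finset.card_range]
  intro a b h
  exact Nat.eq_of_mul_eq_mul_right (by omega) (Nat.add_right_cancel h)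

theorem disjoint_coinBlock (n i : ℕ) :
    Pairwise fun s t => Disjoint (coinBlock n i s) (coinBlock n i t) := by
  intro s t hst
  unfold coinBlock
  split_ifs with hs ht <;> try simp
  rw [Finset.disjoint_left]
  intro x hx hx'
  obtain ⟨a, -, rfl⟩ := Finset.mem_image.1 hx
  obtain ⟨b, -, h⟩ := Finset.mem_image.1 hx'
  refine hst ?_
  have := congrArg (· % n) h
  simpa [Nat.mul_add_mod', Nat.mod_eq_of_lt hs, Nat.mod_eq_of_lt ht] using this.symm

/-- The number of long segments at `v`. -/
noncomputable def fullCount (T : NodeTree) (n : ℕ) (sg : ℕ → Segment) (v : ℕ) : ℕ :=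
  (longSet T sg (Finset.range n) v).card

/-- A segment survives exactly if all coins of its block show heads, and the blocks are disjoint, so
the Chernoff bounds for `headCount` apply to the counts. -/
theorem longCount_eq (i v : ℕ) : (longCount T n sg ω i v : ℝ) =
    headCount (coinBlock n i) (longSet T sg (Finset.range n) v) ω := by
  classical
  have h : longSet T sg (keepSet n ω i) v =
      (longSet T sg (Finset.range n) v).filter fun s => ω ∈ allHeads (coinBlock n i s) := by
    ext s
    have hb : ω ∈ allHeads (coinBlock n i s) ↔ s < n → ∀ j < i, ω (j * n + s) = true := by
      by_cases hs : s < n <;> simp [allHeads, coinBlock, hs]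
    rw [Finset.mem_filter, hb]
    unfold longSet keepSet
    rw [Finset.mem_filter, Finset.mem_filter, Finset.mem_filter, Finset.mem_range]
    tauto
  rw [longCount, h, headCount, Finset.card_filter]
  push_cast
  exact Finset.sum_congr rfl fun s _ => by simp [Set.indicator_apply]

theorem longCount_zero (v : ℕ) : longCount T n sg ω 0 v = fullCount T n sg v := by
  rw [longCount, fullCount, keepSet, Finset.filter_true_of_mem (by simp)]

theorem fullCount_le (v : ℕ) : fullCount T n sg v ≤ n := by
  classical
  exact (Finset.card_filter_le _ _).trans (by simp)

/-- The largest number of long segments at a node. -/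
noncomputable def maxCount (T : NodeTree) (n : ℕ) (sg : ℕ → Segment) : ℕ :=
  (Finset.range T.m).sup (fullCount T n sg)

theorem fullCount_le_max {v : ℕ} (hv : v < T.m) : fullCount T n sg v ≤ maxCount T n sg :=
  Finset.le_sup (f := fullCount T n sg) (Finset.mem_range.2 hv)

theorem maxCount_le : maxCount T n sg ≤ n := Finset.sup_le fun v _ => fullCount_le v

/-- The counts at `v` after `i` rounds of thinning are as accurate as needed. -/
def Accurate (T : NodeTree) (n : ℕ) (sg : ℕ → Segment) (k cap i v : ℕ) (ω : ℕ → Bool) : Prop :=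
  ((cap : ℝ) / 4 ≤ (1 / 2) ^ i * maxCount T n sg →
    |(longCount T n sg ω i v : ℝ) - (1 / 2) ^ i * fullCount T n sg v| ≤
      1 / k * ((1 / 2) ^ i * maxCount T n sg)) ∧
  ((1 / 2) ^ i * (maxCount T n sg : ℝ) < cap / 2 → longCount T n sg ω i v ≤ cap)

/-- With p = 2^(-i): the two tails of the first property use e = 1/k and M = p·max ≥ cap/4, with
exponent at least cap/(16k²). The second property uses e = 1 and M = cap/2, since exceeding `cap`
means exceeding a mean of at most cap/2 by cap/2. -/
theorem not_accurate_le {k cap i v : ℕ} (hk : 1 ≤ k) (hv : v < T.m) :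
    coinMeasure.real {ω | ¬ Accurate T n sg k cap i v ω} ≤
      3 * Real.exp (-(cap / (16 * k ^ 2))) := by
  classical
  set p : ℝ := (1 / 2) ^ i with hp
  set H := longSet T sg (Finset.range n) v with hH
  have hp0 : 0 < p := by positivity
  have hB := disjoint_coinBlock n i
  have hi : ∀ s ∈ H, (coinBlock n i s).card = i := fun s hs =>
    card_coinBlock (Finset.mem_range.1 (Finset.mem_filter.1 hs).1)
  have hk0 : (0 : ℝ) < k := by exact_mod_cast hk
  have hk1 : (1 : ℝ) ≤ k := by exact_mod_cast hk
  have he1 : (1 : ℝ) / k ≤ 1 := by rw [div_le_one hk0]; exact hk1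
  have hM : p * H.card ≤ p * maxCount T n sg :=
    mul_le_mul_of_nonneg_left (by exact_mod_cast fullCount_le_max hv) hp0.le
  set E := Real.exp (-(cap / (16 * k ^ 2) : ℝ)) with hE
  have hE0 : 0 < E := Real.exp_pos _
  have ha : coinMeasure.real {ω | ¬ ((cap : ℝ) / 4 ≤ p * maxCount T n sg →
      |(longCount T n sg ω i v : ℝ) - p * fullCount T n sg v| ≤
      1 / k * (p * maxCount T n sg))} ≤ 2 * E := by
    by_cases hc : (cap : ℝ) / 4 ≤ p * maxCount T n sg
    · have hle : Real.exp (-((1 / k) ^ 2 * (p * maxCount T n sg) / 4)) ≤ E := by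
        rw [hE, Real.exp_le_exp, neg_le_neg_iff]
        have : (cap : ℝ) / (16 * k ^ 2) = (1 / k) ^ 2 * (cap / 4) / 4 := by field_simp; norm_num
        rw [this]
        gcongr
      have h1 := headCount_ge_le hB hi (by positivity) he1 hM
      have h2 := headCount_le_le hB hi (by positivity) he1 hM
      refine (measureReal_mono (fun ω hω => ?_)).trans ((measureReal_union_le
        {ω | p * H.card + 1 / k * (p * maxCount T n sg) ≤ headCount (coinBlock n i) H ω}
        {ω | headCount (coinBlock n i) H ω ≤ p * H.card - 1 / k * (p * maxCount T n sg)}).trans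
          (by linarith))
      have hω : ¬ _ := hω
      rw [Classical.not_imp, abs_le, not_and_or, not_le, not_le, longCount_eq] at hω
      rw [Set.mem_union, Set.mem_ofPred_eq, Set.mem_ofPred_eq]
      unfold fullCount at hω
      rcases hω.2 with h | h
      · right; linarith
      · left; linarith
    · simp [hc, hE0.le]
  have hb : coinMeasure.real {ω | ¬ (p * (maxCount T n sg : ℝ) < cap / 2 →
      longCount T n sg ω i v ≤ cap)} ≤ E := by
    by_cases hc : p * (maxCount T n sg : ℝ) < cap / 2
    · have h1 := headCount_ge_le hB hi zero_le_one le_rfl (hM.trans hc.le)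
      refine (measureReal_mono fun ω hω => ?_).trans (h1.trans ?_)
      · have hω : ¬ _ := hω
        rw [Classical.not_imp, not_le, ← @Nat.cast_lt ℝ, longCount_eq] at hω
        rw [Set.mem_ofPred_eq]
        linarith [hω.2]
      · rw [hE, Real.exp_le_exp, neg_le_neg_iff, div_le_iff₀ (by positivity)]
        have : (1 : ℝ) ≤ k ^ 2 := one_le_pow₀ hk1
        nlinarith [(Nat.cast_nonneg cap : (0 : ℝ) ≤ cap)]
    · simp [hc, hE0.le]
  refine (measureReal_mono (fun ω hω => ?_)).trans
    ((measureReal_union_le _ _).trans (add_le_add ha hb)) |>.trans (by linarith)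
  by_contra hcon
  simp only [Set.mem_union, Set.mem_ofPred_eq, not_or, not_not] at hcon
  exact hω hcon

/-- The counts are as accurate as needed for all nodes and all rounds. -/
def AllAccurate (T : NodeTree) (n : ℕ) (sg : ℕ → Segment) (k cap L : ℕ) (ω : ℕ → Bool) : Prop :=
  ∀ i ≤ L, ∀ v < T.m, Accurate T n sg k cap i v ω

theorem not_allAccurate_le {k cap L : ℕ} (hk : 1 ≤ k) :
    coinMeasure.real {ω | ¬ AllAccurate T n sg k cap L ω} ≤
      (L + 1) * T.m * (3 * Real.exp (-(cap / (16 * k ^ 2)))) := by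
  refine (measureReal_mono (s₂ := ⋃ x ∈ Finset.range (L + 1) ×ˢ Finset.range T.m,
    {ω | ¬ Accurate T n sg k cap x.1 x.2 ω}) (fun ω hω => ?_) (measure_ne_top _ _)).trans
    ((measureReal_biUnion_finset_le _ _).trans
      ((Finset.sum_le_card_nsmul _ _ _ fun x hx => not_accurate_le hk ?_).trans ?_))
  · have hω : ¬ AllAccurate T n sg k cap L ω := hω
    simp only [AllAccurate, not_forall] at hω
    obtain ⟨i, hi, v, hv, h⟩ := hω
    simp only [Set.mem_iUnion]
    exact ⟨(i, v), by simp; omega, h⟩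
  · simp only [Finset.mem_product, Finset.mem_range] at hx
    exact hx.2
  · rw [Finset.card_product, Finset.card_range, Finset.card_range, nsmul_eq_mul]
    push_cast; rfl

/-- The capacity makes each failure probability at most 3·exp(-(d+4)L) ≤ 3·2^(-(d+4)L), and the
union bound runs over L + 1 rounds and all nodes. -/
theorem le_allAccurate {k d : ℕ} (hk : 1 ≤ k) (hn : 1 ≤ n) :
    ENNReal.ofReal (1 - 1 / (n : ℝ) ^ d) ≤ coinMeasure {ω | AllAccurate T n sg k
      (16 * k ^ 2 * (d + 4) * bits n T.m) (bits n T.m) ω} := by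
  set L := bits n T.m with hL
  have hpow : n + T.m < 2 ^ L := lt_two_pow_bits n T.m
  have hL1 : 1 ≤ L := by simp [hL, bits]
  have hn0 : (0 : ℝ) < n := by exact_mod_cast hn
  have hk0 : (0 : ℝ) < k := by exact_mod_cast hk
  have h := not_allAccurate_le (T := T) (n := n) (sg := sg) (cap := 16 * k ^ 2 * (d + 4) * L) (L := L) hk
  have hexp : Real.exp (-(((16 * k ^ 2 * (d + 4) * L : ℕ) : ℝ) / (16 * k ^ 2))) ≤
      1 / (2 : ℝ) ^ ((d + 4) * L) := by
    have : ((16 * k ^ 2 * (d + 4) * L : ℕ) : ℝ) / (16 * k ^ 2) = ((d + 4) * L : ℕ) := by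
      push_cast; field_simp
    rw [this, Real.exp_neg, ← one_div, ← Real.exp_one_pow]
    exact one_div_le_one_div_of_le (by positivity) (pow_le_pow_left₀ (by norm_num)
      (by linarith [Real.add_one_le_exp (1 : ℝ)]) _)
  -- Of the d + 4 factors 2^L, three pay for 3(L + 1) ≤ 8^L, one for the number of nodes, and d for
  -- n^d.
  have hnat : (L + 1) * T.m * 3 * n ^ d ≤ 2 ^ ((d + 4) * L) := by
    have h3 : 3 * (L + 1) ≤ 8 ^ L := by
      clear_value L
      clear hexp h hpow
      clear hL
      induction L, hL1 using Nat.le_induction with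
      | base => norm_num
      | succ l hl ih => rw [pow_succ]; omega
    calc (L + 1) * T.m * 3 * n ^ d = (3 * (L + 1)) * T.m * n ^ d := by ring
      _ ≤ 8 ^ L * 2 ^ L * (2 ^ L) ^ d := by gcongr <;> omega
      _ = 2 ^ ((d + 4) * L) := by
        rw [show (8 : ℕ) = 2 ^ 3 by norm_num, ← pow_mul, ← pow_mul, ← pow_add, ← pow_add]; ring_nf
  have hfail : coinMeasure.real {ω | ¬ AllAccurate T n sg k (16 * k ^ 2 * (d + 4) * L) L ω} ≤
      1 / (n : ℝ) ^ d := by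
    refine h.trans ?_
    calc _ ≤ (L + 1) * T.m * (3 * (1 / (2 : ℝ) ^ ((d + 4) * L))) := by gcongr
      _ = ((L + 1) * T.m * 3) / (2 : ℝ) ^ ((d + 4) * L) := by ring
      _ ≤ 1 / (n : ℝ) ^ d := by
        rw [div_le_div_iff₀ (by positivity) (by positivity), one_mul]
        exact_mod_cast hnat
  -- Subadditivity on an event and its complement gives the lower bound without measurability of the
  -- event.
  have hunion := measure_union_le (μ := coinMeasure)
    {ω | AllAccurate T n sg k (16 * k ^ 2 * (d + 4) * L) L ω}
    {ω | ¬ AllAccurate T n sg k (16 * k ^ 2 * (d + 4) * L) L ω}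
  have huniv : {ω | AllAccurate T n sg k (16 * k ^ 2 * (d + 4) * L) L ω} ∪
    {ω | ¬ AllAccurate T n sg k (16 * k ^ 2 * (d + 4) * L) L ω} = Set.univ :=
    Set.union_compl_self _
  rw [huniv, measure_univ, ← ofReal_measureReal] at hunion
  rw [ENNReal.ofReal_sub _ (by positivity), ENNReal.ofReal_one, tsub_le_iff_right]
  rw [ofReal_measureReal (s := {ω | AllAccurate T n sg k (16 * k ^ 2 * (d + 4) * L) L ω}),
    ← ofReal_measureReal (s := {ω | ¬ AllAccurate T n sg k (16 * k ^ 2 * (d + 4) * L) L ω})] at hunion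
  exact hunion.trans (by gcongr)

/-- If all counts are accurate, then the rounds produce an output with a small relative error. -/
theorem AllAccurate.found {k cap L done : ℕ} {A : ℕ → ℝ} {x : ℝ}
    (h : AllAccurate T n sg k cap L ω) (hcap : 2 ≤ cap) (hL : n < 2 ^ L)
    (hf : Found T n sg ω k cap A (L + 1) done x) : ∃ N' : ℕ → ℝ,
      (∀ v < T.m, |N' v - fullCount T n sg v| ≤ 1 / k * maxCount T n sg) ∧
      IsMax (baseValue n sg) (fun v => k / (2 * (k + 1)) * (A v / (T.D v / 2) + N' v)) T.m x := by
  have hcap' : (2 : ℝ) ≤ cap := by exact_mod_cast hcap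
  rcases hf with ⟨-, -, h'⟩ | ⟨-, j, hj, h1, h2, h3⟩
  -- Some round succeeds: in round `L` all means are below 1 ≤ cap/2, so accuracy rules out an
  -- overflow.
  · obtain ⟨v, hv, hlt⟩ := h' L (by omega)
    have := (h L le_rfl v hv).2 (by
      have h4 : (maxCount T n sg : ℝ) < 2 ^ L := by exact_mod_cast maxCount_le.trans_lt hL
      have h5 : (1 / 2 : ℝ) ^ L * maxCount T n sg < 1 := by
        rw [one_div, inv_pow, inv_mul_lt_one₀ (by positivity)]; exact h4
      linarith)
    omega
  · refine ⟨fun v => 2 ^ j * longCount T n sg ω j v, fun v hv => ?_, h3⟩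
    -- Without thinning the counts are exact. Otherwise the preceding round overflowed, so its
    -- largest mean was at least cap/2; one thinning later it is at least cap/4, which is the range
    -- of the accuracy guarantee.
    rcases Nat.eq_zero_or_pos j with rfl | hj0
    · simp only [longCount_zero, pow_zero, one_mul, sub_self, abs_zero]
      positivity
    · obtain ⟨i, rfl⟩ := Nat.exists_eq_add_of_le' hj0
      obtain ⟨w, hw, hlt⟩ := h1 i (by omega)
      have h4 : (cap : ℝ) / 2 ≤ (1 / 2) ^ i * maxCount T n sg := by
        by_contra hcon
        exact absurd ((h i (by omega) w hw).2 (not_le.1 hcon)) (by omega)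
      have h5 := (h (i + 1) (by omega) v hv).1 (by rw [pow_succ]; linarith)
      have e : (2 : ℝ) ^ (i + 1) * longCount T n sg ω (i + 1) v - fullCount T n sg v =
          2 ^ (i + 1) * (longCount T n sg ω (i + 1) v - (1 / 2) ^ (i + 1) * fullCount T n sg v) := by
        rw [mul_sub, ← mul_assoc, ← mul_pow]; norm_num
      rw [e, abs_mul, abs_of_pos (by positivity)]
      calc _ ≤ (2 : ℝ) ^ (i + 1) * (1 / k * ((1 / 2) ^ (i + 1) * maxCount T n sg)) := by gcongr
        _ = (2 * (1 / 2 : ℝ)) ^ (i + 1) * (1 / k * maxCount T n sg) := by rw [mul_pow]; ring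
        _ = _ := by norm_num

end Congestion

-- From quadtrees to memory contents, quality of the output, and conclusion.

namespace Congestion

open RealRAM

/-! ## The coordinates of a quadtree -/

namespace CanonicalSquare

theorem side_pos (Q : CanonicalSquare) : 0 < Q.side := by unfold side; positivity

theorem toSet_subset_iff {Q R : CanonicalSquare} : Q.toSet ⊆ R.toSet ↔
    (R.left ≤ Q.left ∧ Q.left + Q.side ≤ R.left + R.side) ∧
      R.bottom ≤ Q.bottom ∧ Q.bottom + Q.side ≤ R.bottom + R.side := by
  constructor
  · intro h
    have hs := Q.side_pos
    have key : ∀ t, 0 ≤ t → t < Q.side → (!₂[Q.left + t, Q.bottom + t] : Point) ∈ R.toSet := by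
      intro t h0 h1
      refine h ⟨?_, ?_, ?_, ?_⟩ <;> simp <;> linarith
    have h0 := key 0 le_rfl hs
    simp only [toSet, Set.mem_ofPred_eq] at h0 key
    simp at h0 key
    refine ⟨⟨h0.1, ?_⟩, h0.2.2.1, ?_⟩ <;> by_contra! hcon
    -- If the right edge of `Q` stuck out, this point of `Q` would lie on or beyond the open right
    -- edge of `R`. The maximum with 0 keeps it in `Q`.
    · have := (key (max 0 (R.left + R.side - Q.left)) (le_max_left _ _)
        (max_lt hs (by linarith))).2.1
      linarith [le_max_right 0 (R.left + R.side - Q.left)]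
    · have := (key (max 0 (R.bottom + R.side - Q.bottom)) (le_max_left _ _)
        (max_lt hs (by linarith))).2.2.2
      linarith [le_max_right 0 (R.bottom + R.side - Q.bottom)]
  · rintro ⟨⟨h1, h2⟩, h3, h4⟩ x ⟨a, b, c, d⟩
    exact ⟨by linarith, by linarith, by linarith, by linarith⟩

theorem toSet_subset_box (Q : CanonicalSquare) : Q.toSet ⊆ box Q.left Q.bottom Q.side :=
  fun _ ⟨a, b, c, d⟩ => ⟨a, b.le, c, d.le⟩

namespace IsQuadrant

variable {R Q : CanonicalSquare}

theorem side (h : R.IsQuadrant Q) : R.side = Q.side / 2 := by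
  rw [CanonicalSquare.side, CanonicalSquare.side, h.1, pow_succ]; ring

theorem left (h : R.IsQuadrant Q) : R.left = Q.left + (R.col % 2 : ℕ) * (Q.side / 2) := by
  have e : (R.col : ℝ) = (2 * Q.col + R.col % 2 : ℕ) := by rw [← h.2.1]; congr 1; omega
  rw [CanonicalSquare.left, CanonicalSquare.left, h.side, e]; push_cast; ring

theorem bottom (h : R.IsQuadrant Q) : R.bottom = Q.bottom + (R.row % 2 : ℕ) * (Q.side / 2) := by
  have e : (R.row : ℝ) = (2 * Q.row + R.row % 2 : ℕ) := by rw [← h.2.2]; congr 1; omega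
  rw [CanonicalSquare.bottom, CanonicalSquare.bottom, h.side, e]; push_cast; ring

/-- The half of an interval in which a smaller interval lies. -/
theorem half {a x D d : ℝ} {b : ℕ} (hd : 0 < d) (h1 : a + (b % 2 : ℕ) * (D / 2) ≤ x)
    (h2 : x + d ≤ a + (b % 2 : ℕ) * (D / 2) + D / 2) :
    (b % 2 = 0 ∧ ¬ a + D / 2 ≤ x ∧ a ≤ x ∧ x + d ≤ a + D / 2) ∨
      (b % 2 = 1 ∧ a + D / 2 ≤ x ∧ x + d ≤ a + D) := by
  rcases Nat.mod_two_eq_zero_or_one b with h | h <;> rw [h] at h1 h2 ⊢ <;> push_cast at h1 h2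
  · left; exact ⟨rfl, by linarith, by linarith, by linarith⟩
  · right; exact ⟨rfl, by linarith, by linarith⟩

end IsQuadrant

end CanonicalSquare

namespace Quadtree

variable {m : ℕ} (T : Quadtree m)

theorem exists_quadrant {v : Fin m} (hv : v ≠ T.root) : ∃ R : CanonicalSquare,
    R.IsQuadrant (T.cell (T.parent v)) ∧ (T.cell v).toSet ⊆ R.toSet ∧
    (T.cell v).side ≤ (T.cell (T.parent v)).side / 2 ∧
    ((R.col % 2 = 0 ∧ ¬ (T.cell (T.parent v)).left + (T.cell (T.parent v)).side / 2 ≤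
        (T.cell v).left ∧ (T.cell (T.parent v)).left ≤ (T.cell v).left ∧
        (T.cell v).left + (T.cell v).side ≤
          (T.cell (T.parent v)).left + (T.cell (T.parent v)).side / 2) ∨
      (R.col % 2 = 1 ∧ (T.cell (T.parent v)).left + (T.cell (T.parent v)).side / 2 ≤
        (T.cell v).left ∧ (T.cell v).left + (T.cell v).side ≤
          (T.cell (T.parent v)).left + (T.cell (T.parent v)).side)) ∧
    ((R.row % 2 = 0 ∧ ¬ (T.cell (T.parent v)).bottom + (T.cell (T.parent v)).side / 2 ≤
        (T.cell v).bottom ∧ (T.cell (T.parent v)).bottom ≤ (T.cell v).bottom ∧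
        (T.cell v).bottom + (T.cell v).side ≤
          (T.cell (T.parent v)).bottom + (T.cell (T.parent v)).side / 2) ∨
      (R.row % 2 = 1 ∧ (T.cell (T.parent v)).bottom + (T.cell (T.parent v)).side / 2 ≤
        (T.cell v).bottom ∧ (T.cell v).bottom + (T.cell v).side ≤
          (T.cell (T.parent v)).bottom + (T.cell (T.parent v)).side)) := by
  obtain ⟨R, hR, hsub⟩ := T.cell_subset v hv
  obtain ⟨⟨h1, h2⟩, h3, h4⟩ := CanonicalSquare.toSet_subset_iff.1 hsub
  rw [hR.left, hR.side] at h2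
  rw [hR.left] at h1
  rw [hR.bottom, hR.side] at h4
  rw [hR.bottom] at h3
  exact ⟨R, hR, hsub, by linarith,
    CanonicalSquare.IsQuadrant.half (T.cell v).side_pos h1 h2,
    CanonicalSquare.IsQuadrant.half (T.cell v).side_pos h3 h4⟩

/-- A function on the nodes, extended by a default value. -/
def extend {α : Type} (f : Fin m → α) (a : α) (i : ℕ) : α := if h : i < m then f ⟨i, h⟩ else a

theorem extend_of_lt {α : Type} (f : Fin m → α) (a : α) {i : ℕ} (h : i < m) :
    extend f a i = f ⟨i, h⟩ := dif_pos h

/-- The data of a quadtree as they are stored in the memory. -/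
noncomputable def toNodeTree : NodeTree where
  m := m
  root := T.root
  par := extend (fun v => (T.parent v : ℕ)) 0
  X := extend (fun v => (T.cell v).left) 0
  Y := extend (fun v => (T.cell v).bottom) 0
  D := extend (fun v => (T.cell v).side) 0
  lev := extend (fun v => (T.cell v).level) 0
  root_lt := T.root.2
  par_lt v hv := by rw [extend_of_lt _ _ hv]; exact (T.parent _).2
  par_root := by rw [extend_of_lt _ _ T.root.2, T.parent_root]
  side v hv := by rw [extend_of_lt _ _ hv, extend_of_lt _ _ hv]; rfl
  D_end := by simp [extend]
  grid v hv := by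
    rw [extend_of_lt _ _ hv, extend_of_lt _ _ hv, extend_of_lt _ _ hv]
    exact ⟨(T.cell ⟨v, hv⟩).col, (T.cell ⟨v, hv⟩).row, by push_cast; exact ⟨rfl, rfl⟩⟩
  lev_lt v hv hr := by
    have hr' : (⟨v, hv⟩ : Fin m) ≠ T.root := fun h => hr (congrArg Fin.val h)
    obtain ⟨R, -, -, h, -⟩ := T.exists_quadrant hr'
    rw [extend_of_lt _ _ hv, extend_of_lt _ _ hv, extend_of_lt _ _ (T.parent _).2]
    have h' : (1 / 2 : ℝ) ^ (T.cell ⟨v, hv⟩).level < (1 / 2) ^ (T.cell (T.parent ⟨v, hv⟩)).level :=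
      h.trans_lt (half_lt_self (T.cell _).side_pos)
    exact (pow_lt_pow_iff_right_of_lt_one₀ (by norm_num) (by norm_num)).1 h'
  quadX v hv hr := by
    have hr' : (⟨v, hv⟩ : Fin m) ≠ T.root := fun h => hr (congrArg Fin.val h)
    obtain ⟨R, -, -, -, h, -⟩ := T.exists_quadrant hr'
    rw [extend_of_lt _ _ hv, extend_of_lt _ _ (T.parent _).2, extend_of_lt _ _ hv,
      extend_of_lt _ _ hv, extend_of_lt _ _ (T.parent _).2]
    exact h.imp (fun h => h.2.2) fun h => h.2
  quadY v hv hr := by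
    have hr' : (⟨v, hv⟩ : Fin m) ≠ T.root := fun h => hr (congrArg Fin.val h)
    obtain ⟨R, -, -, -, -, h⟩ := T.exists_quadrant hr'
    rw [extend_of_lt _ _ hv, extend_of_lt _ _ (T.parent _).2, extend_of_lt _ _ hv,
      extend_of_lt _ _ hv, extend_of_lt _ _ (T.parent _).2]
    exact h.imp (fun h => h.2.2) fun h => h.2
  sib v w hv hw hvr hwr hp hX hY := by
    by_contra hne
    have hvr' : (⟨v, hv⟩ : Fin m) ≠ T.root := fun h => hvr (congrArg Fin.val h)
    have hwr' : (⟨w, hw⟩ : Fin m) ≠ T.root := fun h => hwr (congrArg Fin.val h)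
    rw [extend_of_lt _ _ hv, extend_of_lt _ _ hw] at hp
    have hp' : T.parent ⟨v, hv⟩ = T.parent ⟨w, hw⟩ := Fin.ext hp
    rw [extend_of_lt _ _ hv, extend_of_lt _ _ (T.parent _).2, extend_of_lt _ _ hv,
      extend_of_lt _ _ hw, extend_of_lt _ _ (T.parent _).2] at hX hY
    obtain ⟨R, hR, hRs, -, hRX, hRY⟩ := T.exists_quadrant hvr'
    obtain ⟨Q, hQ, hQs, -, hQX, hQY⟩ := T.exists_quadrant hwr'
    rw [← hp'] at hQ hQX hQY
    have hc : Q.col = R.col := by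
      have := hR.2.1
      have := hQ.2.1
      have : Q.col % 2 = R.col % 2 := by
        rcases hRX with ⟨e, h, -⟩ | ⟨e, h, -⟩ <;> rcases hQX with ⟨e', h', -⟩ | ⟨e', h', -⟩
        · rw [e, e']
        · exact absurd (hX.2 h') h
        · exact absurd (hX.1 h) h'
        · rw [e, e']
      omega
    have hr : Q.row = R.row := by
      have := hR.2.2
      have := hQ.2.2
      have : Q.row % 2 = R.row % 2 := by
        rcases hRY with ⟨e, h, -⟩ | ⟨e, h, -⟩ <;> rcases hQY with ⟨e', h', -⟩ | ⟨e', h', -⟩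
        · rw [e, e']
        · exact absurd (hY.2 h') h
        · exact absurd (hY.1 h) h'
        · rw [e, e']
      omega
    have hQR : Q = R := by
      have := hQ.1.trans hR.1.symm
      cases Q; cases R; simp_all
    exact T.siblings _ _ hvr' hwr' (fun h => hne (congrArg Fin.val h)) hp' R hR ⟨hRs, hQR ▸ hQs⟩

end Quadtree

/-- The segments, indexed by the natural numbers. -/
def extendSegments {n : ℕ} (S : Fin n → Segment) (i : ℕ) : Segment :=
  if h : i < n then S ⟨i, h⟩ else ⟨0, 0⟩

theorem extendSegments_coe {n : ℕ} (S : Fin n → Segment) :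
    (fun i : Fin n => extendSegments S i) = S := by
  funext i; simp [extendSegments]

theorem start_inputState {n m : ℕ} (S : Fin n → Segment) (T : Quadtree m) :
    Start T.toNodeTree n (extendSegments S) (inputState S T) where
  inp := by
    refine ⟨rfl, rfl, rfl, rfl, ?_, ?_, ?_, ?_, rfl, rfl, rfl⟩ <;> funext i <;>
      by_cases h : i < n <;> simp [inputState, extendSegments, h]
  nat a ha := by
    obtain ⟨b, rfl⟩ := Nat.exists_eq_add_of_le' ha; rfl
  real a ha := by
    obtain ⟨b, rfl⟩ := Nat.exists_eq_add_of_le' ha; rfl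
  coins := rfl

end Congestion

namespace Congestion

open RealRAM
variable {T : NodeTree} {n : ℕ} {sg : ℕ → Segment} {ω : ℕ → Bool} {B c₂ : ℕ} {ent : ℕ → ℕ} {A : ℕ → ℝ}

/-! ## The quality of the output -/

/-- A set of natural numbers as a set of segments. -/
def toFin (n : ℕ) (F : Finset ℕ) : Finset (Fin n) := Finset.univ.filter fun i => (i : ℕ) ∈ F

theorem mem_toFin {F : Finset ℕ} {i : Fin n} : i ∈ toFin n F ↔ (i : ℕ) ∈ F := by simp [toFin]

theorem sum_toFin {F : Finset ℕ} (hF : ∀ s ∈ F, s < n) (f : ℕ → ℝ) :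
    ∑ i ∈ toFin n F, f i = ∑ s ∈ F, f s :=
  Finset.sum_nbij (fun i => (i : ℕ)) (fun _ hi => mem_toFin.1 hi)
    (fun _ _ _ _ h => Fin.ext h) (fun s hs => ⟨⟨s, hF s hs⟩, mem_toFin.2 hs, rfl⟩) fun _ _ => rfl

theorem card_toFin {F : Finset ℕ} (hF : ∀ s ∈ F, s < n) : (toFin n F).card = F.card := by
  have := sum_toFin hF fun _ => 1
  simpa using this

theorem mem_longSet_range {s v : ℕ} : s ∈ longSet T sg (Finset.range n) v ↔
    s < n ∧ 0 < (sg s).len ∧ T.D v / 2 ≤ (sg s).len ∧ Hits T sg s v := by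
  classical
  simp [longSet]

theorem EntriesSpec.nonneg (he : EntriesSpec T n sg B ent A) {v : ℕ} (hv : v < T.m) : 0 ≤ A v := by
  obtain ⟨F, hF⟩ := he.short
  rw [(hF v hv).1]
  exact Finset.sum_nonneg fun s _ => (sg s).len_nonneg

theorem EntriesSpec.weight_le (he : EntriesSpec T n sg B ent A) {v : ℕ} (hv : v < T.m) :
    A v / (T.D v / 2) + fullCount T n sg v ≤ 2 * congestion fun i : Fin n => sg i := by
  obtain ⟨F, hF⟩ := he.short
  obtain ⟨h1, h2, -⟩ := hF v hv
  have h := weight_le_congestion (fun i : Fin n => sg i) (T.D_pos hv)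
    (F := toFin n (F v)) (N := toFin n (longSet T sg (Finset.range n) v)) (l := T.X v) (b := T.Y v)
    (fun i hi => (h2 i (mem_toFin.1 hi)).2)
    (fun i hi => (mem_longSet_range.1 (mem_toFin.1 hi)).2.2)
  rw [sum_toFin (fun s hs => (h2 s hs).1) fun s => (sg s).len, ← h1,
    card_toFin fun s hs => (mem_longSet_range.1 hs).1] at h
  unfold fullCount
  linarith

/-- A short segment not recorded at `v` satisfies D > 2^(L + c₂)·2·`gside`. As n ≤ 2^L and its
length is below `gside`, n times its length is at most 2^(-c₂)·D/2, which is the negligible case of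
`squareCongestion_le_weight`. -/
theorem EntriesSpec.le_weight (he : EntriesSpec T n sg (bits n T.m + c₂) ent A) {v : ℕ}
    (hv : v < T.m) {Q : Set Point} (hQ : Q ⊆ box (T.X v) (T.Y v) (T.D v)) :
    squareCongestion (fun i : Fin n => sg i) Q (T.D v / 2) ≤
      A v / (T.D v / 2) + (1 / 2) ^ c₂ + 2 * √2 * fullCount T n sg v := by
  obtain ⟨F, hF⟩ := he.short
  obtain ⟨h1, h2, h3⟩ := hF v hv
  have h := squareCongestion_le_weight (fun i : Fin n => sg i) (T.D_pos hv)
    (δ := (1 / 2) ^ c₂) (by positivity) hQ (F := toFin n (F v))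
    (N := toFin n (longSet T sg (Finset.range n) v)) (fun i h0 hs hm hi => ?_)
    (fun i h0 hl hm => mem_toFin.2 (mem_longSet_range.2 ⟨i.2, h0, hl, hm⟩))
  · rw [sum_toFin (fun s hs => (h2 s hs).1) fun s => (sg s).len, ← h1,
      card_toFin fun s hs => (mem_longSet_range.1 hs).1] at h
    exact h
  · have h4 : ¬ T.D v ≤ 2 ^ (bits n T.m + c₂) * (2 * gside (sg i)) := fun hle =>
      hi (mem_toFin.2 (h3 i i.2 h0 hs hm hle))
    rw [not_le, pow_add] at h4
    have h5 : (n : ℝ) ≤ 2 ^ bits n T.m := by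
      exact_mod_cast ((Nat.le_add_right _ _).trans_lt (lt_two_pow_bits n T.m)).le
    have h6 : (sg i).len * n * 2 ^ c₂ ≤ T.D v / 2 := by
      have h7 := (len_lt_gside (sg i)).le
      have h8 := (gside_pos (sg i)).le
      calc (sg i).len * n * 2 ^ c₂ ≤ gside (sg i) * 2 ^ bits n T.m * 2 ^ c₂ := by gcongr
        _ ≤ T.D v / 2 := by nlinarith
    have h8 : (1 / 2 : ℝ) ^ c₂ * 2 ^ c₂ = 1 := by rw [← mul_pow]; norm_num
    calc (sg i).len * n = (1 / 2) ^ c₂ * ((sg i).len * n * 2 ^ c₂) := by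
          rw [mul_comm _ ((2 : ℝ) ^ c₂), ← mul_assoc, h8, one_mul]
      _ ≤ _ := by gcongr

theorem exists_fullCount_eq_max : ∃ v < T.m, fullCount T n sg v = maxCount T n sg := by
  obtain ⟨v, hv, h⟩ := Finset.exists_mem_eq_sup (Finset.range T.m) ⟨T.root, by simpa using T.root_lt⟩
    (fullCount T n sg)
  exact ⟨v, by simpa using hv, h.symm⟩

theorem baseValue_le : baseValue n sg ≤ congestion fun i : Fin n => sg i := by
  classical
  unfold baseValue
  split_ifs with h
  · obtain ⟨s, hs, hl⟩ := h
    exact one_le_congestion (fun i : Fin n => sg i) ⟨s, hs⟩ hl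
  · exact congestion_nonneg _

theorem baseValue_nonneg : 0 ≤ baseValue n sg := by
  classical
  unfold baseValue; split_ifs <;> norm_num

/-- Accurate counts lead to an output that is a lower bound for the congestion. -/
theorem EntriesSpec.output_le (he : EntriesSpec T n sg B ent A) {k : ℕ} (hk : 1 ≤ k) {N' : ℕ → ℝ}
    (hN : ∀ v < T.m, |N' v - fullCount T n sg v| ≤ 1 / k * maxCount T n sg) {x : ℝ}
    (hx : IsMax (baseValue n sg) (fun v => k / (2 * (k + 1)) * (A v / (T.D v / 2) + N' v)) T.m x) :
    x ≤ congestion fun i : Fin n => sg i := by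
  rcases hx.attained with rfl | ⟨v, hv, rfl⟩
  · exact baseValue_le
  · have hk0 : (0 : ℝ) < k := by exact_mod_cast hk
    obtain ⟨w, hw, hmax⟩ := exists_fullCount_eq_max (T := T) (n := n) (sg := sg)
    have h1 := he.weight_le hv
    have h2 := he.weight_le hw
    have h3 : 0 ≤ A w / (T.D w / 2) := div_nonneg (he.nonneg hw) (by linarith [T.D_pos hw])
    rw [hmax] at h2
    have h4 := (abs_le.1 (hN v hv)).2
    have h5 : 1 / k * (maxCount T n sg : ℝ) ≤ 1 / k * (2 * congestion fun i : Fin n => sg i) := by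
      gcongr; linarith
    -- The largest count is itself at most twice the congestion, so overestimation costs at most a
    -- factor 1 + 1/k. The factor k/(2(k+1)) in the estimate is the reciprocal of 2(1 + 1/k).
    calc _ ≤ k / (2 * (k + 1)) * ((1 + 1 / k) * (2 * congestion fun i : Fin n => sg i)) := by
          gcongr; linarith
      _ = _ := by field_simp

/-- Accurate counts lead to an output that is not much smaller than the congestion of a cell. -/
theorem EntriesSpec.le_output (he : EntriesSpec T n sg (bits n T.m + c₂) ent A) {ε : ℝ} {k : ℕ}
    (hk : 2 ≤ k) (hε : 24 ≤ ε * (k - 1)) (hc : (1 / 2) ^ c₂ ≤ ε / 2) {N' : ℕ → ℝ}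
    (hN : ∀ v < T.m, |N' v - fullCount T n sg v| ≤ 1 / k * maxCount T n sg) {x : ℝ}
    (hx : IsMax (baseValue n sg) (fun v => k / (2 * (k + 1)) * (A v / (T.D v / 2) + N' v)) T.m x)
    {v : ℕ} (hv : v < T.m) {Q : Set Point} (hQ : Q ⊆ box (T.X v) (T.Y v) (T.D v)) :
    squareCongestion (fun i : Fin n => sg i) Q (T.D v / 2) ≤ (4 * √2 + ε) * x := by
  classical
  have hk2 : (2 : ℝ) ≤ k := by exact_mod_cast hk
  have hε0 : 0 < ε := by
    have : (0 : ℝ) < (1 / 2) ^ c₂ := by positivity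
    linarith
  have hb := hx.base
  by_cases hpos : ∃ s < n, 0 < (sg s).len
  swap
  · have h := squareCongestion_le_weight (fun i : Fin n => sg i) (T.D_pos hv) le_rfl hQ
      (F := ∅) (N := ∅) (fun i h0 => absurd ⟨i, i.2, h0⟩ hpos) (fun i h0 => absurd ⟨i, i.2, h0⟩ hpos)
    have h0 : 0 ≤ x := baseValue_nonneg.trans hb
    refine h.trans ?_
    simp only [Finset.sum_empty, zero_div, Finset.card_empty, Nat.cast_zero, mul_zero, add_zero]
    positivity
  rw [baseValue, if_pos hpos] at hb
  have hest : ∀ w < T.m, k * (A w / (T.D w / 2) + N' w) ≤ 2 * (k + 1) * x := by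
    intro w hw
    have h : k / (2 * (k + 1)) * (A w / (T.D w / 2) + N' w) ≤ x := hx.le w hw
    rw [div_mul_eq_mul_div, div_le_iff₀ (by positivity)] at h
    linarith
  have hkN : ∀ w < T.m, k * (fullCount T n sg w : ℝ) ≤ k * N' w + maxCount T n sg := by
    intro w hw
    have h := (abs_le.1 (hN w hw)).1
    have h' : (k : ℝ) * (1 / k * maxCount T n sg) = maxCount T n sg := by field_simp
    nlinarith
  obtain ⟨w, hw, hmax⟩ := exists_fullCount_eq_max (T := T) (n := n) (sg := sg)
  have hAw : 0 ≤ A w / (T.D w / 2) := div_nonneg (he.nonneg hw) (by linarith [T.D_pos hw])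
  have hAv : 0 ≤ A v / (T.D v / 2) := div_nonneg (he.nonneg hv) (by linarith [T.D_pos hv])
  have h1 := hkN w hw
  rw [hmax] at h1
  have h2 := hest w hw
  have h3 := hkN v hv
  have h4 := hest v hv
  have h5 := he.le_weight hv hQ
  have hs1 : 1 ≤ √2 := by rw [Real.one_le_sqrt]; norm_num
  have hs2 : √2 ≤ 3 / 2 := by rw [Real.sqrt_le_left (by norm_num)]; norm_num
  set W := A v / (T.D v / 2) + fullCount T n sg v with hW
  -- The estimate at the node with the largest count bounds that count by the output, so the error
  -- at every other node is bounded by the output too.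
  have hNm : (k - 1) * (maxCount T n sg : ℝ) ≤ 2 * (k + 1) * x := by nlinarith
  have hWk : k * W ≤ 2 * (k + 1) * x + maxCount T n sg := by rw [hW]; nlinarith
  have hW1 : (k - 1) * W ≤ 2 * (k + 1) * x := by
    have : k * ((k - 1) * W) ≤ k * (2 * (k + 1) * x) := by nlinarith
    exact le_of_mul_le_mul_left this (by linarith)
  -- 2(k + 1)/(k - 1) = 2 + 4/(k - 1), and 24 ≤ ε(k - 1).
  have hW2 : W ≤ (2 + ε / 6) * x := by
    have : (k - 1) * W ≤ (k - 1) * ((2 + ε / 6) * x) := by nlinarith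
    exact le_of_mul_le_mul_left this (by linarith)
  have hcount : (0 : ℝ) ≤ fullCount T n sg v := Nat.cast_nonneg _
  -- The additive error is at most ε/2 ≤ (ε/2)·x because x ≥ 1. The other half of ε covers 2√2·ε/6,
  -- as √2 ≤ 3/2.
  calc _ ≤ 2 * √2 * W + ε / 2 * x := by rw [hW]; nlinarith
    _ ≤ 2 * √2 * ((2 + ε / 6) * x) + ε / 2 * x := by gcongr
    _ ≤ _ := by nlinarith [mul_nonneg hε0.le (zero_le_one.trans hb)]

/-! ## The running time in terms of the logarithm -/

/-- From 2^bits ≤ 2(n + m) ≤ 2(1 + |K|)(n + 1) by logarithms. The constant term is absorbed since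
log(n + 1) ≥ log 2 for n ≥ 1. -/
theorem bits_le {K : ℝ} {n m : ℕ} (hn : 1 ≤ n) (hm : (m : ℝ) ≤ K * n) :
    (bits n m : ℝ) ≤ (Real.log (2 * (1 + |K|)) / Real.log 2 + 1) / Real.log 2 * Real.log (n + 1) := by
  have hn1 : (1 : ℝ) ≤ n := by exact_mod_cast hn
  have hl2 : 0 < Real.log 2 := Real.log_pos (by norm_num)
  have hln : Real.log 2 ≤ Real.log (n + 1) := Real.log_le_log (by norm_num) (by linarith)
  have hK : 0 ≤ Real.log (2 * (1 + |K|)) := Real.log_nonneg (by linarith [abs_nonneg K])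
  have h1 : (2 : ℝ) ^ bits n m ≤ 2 * (1 + |K|) * (n + 1) := by
    have h := Nat.pow_log_le_self 2 (x := n + m) (by omega)
    have h' : (2 : ℝ) ^ Nat.log 2 (n + m) ≤ n + m := by exact_mod_cast h
    rw [bits, pow_succ]
    have : K * n ≤ |K| * n := by gcongr; exact le_abs_self K
    nlinarith [abs_nonneg K]
  have h2 := Real.log_le_log (by positivity) h1
  rw [Real.log_pow, Real.log_mul (by positivity) (by positivity)] at h2
  rw [div_mul_eq_mul_div, le_div_iff₀ hl2, add_mul, one_mul]
  refine h2.trans (add_le_add_left ?_ _)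
  rw [div_mul_eq_mul_div, le_div_iff₀ hl2]
  gcongr

theorem treeCongestion_le {n m : ℕ} {S : Fin n → Segment} {T : Quadtree m} {c : ℝ}
    (h : ∀ v, squareCongestion S (T.cell v).toSet (T.cell v).radius ≤ c) :
    treeCongestion S T ≤ c :=
  have : Nonempty (Fin m) := ⟨T.root⟩
  ciSup_le h

end Congestion

theorem mainTheorem2 (ε : ℝ) (hε : 0 < ε) (d : ℕ) :
    ∃ P : RealRAM.Prog, ∀ K : ℝ, ∃ C : ℝ, ∀ (n m : ℕ), (m : ℝ) ≤ K * n →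
      ∀ (S : Fin n → Congestion.Segment) (T : Congestion.Quadtree m),
        RealRAM.expectedTime P (Congestion.inputState S T) ≤
          ENNReal.ofReal (C * n * Real.log (n + 1) ^ 2) ∧
        ENNReal.ofReal (1 - 1 / (n : ℝ) ^ d) ≤
          RealRAM.coinMeasure {ω | ∃ c : ℝ, Congestion.Outputs P S T ω c ∧
            Congestion.treeCongestion S T / (4 * Real.sqrt 2 + ε) ≤ c ∧
            c ≤ Congestion.congestion S} := by
  open Congestion RealRAM in
  obtain ⟨k', hk'⟩ := exists_nat_ge (24 / ε)
  obtain ⟨c₂, hc₂⟩ := exists_pow_lt_of_lt_one (half_pos hε) (by norm_num : (1 / 2 : ℝ) < 1)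
  set k := k' + 2 with hk
  have hkε : 24 ≤ ε * ((k : ℝ) - 1) := by
    rw [div_le_iff₀ hε] at hk'
    rw [hk]; push_cast; nlinarith
  set c₁ := 16 * k ^ 2 * (d + 4) with hc₁
  obtain ⟨C₀, hC₀⟩ := bounded_mainCost k c₁ c₂
  -- The program depends on ε and d only; K enters through the constant in the time bound.
  refine ⟨mainProg k c₁ c₂, fun K => ?_⟩
  set cK := (Real.log (2 * (1 + |K|)) / Real.log 2 + 1) / Real.log 2 with hcK
  refine ⟨C₀ * (1 + |K|) * cK ^ 2, fun n m hm S T => ?_⟩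
  -- For n = 0 there would be no nodes, but a quadtree has a root.
  have hn : 1 ≤ n := by
    rcases Nat.eq_zero_or_pos n with rfl | h
    · have : m = 0 := by simpa using hm
      subst this
      exact T.root.elim0
    · exact h
  have hm1 : 1 ≤ m := T.root.pos
  set sg := extendSegments S with hsg
  have hwp := fun ω => mainProg_wp (ω := ω) (k := k) (c₁ := c₁) (c₂ := c₂) (start_inputState S T)
  have hSsg : (fun i : Fin n => sg i) = S := extendSegments_coe S
  set L := bits n m with hL
  have hL1 : 1 ≤ L := by simp [hL, bits]
  constructor
  · calc expectedTime (mainProg k c₁ c₂) (inputState S T)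
        ≤ ∫⁻ _, (mainCost k c₁ c₂ n m L : ℝ≥0∞) ∂coinMeasure :=
          lintegral_mono fun ω => runTime_le (hwp ω)
      _ = (mainCost k c₁ c₂ n m L : ℝ≥0∞) := by simp
      _ = ENNReal.ofReal (mainCost k c₁ c₂ n m L) := (ENNReal.ofReal_natCast _).symm
      _ ≤ _ := ENNReal.ofReal_le_ofReal ?_
    have h1 : (mainCost k c₁ c₂ n m L : ℝ) ≤ C₀ * ((n + m) * L ^ 2) := by
      have := hC₀ n m L hm1 hL1
      rw [pow_one] at this
      exact_mod_cast this
    have h2 : (n : ℝ) + m ≤ (1 + |K|) * n := by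
      have : K * n ≤ |K| * n := by gcongr; exact le_abs_self K
      linarith
    have h3 := bits_le hn hm
    calc (mainCost k c₁ c₂ n m L : ℝ) ≤ C₀ * ((n + m) * L ^ 2) := h1
      _ ≤ C₀ * (((1 + |K|) * n) * (cK * Real.log (n + 1)) ^ 2) := by gcongr
      _ = _ := by ring
  · refine (le_allAccurate (T := T.toNodeTree) (sg := sg) (k := k) (d := d) (by omega) hn).trans
      (measure_mono fun ω hω => ?_)
    have hω : AllAccurate T.toNodeTree n sg k (c₁ * L) L ω := hω
    obtain ⟨t, -, τ, hex, ent, A, done, he, hf⟩ := hwp ω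
    have hcap : 2 ≤ c₁ * L := by
      have : 1 ≤ c₁ := Nat.one_le_iff_ne_zero.2 (by positivity)
      have h2 : 2 ≤ c₁ := by
        rw [hc₁]; nlinarith [Nat.one_le_pow 2 k (by omega), Nat.zero_le d]
      nlinarith
    obtain ⟨N', hN, hx⟩ := hω.found hcap
      ((Nat.le_add_right _ _).trans_lt (lt_two_pow_bits n m)) hf
    refine ⟨τ.real 7 0, ⟨t, τ, hex, rfl⟩, ?_, ?_⟩
    · rw [div_le_iff₀ (by positivity), mul_comm]
      refine treeCongestion_le fun v => ?_
      have h := he.le_output (by omega) hkε hc₂.le hN hx (v := v) v.2 (Q := (T.cell v).toSet) (by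
        simpa [Quadtree.toNodeTree, Quadtree.extend] using (T.cell v).toSet_subset_box)
      rw [hSsg] at h
      simpa [Quadtree.toNodeTree, Quadtree.extend, CanonicalSquare.radius] using h
    · have h := he.output_le (by omega) hN hx
      rwa [hSsg] at h
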